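/- Let $\alpha>0$ and $\varepsilon>0$ be real constants. If the minimum MEG-set problem has a polynomial-time $(\alpha\ln n)$-approximation algorithm, then Set Cover has a polynomial-time $((2\alpha+\varepsilon)\ln N)$-approximation algorithm. Here the terms have the following meaning. * Minimum MEG-set. An instance is a finite connected undirected simple graph $G$ on $n$ vertices. A pair $x,y$ of vertices monitors an edge $e$ if $e$ lies on every shortest path between $x$ and $y$ in $G$. A set $M\subseteq V(G)$ is a MEG-set (monitoring edge-geodetic set) if every edge of $G$ is monitored by some pair $x,y\in M$. The goal is to find a MEG-set of minimum cardinality. * Set Cover. An instance consists of $\eta$ items and $h$ distinct sets of items such that every item belongs to at least one of the sets; $N=h+\eta$. The goal is to choose as few of the sets as possible so that every item belongs to a chosen set. * A polynomial-time $r$-approximation algorithm is a deterministic Turing machine that, on every instance, runs in time polynomial in the length of the encoding of the instance and outputs a feasible solution whose cardinality is at most $\max\{1,r\}$ times the minimum cardinality of a feasible solution, where $r$ is evaluated at $n$, respectively at $N$. A graph is encoded by its number of vertices in unary and its adjacency matrix, a Set Cover instance by $h$ and $\eta$ in unary and its incidence matrix, and a solution by its characteristic vector. -/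

import Mathlib

/-- A minimisation problem whose solutions are subsets of a finite ground set attached to each
instance. The cost of a solution is its cardinality. -/
structure SubsetMinProblem where
  /-- the instances -/
  Inst : Type
  /-- the size parameter in which approximation ratios are expressed -/
  size : Inst → ℕ
  /-- the number of elements of the ground set of an instance -/
  ground : Inst → ℕ
  /-- the feasible solutions of an instance -/
  Feasible : (a : Inst) → Finset (Fin (ground a)) → Prop
  /-- the binary string by which an instance is given to an algorithm -/
  encode : Inst → List Bool

/-- The characteristic bit vector of a subset of `{0, …, n - 1}`. -/
def indicator {n : ℕ} (S : Finset (Fin n)) : List Bool :=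
  List.ofFn fun i => decide (i ∈ S)

/-- `P` has a (deterministic) polynomial-time `r`-approximation algorithm: a Turing machine that
reads the encoding of an instance `a`, halts after a number of steps polynomial in the length of
that encoding, and outputs the characteristic vector of a feasible solution whose cardinality is at
most the approximation ratio times that of every feasible solution (hence of an optimal one).
Approximation ratios are at least `1` by definition, so a value `r (size a) < 1` (which a
logarithmic ratio takes at finitely many small sizes) is read as `1`. -/
def HasPolyTimeApprox (P : SubsetMinProblem) (r : ℕ → ℝ) : Prop :=
  ∃ A : (a : P.Inst) → Finset (Fin (P.ground a)),
    Nonempty (Turing.TM2ComputableInPolyTime P.encode (id : List Bool → List Bool)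
      (fun a => indicator (A a))) ∧
    ∀ a : P.Inst, P.Feasible a (A a) ∧
      ∀ S : Finset (Fin (P.ground a)), P.Feasible a S →
        ((A a).card : ℝ) ≤ max 1 (r (P.size a)) * (S.card : ℝ)

/-- The pair `x, y` monitors `e`: the edge `e` lies on every shortest path between `x` and `y`. -/
def Monitors {V : Type*} (G : SimpleGraph V) (x y : V) (e : Sym2 V) : Prop :=
  ∀ p : G.Walk x y, p.length = G.dist x y → e ∈ p.edges

/-- `M` is a monitoring edge-geodetic set of `G`. -/
def IsMEGSet {V : Type*} (G : SimpleGraph V) (M : Finset V) : Prop :=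
  ∀ e ∈ G.edgeSet, ∃ x ∈ M, ∃ y ∈ M, Monitors G x y e

/-- A finite connected graph. -/
structure ConnectedGraph where
  /-- the number of vertices -/
  n : ℕ
  graph : SimpleGraph (Fin n)
  connected : graph.Connected

open Classical in
/-- The number of vertices in unary, followed by the adjacency matrix, row by row. -/
noncomputable def ConnectedGraph.encode (G : ConnectedGraph) : List Bool :=
  List.replicate G.n true ++ [false] ++
    (List.ofFn fun u : Fin G.n => List.ofFn fun v : Fin G.n =>
      decide (G.graph.Adj u v)).flatten

/-- The minimum MEG-set problem; the size of a graph is its number of vertices. -/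
noncomputable def minMEGSet : SubsetMinProblem where
  Inst := ConnectedGraph
  size G := G.n
  ground G := G.n
  Feasible G M := IsMEGSet G.graph M
  encode G := G.encode

/-- A Set Cover instance: `η` items and `h` distinct sets of items whose union contains
every item. -/
structure SetCoverInstance where
  /-- the number of items -/
  η : ℕ
  /-- the number of sets -/
  h : ℕ
  sets : Fin h → Finset (Fin η)
  distinct : Function.Injective sets
  covered : ∀ i : Fin η, ∃ j : Fin h, i ∈ sets j

/-- The numbers of sets and of items in unary, followed by the incidence matrix, set by set. -/
def SetCoverInstance.encode (I : SetCoverInstance) : List Bool :=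
  List.replicate I.h true ++ [false] ++ List.replicate I.η true ++ [false] ++
    (List.ofFn fun j : Fin I.h => List.ofFn fun i : Fin I.η =>
      decide (i ∈ I.sets j)).flatten

/-- The Set Cover problem: choose as few of the sets as possible so that every item is covered. The
size of an instance is `N = h + η`, the number of sets plus the number of items. -/
def setCover : SubsetMinProblem where
  Inst := SetCoverInstance
  size I := I.h + I.η
  ground I := I.h
  Feasible I C := ∀ i : Fin I.η, ∃ j ∈ C, i ∈ I.sets j
  encode I := I.encode

/-! The reduction turns a set system into a graph with `k₁ * k₂` copies of it that share
comparatively few further vertices. The copy `(p, q)` has a vertex `s j p q` for each set `j` and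
`r` hubs `y a p q`; every shared vertex (`Core`) carries a pendant leaf. The leaves monitor all
edges apart from those between a hub `y a p q` and an item vertex `X i a`. Such an edge is monitored
by `s j p q` and the leaf of `X i a` if the set `j` contains the item `i`. Otherwise `W j p` opens a
second path of length two from `s j p q` to `X i a`, and a geodesic that enters the hub in any other
way, or starts before `s j p q`, can be rerouted through another copy or through `D`. Hence in each
copy a MEG-set contains all hubs or else set vertices that form a cover (`Vtx.isMEGSet_of_cover`,
`Vtx.exists_mem_of_isMEGSet`).

Let `c` be the optimum of Set Cover, `β = 2 * α + ε` and `τ = β * ln N * c`. Repeating an optimal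
cover in every copy and adding the leaves gives a MEG-set, so a `ρ`-approximate one has at most `ρ *
(k₁ * k₂ * c + leaves)` vertices. Take `k₁` about `D * β * ln N`, `k₂ = D * N` and `r` just above
`τ`, for a large constant `D`. Then the leaves are at most a fraction `6 / D` of `k₁ * k₂ * c`, and
the graph has `O(N² ln N)` vertices, so that `α * ln n` is `2 * α * ln N` up to lower order terms;
the square is the source of the factor two. By averaging, some copy contains at most `τ < r` chosen
vertices. It misses a hub, so its chosen set vertices are a cover of size at most `τ`
(`exists_good_parameters`, `Vtx.exists_good_copy`).

The right `k₁` and `r` depend on `ln N` and on the unknown `c`. The algorithm therefore tries `N`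
values of each and keeps the smallest cover found, starting from the family of all sets; finitely
many small instances are answered from a table. To obtain a genuine Turing machine, this is written
as a structured program (`Frag`) over unary counters and bit registers which calls the given machine
as a subroutine. Rules in the style of Hoare logic (`Runs`, `Exec`, `Emits`) carry correctness and
explicit time bounds together. -/

section

open Turing Function

/-! ### Program fragments for multi-stack machines -/

namespace StackProg

/-- `c` reaches `c'` in at most `t` iterations of the partial step function `f`. -/
def Reach {C : Type*} (f : C → Option C) (t : ℕ) (c c' : C) : Prop :=
  ∃ n ≤ t, (flip bind f)^[n] (some c) = some c'

theorem Reach.mono {C : Type*} {f : C → Option C} {t t' : ℕ} {c c' : C} (h : Reach f t c c')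
    (ht : t ≤ t') : Reach f t' c c' :=
  let ⟨n, hn, e⟩ := h
  ⟨n, hn.trans ht, e⟩

theorem Reach.trans {C : Type*} {f : C → Option C} {t t' : ℕ} {c c' c'' : C} (h : Reach f t c c')
    (h' : Reach f t' c' c'') : Reach f (t + t') c c'' := by
  obtain ⟨n, hn, e⟩ := h
  obtain ⟨n', hn', e'⟩ := h'
  exact ⟨n' + n, by omega, by rw [iterate_add_apply, e, e']⟩

theorem Reach.single {C : Type*} {f : C → Option C} {c c' : C} (h : f c = some c') :
    Reach f 1 c c' :=
  ⟨1, le_rfl, h⟩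

variable {S : Type} [DecidableEq S]

/-- The stack alphabets of a machine with Boolean stacks `S` next to the stacks of `aux`. -/
abbrev Alph (S : Type) (aux : TM2ComputableAux Bool Bool) : S ⊕ aux.tm.K → Type :=
  Sum.elim (fun _ => Bool) aux.tm.Γ

/-- The internal states of a machine that may call `aux`. -/
abbrev Vars (aux : TM2ComputableAux Bool Bool) : Type := Option Bool × aux.tm.σ

/-- Statements of a machine with Boolean stacks `S` that may call `aux`. -/
abbrev Code (S : Type) (aux : TM2ComputableAux Bool Bool) (L : Type) : Type :=
  TM2.Stmt (Alph S aux) L (Vars aux)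

/-- A program fragment: code with one entry whose exit is a label to be supplied. -/
structure Frag (S : Type) (aux : TM2ComputableAux Bool Bool) where
  /-- the labels of the fragment -/
  Lab : Type
  [fin : Fintype Lab]
  /-- the label at which execution starts -/
  entry : Lab
  /-- the code, given the embedding of the labels into those of a machine and the exit -/
  code : {L : Type} → (Lab → L) → L → Lab → Code S aux L

attribute [instance] Frag.fin

variable {aux : TM2ComputableAux Bool Bool}

/-- All stacks of the machine: the Boolean stacks and those of the called machine. -/
def allStk (s : S → List Bool) (s' : ∀ k, List (aux.tm.Γ k)) :
    ∀ k : S ⊕ aux.tm.K, List (Alph S aux k)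
  | .inl x => s x
  | .inr k => s' k

theorem update_allStk_inl (s : S → List Bool) (s' : ∀ k, List (aux.tm.Γ k)) (x : S)
    (l : List Bool) :
    update (allStk s s') (.inl x) l = allStk (update s x l) s' := by
  funext k
  rcases k with y | k
  · by_cases h : y = x
    · subst h
      exact (update_self _ _ _).trans (update_self (β := fun _ => List Bool) _ _ _).symm
    · exact (update_of_ne (by simpa using h) _ _).trans
        (update_of_ne (β := fun _ => List Bool) h _ _).symm
  · exact update_of_ne (by simp) _ _

theorem update_allStk_inr (s : S → List Bool) (s' : ∀ k, List (aux.tm.Γ k)) (k : aux.tm.K)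
    (l : List (aux.tm.Γ k)) :
    update (allStk s s') (.inr k) l = allStk s (update s' k l) := by
  funext k'
  rcases k' with y | k'
  · exact update_of_ne (by simp) _ _
  · by_cases h : k' = k
    · subst h
      exact (update_self _ _ _).trans (update_self (β := fun k => List (aux.tm.Γ k)) _ _ _).symm
    · exact (update_of_ne (by simpa using h) _ _).trans
        (update_of_ne (β := fun k => List (aux.tm.Γ k)) h _ _).symm

theorem step_eq {L : Type} {m : L → Code S aux L} {l : L} {c : Code S aux L} (h : m l = c)
    (v : Vars aux) (s : ∀ k, List (Alph S aux k)) :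
    TM2.step m ⟨some l, v, s⟩ = some (TM2.stepAux c v s) := by
  rw [TM2.step, h]

/-- The configuration between two fragments: label `l`, stack contents `s`. -/
def cfgAt {L : Type} (l : L) (s : S → List Bool) : TM2.Cfg (Alph S aux) L (Vars aux) :=
  ⟨some l, (none, aux.tm.initialState), allStk s fun _ => []⟩

/-- The fragment `p` transforms the stack contents `s` into `s'` in at most `t` steps. -/
def Runs (p : Frag S aux) (s s' : S → List Bool) (t : ℕ) : Prop :=
  ∀ ⦃L : Type⦄ (m : L → Code S aux L) (emb : p.Lab → L) (ex : L),
    (∀ l, m (emb l) = p.code emb ex l) →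
    Reach (TM2.step m) t (cfgAt (emb p.entry) s) (cfgAt ex s')

theorem Runs.mono {p : Frag S aux} {s s' : S → List Bool} {t t' : ℕ} (h : Runs p s s' t)
    (ht : t ≤ t') : Runs p s s' t' :=
  fun _ m emb ex hm => (h m emb ex hm).mono ht

/-- Push the bit `b` on the stack `x`. -/
def Frag.push (x : S) (b : Bool) : Frag S aux where
  Lab := Unit
  entry := ()
  code _ ex _ := .push (.inl x) (fun _ => b) (.goto fun _ => ex)

theorem runs_push (x : S) (b : Bool) (s : S → List Bool) :
    Runs (aux := aux) (.push x b) s (update s x (b :: s x)) 1 := by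
  intro L m emb ex hm
  apply Reach.single
  refine (step_eq (hm _) _ _).trans ?_
  rw [cfgAt, ← update_allStk_inl]
  rfl

/-- Remove the top of the stack `x`. -/
def Frag.pop (x : S) : Frag S aux where
  Lab := Unit
  entry := ()
  code _ ex _ := .pop (.inl x) (fun v _ => v) (.goto fun _ => ex)

theorem runs_pop (x : S) (s : S → List Bool) :
    Runs (aux := aux) (.pop x) s (update s x (s x).tail) 1 := by
  intro L m emb ex hm
  apply Reach.single
  refine (step_eq (hm _) _ _).trans ?_
  rw [cfgAt, ← update_allStk_inl]
  rfl

/-- Do nothing. -/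
def Frag.skip : Frag S aux where
  Lab := Unit
  entry := ()
  code _ ex _ := .goto fun _ => ex

theorem runs_skip (s : S → List Bool) : Runs (aux := aux) .skip s s 1 := by
  intro L m emb ex hm
  exact Reach.single (step_eq (hm _) _ _)

/-- Sequential composition. -/
def Frag.seq (p q : Frag S aux) : Frag S aux where
  Lab := p.Lab ⊕ q.Lab
  entry := .inl p.entry
  code emb ex
    | .inl l => p.code (emb ∘ .inl) (emb (.inr q.entry)) l
    | .inr l => q.code (emb ∘ .inr) ex l

/-- `Runs` quantifies over all host machines, label embeddings and exits, so both halves can be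
instantiated inside the machine that hosts the composition. -/
theorem Runs.seq {p q : Frag S aux} {s s' s'' : S → List Bool} {t t' : ℕ} (hp : Runs p s s' t)
    (hq : Runs q s' s'' t') : Runs (p.seq q) s s'' (t + t') := fun _ m emb ex hm =>
  (hp m (emb ∘ .inl) (emb (.inr q.entry)) fun l => hm (.inl l)).trans
    (hq m (emb ∘ .inr) ex fun l => hm (.inr l))

/-- Branch on the top of the stack `x`. -/
def Frag.ite (x : S) (c : Option Bool → Bool) (p q : Frag S aux) : Frag S aux where
  Lab := Unit ⊕ p.Lab ⊕ q.Lab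
  entry := .inl ()
  code emb ex
    | .inl _ => .peek (.inl x) (fun v o => (o, v.2)) <| .branch (fun v => c v.1)
        (.load (fun v => (none, v.2)) (.goto fun _ => emb (.inr (.inl p.entry))))
        (.load (fun v => (none, v.2)) (.goto fun _ => emb (.inr (.inr q.entry))))
    | .inr (.inl l) => p.code (emb ∘ .inr ∘ .inl) ex l
    | .inr (.inr l) => q.code (emb ∘ .inr ∘ .inr) ex l

theorem Runs.ite_true {p q : Frag S aux} {x : S} {c : Option Bool → Bool} {s s' : S → List Bool}
    {t : ℕ} (hc : c (s x).head? = true) (hp : Runs p s s' t) :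
    Runs (.ite x c p q) s s' (t + 1) := by
  intro L m emb ex hm
  rw [add_comm]
  refine Reach.trans (Reach.single ?_) (hp m (emb ∘ .inr ∘ .inl) ex fun l => hm (.inr (.inl l)))
  refine (step_eq (hm _) _ _).trans ?_
  exact congrArg (fun b : Bool => some (cond b _ _)) hc

theorem Runs.ite_false {p q : Frag S aux} {x : S} {c : Option Bool → Bool} {s s' : S → List Bool}
    {t : ℕ} (hc : c (s x).head? = false) (hq : Runs q s s' t) :
    Runs (.ite x c p q) s s' (t + 1) := by
  intro L m emb ex hm
  rw [add_comm]
  refine Reach.trans (Reach.single ?_) (hq m (emb ∘ .inr ∘ .inr) ex fun l => hm (.inr (.inr l)))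
  refine (step_eq (hm _) _ _).trans ?_
  exact congrArg (fun b : Bool => some (cond b _ _)) hc

/-- Repeat `p` as long as the top of the stack `x` satisfies `c`. -/
def Frag.loop (x : S) (c : Option Bool → Bool) (p : Frag S aux) : Frag S aux where
  Lab := Unit ⊕ p.Lab
  entry := .inl ()
  code emb ex
    | .inl _ => .peek (.inl x) (fun v o => (o, v.2)) <| .branch (fun v => c v.1)
        (.load (fun v => (none, v.2)) (.goto fun _ => emb (.inr p.entry)))
        (.load (fun v => (none, v.2)) (.goto fun _ => ex))
    | .inr l => p.code (emb ∘ .inr) (emb (.inl ())) l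

theorem runs_loop_exit {p : Frag S aux} {x : S} {c : Option Bool → Bool} {s : S → List Bool}
    (hc : c (s x).head? = false) : Runs (.loop x c p) s s 1 := by
  intro L m emb ex hm
  apply Reach.single
  refine (step_eq (hm _) _ _).trans ?_
  exact congrArg (fun b : Bool => some (cond b _ _)) hc

theorem Runs.loop_step {p : Frag S aux} {x : S} {c : Option Bool → Bool} {s s' s'' : S → List Bool}
    {t t' : ℕ} (hc : c (s x).head? = true) (hp : Runs p s s' t)
    (hl : Runs (.loop x c p) s' s'' t') : Runs (.loop x c p) s s'' (1 + t + t') := by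
  intro L m emb ex hm
  refine Reach.trans (Reach.trans (Reach.single ?_)
    (hp m (emb ∘ .inr) (emb (.inl ())) fun l => hm (.inr l))) (hl m emb ex hm)
  refine (step_eq (hm _) _ _).trans ?_
  exact congrArg (fun b : Bool => some (cond b _ _)) hc

/-- Statements of the called machine, with `halt` replaced by a jump to `ex`. -/
def liftStmt {L : Type} (emb : aux.tm.Λ → L) (ex : L) :
    TM2.Stmt aux.tm.Γ aux.tm.Λ aux.tm.σ → Code S aux L
  | .push k f q => .push (.inr k) (fun v => f v.2) (liftStmt emb ex q)
  | .peek k f q => .peek (.inr k) (fun v o => (v.1, f v.2 o)) (liftStmt emb ex q)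
  | .pop k f q => .pop (.inr k) (fun v o => (v.1, f v.2 o)) (liftStmt emb ex q)
  | .load f q => .load (fun v => (v.1, f v.2)) (liftStmt emb ex q)
  | .branch f q q' => .branch (fun v => f v.2) (liftStmt emb ex q) (liftStmt emb ex q')
  | .goto f => .goto fun v => emb (f v.2)
  | .halt => .goto fun _ => ex

/-- A configuration of the called machine as one of the calling machine. -/
def liftCfg {L : Type} (emb : aux.tm.Λ → L) (ex : L) (s : S → List Bool)
    (c : TM2.Cfg aux.tm.Γ aux.tm.Λ aux.tm.σ) : TM2.Cfg (Alph S aux) L (Vars aux) :=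
  ⟨some (c.l.elim ex emb), (none, c.var), allStk s c.stk⟩

/-- A lifted statement touches only the stacks and the state component of the called machine. Its
`halt` is a jump to `ex`, which is also what `liftCfg` makes of the label `none`. -/
theorem stepAux_liftStmt {L : Type} (emb : aux.tm.Λ → L) (ex : L) (s : S → List Bool)
    (q : TM2.Stmt aux.tm.Γ aux.tm.Λ aux.tm.σ) (v : aux.tm.σ) (s' : ∀ k, List (aux.tm.Γ k)) :
    TM2.stepAux (liftStmt emb ex q) (none, v) (allStk s s') =
      liftCfg emb ex s (TM2.stepAux q v s') := by
  induction q generalizing v s' with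
  | push k f q ih =>
    simp only [liftStmt, TM2.stepAux]
    rw [← ih, ← update_allStk_inr]; rfl
  | peek k f q ih =>
    simp only [liftStmt, TM2.stepAux]
    rw [← ih]; rfl
  | pop k f q ih =>
    simp only [liftStmt, TM2.stepAux]
    rw [← ih, ← update_allStk_inr]; rfl
  | load f q ih => simp only [liftStmt, TM2.stepAux]; rw [← ih]
  | branch f q q' ih ih' =>
    simp only [liftStmt, TM2.stepAux]
    cases f v
    · exact ih' v s'
    · exact ih v s'
  | goto f => rfl
  | halt => rfl

theorem iterate_bind_none {C : Type*} (f : C → Option C) (n : ℕ) :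
    (flip bind f)^[n] none = none := by
  induction n with
  | zero => rfl
  | succ n ih => rw [iterate_succ_apply]; exact ih

theorem iterate_liftCfg {L : Type} (m : L → Code S aux L) (emb : aux.tm.Λ → L) (ex : L)
    (hm : ∀ l, m (emb l) = liftStmt emb ex (aux.tm.m l)) (s : S → List Bool) (n : ℕ)
    (c c' : TM2.Cfg aux.tm.Γ aux.tm.Λ aux.tm.σ)
    (h : (flip bind (TM2.step aux.tm.m))^[n] (some c) = some c') :
    (flip bind (TM2.step m))^[n] (some (liftCfg emb ex s c)) = some (liftCfg emb ex s c') := by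
  induction n generalizing c with
  | zero =>
    simp only [iterate_zero, id_eq, Option.some.injEq] at h
    rw [h]; rfl
  | succ n ih =>
    rw [iterate_succ_apply] at h ⊢
    obtain ⟨l, v, s'⟩ := c
    cases l with
    | none =>
      -- A halted configuration has no successor, hence reaches nothing in `n + 1` steps.
      exfalso
      change (flip bind (TM2.step aux.tm.m))^[n] none = some c' at h
      rw [iterate_bind_none] at h
      exact absurd h (by simp)
    | some l =>
      rw [← ih _ h]
      congr 1
      refine (step_eq (hm _) _ _).trans ?_
      rw [stepAux_liftStmt]

/-- Move the contents of the stack `x` to the input stack of `aux`, run `aux`, and move the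
contents of its output stack to `x`. -/
def Frag.call (x : S) : Frag S aux where
  Lab := Unit ⊕ aux.tm.Λ ⊕ Unit
  fin := by
    haveI := aux.tm.ΛFin
    infer_instance
  entry := .inl ()
  code emb ex
    | .inl _ => .pop (.inl x) (fun v o => (o, v.2)) <| .branch (fun v => v.1.isSome)
        (.push (.inr aux.tm.k₀) (fun v => aux.inputAlphabet.symm (v.1.getD true)) <|
          .load (fun v => (none, v.2)) (.goto fun _ => emb (.inl ())))
        (.goto fun _ => emb (.inr (.inl aux.tm.main)))
    | .inr (.inl l) => liftStmt (emb ∘ .inr ∘ .inl) (emb (.inr (.inr ()))) (aux.tm.m l)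
    | .inr (.inr _) => .pop (.inr aux.tm.k₁) (fun v o => (o.map aux.outputAlphabet, v.2)) <|
        .branch (fun v => v.1.isSome)
        (.push (.inl x) (fun v => v.1.getD true) <|
          .load (fun v => (none, v.2)) (.goto fun _ => emb (.inr (.inr ()))))
        (.goto fun _ => ex)

theorem initList_eq (tm : FinTM2) (l : List (tm.Γ tm.k₀)) :
    initList tm l = ⟨some tm.main, tm.initialState, update (fun _ => []) _ l⟩ := by
  unfold initList
  congr 1
  funext k
  by_cases h : k = tm.k₀
  · subst h; simp
  · simp [h]

theorem haltList_eq (tm : FinTM2) (l : List (tm.Γ tm.k₁)) :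
    haltList tm l = ⟨none, tm.initialState, update (fun _ => []) _ l⟩ := by
  unfold haltList
  congr 1
  funext k
  by_cases h : k = tm.k₁
  · subst h; simp
  · simp [h]

/-- The machine `aux` maps the word `w` to `w'` in at most `t` steps. -/
def Outputs (aux : TM2ComputableAux Bool Bool) (w w' : List Bool) (t : ℕ) : Prop :=
  Nonempty (TM2OutputsInTime aux.tm (w.map aux.inputAlphabet.invFun)
    (some (w'.map aux.outputAlphabet.invFun)) t)

/-- Moving a stack symbol by symbol reverses it; therefore `x` holds the input reversed and receives
the output reversed. A machine that halts as `haltList` prescribes has its initial state and no data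
left besides the output, so it is ready for another call. -/
theorem runs_call (x : S) (s : S → List Bool) (w w' : List Bool) (t : ℕ)
    (hx : s x = w.reverse) (h : Outputs aux w w' t) :
    Runs (aux := aux) (.call x) s (update s x w'.reverse) (w.length + t + w'.length + 2) := by
  intro L m emb ex hm
  obtain ⟨⟨⟨n, hn⟩, hnt⟩⟩ := h
  have step1 : ∀ (s₁ : S → List Bool) (s₂ : ∀ k, List (aux.tm.Γ k)),
      TM2.step m ⟨some (emb (.inl ())), (none, aux.tm.initialState), allStk s₁ s₂⟩ =
        some (cond (s₁ x).head?.isSome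
          ⟨some (emb (.inl ())), (none, aux.tm.initialState),
            update (update (allStk s₁ s₂) (.inl x) (s₁ x).tail) (.inr aux.tm.k₀)
              (aux.inputAlphabet.symm ((s₁ x).head?.getD true) ::
                update (allStk s₁ s₂) (.inl x) (s₁ x).tail (.inr aux.tm.k₀))⟩
          ⟨some (emb (.inr (.inl aux.tm.main))), ((s₁ x).head?, aux.tm.initialState),
            update (allStk s₁ s₂) (.inl x) (s₁ x).tail⟩) :=
    fun s₁ s₂ => step_eq (hm _) _ _
  have step2 : ∀ (s₁ : S → List Bool) (s₂ : ∀ k, List (aux.tm.Γ k)),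
      TM2.step m ⟨some (emb (.inr (.inr ()))), (none, aux.tm.initialState), allStk s₁ s₂⟩ =
        some (cond ((s₂ aux.tm.k₁).head?.map aux.outputAlphabet).isSome
          ⟨some (emb (.inr (.inr ()))), (none, aux.tm.initialState),
            update (update (allStk s₁ s₂) (.inr aux.tm.k₁) (s₂ aux.tm.k₁).tail) (.inl x)
              (((s₂ aux.tm.k₁).head?.map aux.outputAlphabet).getD true ::
                update (allStk s₁ s₂) (.inr aux.tm.k₁) (s₂ aux.tm.k₁).tail (.inl x))⟩
          ⟨some ex, ((s₂ aux.tm.k₁).head?.map aux.outputAlphabet, aux.tm.initialState),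
            update (allStk s₁ s₂) (.inr aux.tm.k₁) (s₂ aux.tm.k₁).tail⟩) :=
    fun s₁ s₂ => step_eq (hm _) _ _
  simp only [update_allStk_inl, update_allStk_inr] at step1 step2
  simp only [allStk] at step1 step2
  have load : ∀ (l : List Bool) (r : List (aux.tm.Γ aux.tm.k₀)),
      Reach (TM2.step m) (l.length + 1)
        ⟨some (emb (.inl ())), (none, aux.tm.initialState),
          allStk (update s x l) (update (fun _ => []) aux.tm.k₀ r)⟩
        ⟨some (emb (.inr (.inl aux.tm.main))), (none, aux.tm.initialState),
          allStk (update s x []) (update (fun _ => []) aux.tm.k₀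
            (l.reverse.map aux.inputAlphabet.invFun ++ r))⟩ := by
    intro l
    induction l with
    | nil =>
      intro r
      apply Reach.single
      rw [step1]
      simp
    | cons b l ih =>
      intro r
      have h1 := (Reach.single (step1 (update s x (b :: l))
        (update (fun _ => []) aux.tm.k₀ r)))
      simp only [update_self, List.head?_cons, Option.isSome_some, cond_true, List.tail_cons,
        update_idem, Option.getD_some] at h1
      erw [update_allStk_inr] at h1
      erw [update_idem] at h1
      have h2 := h1.trans (ih (aux.inputAlphabet.symm b :: r))
      rw [List.length_cons, add_comm]
      simpa using h2
  have unload : ∀ (l : List (aux.tm.Γ aux.tm.k₁)) (r : List Bool),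
      Reach (TM2.step m) (l.length + 1)
        ⟨some (emb (.inr (.inr ()))), (none, aux.tm.initialState),
          allStk (update s x r) (update (fun _ => []) aux.tm.k₁ l)⟩
        ⟨some ex, (none, aux.tm.initialState),
          allStk (update s x ((l.map aux.outputAlphabet).reverse ++ r)) (fun _ => [])⟩ := by
    intro l
    induction l with
    | nil =>
      intro r
      apply Reach.single
      rw [step2]
      simp
    | cons b l ih =>
      intro r
      have h1 := (Reach.single (step2 (update s x r)
        (update (fun _ => []) aux.tm.k₁ (b :: l))))
      simp only [update_self, List.head?_cons, Option.isSome_some, cond_true, List.tail_cons,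
        update_idem, Option.getD_some, Option.map_some] at h1
      erw [update_allStk_inl] at h1
      erw [update_idem] at h1
      have h2 := h1.trans (ih (aux.outputAlphabet b :: r))
      rw [List.length_cons, add_comm]
      simpa using h2
  have h1 := load (s x) []
  have h2 : Reach (TM2.step m) n _ _ := ⟨n, le_rfl, iterate_liftCfg m (emb ∘ .inr ∘ .inl)
    (emb (.inr (.inr ()))) (fun l => hm (.inr (.inl l))) (update s x []) n _ _ hn⟩
  have h3 := unload (w'.map aux.outputAlphabet.invFun) []
  rw [initList_eq, haltList_eq] at h2
  simp only [update_eq_self, hx, List.reverse_reverse, List.append_nil,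
    List.map_map] at h1 h3
  have hs : (⇑aux.outputAlphabet ∘ aux.outputAlphabet.invFun) = id := by
    funext b; simp
  rw [hs, List.map_id] at h3
  refine Reach.mono (t := (w.reverse.length + 1) +
    (n + ((w'.map aux.outputAlphabet.invFun).length + 1))) ?_ ?_
  · have h4 := h1.trans (h2.trans h3)
    rw [← hx, update_eq_self] at h4
    rw [← hx]
    exact h4
  · simp only at hnt
    simp only [List.length_reverse, List.length_map]
    omega

end StackProg

end

/-! ### From a program to a complete machine -/

section

open Turing Function

namespace StackProg

variable {S : Type} [DecidableEq S] [Fintype S] {aux : TM2ComputableAux Bool Bool}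

/-- The machine that runs the fragment `p` and halts; input on `x`, output on `y`. -/
def Frag.machine (p : Frag S aux) (x y : S) : FinTM2 :=
  haveI := aux.tm.kFin
  haveI := aux.tm.σFin
  { K := S ⊕ aux.tm.K
    kDecidableEq := inferInstance
    kFin := inferInstance
    k₀ := .inl x
    k₁ := .inl y
    Γ := Alph S aux
    Λ := Option p.Lab
    main := some p.entry
    ΛFin := inferInstance
    σ := Vars aux
    initialState := (none, aux.tm.initialState)
    σFin := inferInstance
    Γk₀Fin := inferInstanceAs (Fintype Bool)
    m := fun
      | none => .halt
      | some l => p.code some none l }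

/-- The format of `haltList` forces `p` to leave every stack except `y` empty. The time bound grows
by one for the final `halt` at the label `none`. -/
theorem nonempty_polyTime_of_runs (p : Frag S aux) (x y : S) {β : Type} (ea : β → List Bool)
    (f : β → List Bool) (T : Polynomial ℕ)
    (h : ∀ a, Runs p (update (fun _ => []) x (ea a)) (update (fun _ => []) y (f a))
      (T.eval (ea a).length)) :
    Nonempty (TM2ComputableInPolyTime ea (id : List Bool → List Bool) f) := by
  refine ⟨{ tm := p.machine x y, inputAlphabet := Equiv.refl Bool, outputAlphabet := Equiv.refl Bool,
            time := T + 1, outputsFun := fun a => Classical.choice ?_ }⟩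
  obtain ⟨n, hn, e⟩ := h a (p.machine x y).m some none (fun l => rfl)
  have hstk : ∀ (z : S) (l : List Bool), update (β := fun k => List (Alph S aux k))
      (fun _ => []) (.inl z) l = allStk (update (fun _ => []) z l) fun _ => [] := by
    intro z l
    rw [← update_allStk_inl]
    congr 1
    funext k
    cases k <;> rfl
  have hinit : initList (p.machine x y) ((ea a).map (Equiv.refl Bool).invFun) =
      cfgAt (some p.entry) (update (fun _ => []) x (ea a)) := by
    rw [initList_eq, cfgAt, ← hstk]
    exact congrArg (fun l => TM2.Cfg.mk _ _ (update (fun _ => []) _ l)) (List.map_id (ea a))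
  have hhalt : haltList (p.machine x y) ((f a).map (Equiv.refl Bool).invFun) =
      ⟨none, (none, aux.tm.initialState), allStk (update (fun _ => []) y (f a)) fun _ => []⟩ := by
    rw [haltList_eq, ← hstk]
    exact congrArg (fun l => TM2.Cfg.mk _ _ (update (fun _ => []) _ l)) (List.map_id (f a))
  refine ⟨⟨⟨n + 1, ?_⟩, ?_⟩⟩
  · rw [iterate_succ_apply', id_eq, Option.map_some, hhalt, hinit]
    refine (congrArg (flip bind (p.machine x y).step) e).trans ?_
    rfl
  · rw [Polynomial.eval_add, Polynomial.eval_one]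
    exact Nat.add_le_add_right hn 1

end StackProg

end

section

open Function

/-! ### Monitoring by walks of small length -/

section Monitoring

variable {V : Type*} {G : SimpleGraph V}

theorem Monitors.symm {x y : V} {e : Sym2 V} (h : Monitors G x y e) : Monitors G y x e := by
  intro p hp
  have := h p.reverse (by rw [SimpleGraph.Walk.length_reverse, hp, SimpleGraph.dist_comm])
  simpa using this

theorem monitors_of_adj {u v : V} (h : G.Adj u v) : Monitors G u v s(u, v) := by
  intro p hp
  rw [SimpleGraph.dist_eq_one_iff_adj.2 h] at hp
  cases p with
  | nil => simp at hp
  | cons h' q =>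
    cases q with
    | nil => simp
    | cons h'' q => simp at hp

/-- A geodesic has length at most two, and lengths zero and one are excluded, so it passes through
the only common neighbour. -/
theorem monitors_of_unique_two {u m v : V} (hum : G.Adj u m) (hmv : G.Adj m v) (huv : u ≠ v)
    (hn : ¬ G.Adj u v) (huniq : ∀ m', G.Adj u m' → G.Adj m' v → m' = m) :
    Monitors G u v s(u, m) ∧ Monitors G u v s(m, v) := by
  have key : ∀ p : G.Walk u v, p.length = G.dist u v → s(u, m) ∈ p.edges ∧ s(m, v) ∈ p.edges := by
    intro p hp
    have hd : G.dist u v ≤ 2 := SimpleGraph.dist_le (.cons hum (.cons hmv .nil))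
    rw [← hp] at hd
    cases p with
    | nil => exact absurd rfl huv
    | cons h₁ q =>
      cases q with
      | nil => exact absurd h₁ hn
      | cons h₂ q =>
        cases q with
        | nil =>
          obtain rfl := huniq _ h₁ h₂
          simp
        | cons h₃ q => simp at hd
  exact ⟨fun p hp => (key p hp).1, fun p hp => (key p hp).2⟩

theorem monitors_of_unique_three {u m m' v : V} (h₁ : G.Adj u m) (h₂ : G.Adj m m')
    (h₃ : G.Adj m' v) (huv : u ≠ v) (hn : ¬ G.Adj u v) (hn' : ∀ w, G.Adj u w → ¬ G.Adj w v)
    (huniq : ∀ w w', G.Adj u w → G.Adj w w' → G.Adj w' v → w = m ∧ w' = m') :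
    Monitors G u v s(u, m) ∧ Monitors G u v s(m, m') ∧ Monitors G u v s(m', v) := by
  have key : ∀ p : G.Walk u v, p.length = G.dist u v →
      s(u, m) ∈ p.edges ∧ s(m, m') ∈ p.edges ∧ s(m', v) ∈ p.edges := by
    intro p hp
    have hd : G.dist u v ≤ 3 := SimpleGraph.dist_le (.cons h₁ (.cons h₂ (.cons h₃ .nil)))
    rw [← hp] at hd
    cases p with
    | nil => exact absurd rfl huv
    | cons e₁ q =>
      cases q with
      | nil => exact absurd e₁ hn
      | cons e₂ q =>
        cases q with
        | nil => exact absurd e₂ (hn' _ e₁)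
        | cons e₃ q =>
          cases q with
          | nil =>
            obtain ⟨rfl, rfl⟩ := huniq _ _ e₁ e₂ e₃
            simp
          | cons e₄ q => simp at hd; omega
  exact ⟨fun p hp => (key p hp).1, fun p hp => (key p hp).2.1, fun p hp => (key p hp).2.2⟩

/-- A pendant vertex monitors its edge, and everything its neighbour monitors. -/
theorem Monitors.pendant {l c v : V} (hl : ∀ w, G.Adj l w → w = c) (hv : v ≠ l) {e : Sym2 V}
    (h : Monitors G c v e) : Monitors G l v e := by
  intro p hp
  cases p with
  | nil => exact absurd rfl hv
  | cons h₁ q =>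
    obtain rfl := hl _ h₁
    rw [SimpleGraph.Walk.edges_cons]
    -- The rest of a geodesic after its first edge is again a geodesic: a shorter walk from `c` to
    -- `v` would shorten `p`.
    refine List.mem_cons_of_mem _ (h q (le_antisymm ?_ (SimpleGraph.dist_le q)))
    obtain ⟨r, hr⟩ := q.reachable.exists_walk_length_eq_dist
    have := SimpleGraph.dist_le (SimpleGraph.Walk.cons h₁ r)
    rw [← hp] at this
    simp only [SimpleGraph.Walk.length_cons] at this
    omega

theorem monitors_pendant_edge {l c v : V} (hl : ∀ w, G.Adj l w → w = c) (hv : v ≠ l) :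
    Monitors G l v s(l, c) := by
  intro p _
  cases p with
  | nil => exact absurd rfl hv
  | cons h₁ q =>
    obtain rfl := hl _ h₁
    simp

theorem exists_append_of_mem_edges {u v x y : V} (p : G.Walk u v) (h : s(x, y) ∈ p.edges) :
    (∃ (h : G.Adj x y) (p₁ : G.Walk u x) (p₂ : G.Walk y v), p = p₁.append (.cons h p₂)) ∨
    (∃ (h : G.Adj y x) (p₁ : G.Walk u y) (p₂ : G.Walk x v), p = p₁.append (.cons h p₂)) := by
  induction p with
  | nil => simp at h
  | cons h' q ih =>
    rw [SimpleGraph.Walk.edges_cons, List.mem_cons] at h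
    rcases h with h | h
    · rw [Sym2.eq_iff] at h
      rcases h with ⟨rfl, rfl⟩ | ⟨rfl, rfl⟩
      · exact .inl ⟨h', .nil, q, rfl⟩
      · exact .inr ⟨h', .nil, q, rfl⟩
    · rcases ih h with ⟨h₁, p₁, p₂, rfl⟩ | ⟨h₁, p₁, p₂, rfl⟩
      · exact .inl ⟨h₁, .cons h' p₁, p₂, rfl⟩
      · exact .inr ⟨h₁, .cons h' p₁, p₂, rfl⟩

/-- No pair monitors an edge that can be avoided by changing a part of a geodesic. -/
theorem not_monitors_of_detour {u v w x : V} {e : Sym2 V} (p₁ : G.Walk u w) (q : G.Walk w x)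
    (p₂ : G.Walk x v) (hp : (p₁.append (q.append p₂)).length = G.dist u v) (hq : e ∈ q.edges)
    (r : G.Walk w x) (hr : r.length = q.length) (her : e ∉ r.edges) : ¬ Monitors G u v e := by
  intro hM
  -- A geodesic repeats no edge, so `e` occurs in the segment `q` only and disappears when `q` is
  -- replaced by `r`.
  have hn := ((SimpleGraph.Walk.isPath_of_length_eq_dist _ hp).isTrail).edges_nodup
  simp only [SimpleGraph.Walk.edges_append] at hn
  rw [List.nodup_append] at hn
  have h1 : e ∉ p₁.edges := fun h => hn.2.2 e h e (List.mem_append_left _ hq) rfl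
  have h2 : e ∉ p₂.edges := fun h => (List.nodup_append.1 hn.2.1).2.2 e hq e h rfl
  have := hM (p₁.append (r.append p₂)) (by
    rw [← hp]; simp only [SimpleGraph.Walk.length_append, hr])
  simp only [SimpleGraph.Walk.edges_append, List.mem_append] at this
  tauto

theorem IsMEGSet.map {W : Type*} {H : SimpleGraph W} (φ : G ≃g H) {M : Finset V}
    (h : IsMEGSet G M) : IsMEGSet H (M.map φ.toEquiv.toEmbedding) := by
  intro e he
  have he' : e.map φ.symm ∈ G.edgeSet := by
    induction e with
    | _ a b => exact (φ.symm.map_adj_iff).2 he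
  obtain ⟨x, hx, y, hy, hxy⟩ := h _ he'
  refine ⟨φ x, Finset.mem_map_of_mem _ hx, φ y, Finset.mem_map_of_mem _ hy, ?_⟩
  intro p hp
  have hd : G.dist x y = H.dist (φ x) (φ y) := by
    apply le_antisymm
    · rw [← hp]
      have := SimpleGraph.dist_le ((p.map φ.symm.toHom).copy (φ.symm_apply_apply x)
        (φ.symm_apply_apply y))
      simpa using this
    · by_cases hr : G.Reachable x y
      · obtain ⟨r, hr⟩ := hr.exists_walk_length_eq_dist
        rw [← hr]
        simpa using SimpleGraph.dist_le (r.map φ.toHom)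
      · exact absurd ⟨(p.map φ.symm.toHom).copy (φ.symm_apply_apply x)
          (φ.symm_apply_apply y)⟩ hr
  have := hxy ((p.map φ.symm.toHom).copy (φ.symm_apply_apply x) (φ.symm_apply_apply y))
    (by simpa [hd] using hp)
  simp only [SimpleGraph.Walk.edges_copy, SimpleGraph.Walk.edges_map, List.mem_map] at this
  obtain ⟨e', he', h⟩ := this
  have : e' = e := Sym2.map.injective φ.symm.injective h
  rwa [← this]

end Monitoring

/-! ### The graph -/

/-- Vertices of the graph that carry a pendant leaf. -/
inductive Core (J P Q A I : Type) : Type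
  | T (j : J) (p : P)
  | W (j : J) (p : P)
  | Y (a : A) (q : Q)
  | B (q : Q)
  | X (i : I) (a : A)
  | D

/-- The vertices of the graph: set vertices `s` and hubs `y` of the copy `(p, q)`, core vertices,
and their leaves. -/
inductive Vtx (J P Q A I : Type) : Type
  | s (j : J) (p : P) (q : Q)
  | y (a : A) (p : P) (q : Q)
  | core (c : Core J P Q A I)
  | leaf (c : Core J P Q A I)

namespace Vtx

variable {J P Q A I : Type} {mem : I → J → Prop}

/-- The edges of the graph, with one of their orientations. -/
inductive Arc (mem : I → J → Prop) : Vtx J P Q A I → Vtx J P Q A I → Prop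
  | sT (j : J) (p : P) (q : Q) : Arc mem (.s j p q) (.core (.T j p))
  | sW (j : J) (p : P) (q : Q) : Arc mem (.s j p q) (.core (.W j p))
  | sB (j : J) (p : P) (q : Q) : Arc mem (.s j p q) (.core (.B q))
  | sy (j : J) (a : A) (p : P) (q : Q) : Arc mem (.s j p q) (.y a p q)
  | yY (a : A) (p : P) (q : Q) : Arc mem (.y a p q) (.core (.Y a q))
  | yX (a : A) (p : P) (q : Q) (i : I) : Arc mem (.y a p q) (.core (.X i a))
  | WX (j : J) (p : P) (i : I) (a : A) : ¬ mem i j → Arc mem (.core (.W j p)) (.core (.X i a))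
  | DX (i : I) (a : A) : Arc mem (.core .D) (.core (.X i a))
  | leaf (c : Core J P Q A I) : Arc mem (.core c) (.leaf c)

/-- The graph built from a set system. -/
def graph (P Q A : Type) (mem : I → J → Prop) : SimpleGraph (Vtx J P Q A I) where
  Adj u v := Arc mem u v ∨ Arc mem v u
  symm := ⟨fun _ _ h => h.symm⟩
  loopless := ⟨fun u h => by rcases h with h | h <;> cases h⟩

theorem Arc.adj {u v : Vtx J P Q A I} (h : Arc mem u v) : (graph P Q A mem).Adj u v := .inl h

theorem Arc.adj' {u v : Vtx J P Q A I} (h : Arc mem u v) : (graph P Q A mem).Adj v u := .inr h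

theorem adj_leaf {c : Core J P Q A I} {v : Vtx J P Q A I}
    (h : (graph P Q A mem).Adj (.leaf c) v) : v = .core c := by
  rcases h with h | h <;> cases h
  rfl

theorem adj_T {j : J} {p : P} {v : Vtx J P Q A I}
    (h : (graph P Q A mem).Adj (.core (.T j p)) v) :
    (∃ q, v = .s j p q) ∨ v = .leaf (.T j p) := by
  rcases h with h | h <;> cases h <;> simp

theorem adj_W {j : J} {p : P} {v : Vtx J P Q A I}
    (h : (graph P Q A mem).Adj (.core (.W j p)) v) :
    (∃ q, v = .s j p q) ∨ (∃ i a, v = .core (.X i a)) ∨ v = .leaf (.W j p) := by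
  rcases h with h | h <;> cases h <;> simp

theorem adj_Y {a : A} {q : Q} {v : Vtx J P Q A I}
    (h : (graph P Q A mem).Adj (.core (.Y a q)) v) :
    (∃ p, v = .y a p q) ∨ v = .leaf (.Y a q) := by
  rcases h with h | h <;> cases h <;> simp

theorem adj_B {q : Q} {v : Vtx J P Q A I}
    (h : (graph P Q A mem).Adj (.core (.B q)) v) :
    (∃ j p, v = .s j p q) ∨ v = .leaf (.B q) := by
  rcases h with h | h <;> cases h <;> simp

theorem adj_X {i : I} {a : A} {v : Vtx J P Q A I}
    (h : (graph P Q A mem).Adj (.core (.X i a)) v) :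
    (∃ p q, v = .y a p q) ∨ (∃ j p, ¬ mem i j ∧ v = .core (.W j p)) ∨ v = .core .D ∨
      v = .leaf (.X i a) := by
  rcases h with h | h <;> cases h <;> simp_all

theorem adj_s {j : J} {p : P} {q : Q} {v : Vtx J P Q A I}
    (h : (graph P Q A mem).Adj (.s j p q) v) :
    v = .core (.T j p) ∨ v = .core (.W j p) ∨ v = .core (.B q) ∨ ∃ a, v = .y a p q := by
  rcases h with h | h <;> cases h <;> simp

theorem adj_y {a : A} {p : P} {q : Q} {v : Vtx J P Q A I}
    (h : (graph P Q A mem).Adj (.y a p q) v) :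
    (∃ j, v = .s j p q) ∨ v = .core (.Y a q) ∨ ∃ i, v = .core (.X i a) := by
  rcases h with h | h <;> cases h <;> simp

theorem connected_graph [Nonempty J] [Nonempty P] [Nonempty Q] [Nonempty A] [Nonempty I] :
    (graph P Q A mem).Connected := by
  obtain ⟨j₀⟩ := ‹Nonempty J›
  obtain ⟨p₀⟩ := ‹Nonempty P›
  obtain ⟨q₀⟩ := ‹Nonempty Q›
  obtain ⟨a₀⟩ := ‹Nonempty A›
  obtain ⟨i₀⟩ := ‹Nonempty I›
  have hX : ∀ i a, (graph P Q A mem).Reachable (.core (.X i a)) (.core .D) :=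
    fun i a => (Arc.DX i a).adj'.reachable
  have hy : ∀ a p q, (graph P Q A mem).Reachable (.y a p q) (.core .D) :=
    fun a p q => (Arc.yX a p q i₀).adj.reachable.trans (hX _ _)
  have hs : ∀ j p q, (graph P Q A mem).Reachable (.s j p q) (.core .D) :=
    fun j p q => (Arc.sy j a₀ p q).adj.reachable.trans (hy _ _ _)
  have hc : ∀ c, (graph P Q A mem).Reachable (.core c) (.core .D) := by
    intro c
    cases c with
    | T j p => exact (Arc.sT j p q₀).adj'.reachable.trans (hs _ _ _)
    | W j p => exact (Arc.sW j p q₀).adj'.reachable.trans (hs _ _ _)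
    | Y a q => exact (Arc.yY a p₀ q).adj'.reachable.trans (hy _ _ _)
    | B q => exact (Arc.sB j₀ p₀ q).adj'.reachable.trans (hs _ _ _)
    | X i a => exact hX i a
    | D => exact .refl _
  have hall : ∀ v, (graph P Q A mem).Reachable v (.core .D) := by
    intro v
    cases v with
    | s j p q => exact hs j p q
    | y a p q => exact hy a p q
    | core c => exact hc c
    | leaf c => exact (Arc.leaf c).adj'.reachable.trans (hc c)
  exact { preconnected := fun u v => (hall u).trans (hall v).symm, nonempty := ⟨.core .D⟩ }

/-- The leaves together with one copy of a cover per pair `(p, q)` form a MEG-set. -/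
theorem isMEGSet_of_cover [Nonempty J] [Nonempty A] [Nonempty I]
    (M : Finset (Vtx J P Q A I)) (hleaf : ∀ c, .leaf c ∈ M)
    (hcover : ∀ i p q, ∃ j, mem i j ∧ .s j p q ∈ M) :
    IsMEGSet (graph P Q A mem) M := by
  obtain ⟨j₀⟩ := ‹Nonempty J›
  obtain ⟨a₀⟩ := ‹Nonempty A›
  obtain ⟨i₀⟩ := ‹Nonempty I›
  have pend : ∀ (c : Core J P Q A I) w, (graph P Q A mem).Adj (.leaf c) w → w = .core c :=
    fun c w h => adj_leaf h
  -- What two core vertices monitor is monitored by their leaves, which lie in `M`.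
  have both : ∀ (c d : Core J P Q A I) (e : Sym2 (Vtx J P Q A I)), c ≠ d →
      Monitors (graph P Q A mem) (.core c) (.core d) e →
      ∃ x ∈ M, ∃ y ∈ M, Monitors (graph P Q A mem) x y e := by
    intro c d e hcd h
    refine ⟨.leaf c, hleaf c, .leaf d, hleaf d, Monitors.pendant (pend c) ?_ ?_⟩
    · simpa using hcd.symm
    · exact (Monitors.pendant (pend d) (by simp) h.symm).symm
  -- `T j p` fixes `j` and `p`, and `Y a q` fixes `a` and `q`, so there is just one path of length
  -- three between them and none shorter. `W j p` could not replace `T j p`, as it may reach `Y a q`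
  -- through item vertices and other hubs.
  have TY : ∀ j a p q, ∀ e : Sym2 (Vtx J P Q A I), e = s(.s j p q, .core (.T j p)) ∨
      e = s(.s j p q, .y a p q) ∨ e = s(.y a p q, .core (.Y a q)) →
      ∃ x ∈ M, ∃ y ∈ M, Monitors (graph P Q A mem) x y e := by
    intro j a p q e he
    apply both (.T j p) (.Y a q) e (by simp)
    have := monitors_of_unique_three (Arc.sT (A := A) (mem := mem) j p q).adj'
      (Arc.sy j a p q).adj (Arc.yY a p q).adj (by simp)
      (by intro h; rcases adj_T h with ⟨_, h⟩ | h <;> simp at h)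
      (by
        intro w h h'
        rcases adj_T h with ⟨q', rfl⟩ | rfl
        · rcases adj_Y h'.symm with ⟨_, h⟩ | h <;> simp at h
        · have := adj_leaf h'
          simp at this)
      (by
        intro w w' h h' h''
        rcases adj_T h with ⟨q', rfl⟩ | rfl
        · rcases adj_Y h''.symm with ⟨p', rfl⟩ | rfl
          · rcases adj_s h' with h | h | h | ⟨a', h⟩ <;> simp at h
            obtain ⟨-, rfl, rfl⟩ := h
            simp
          · have := adj_leaf h'.symm
            simp at this
        · obtain rfl := adj_leaf h'
          rcases adj_T h'' with ⟨_, h⟩ | h <;> simp at h)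
    rcases he with rfl | rfl | rfl
    · rw [Sym2.eq_swap]; exact this.1
    · exact this.2.1
    · exact this.2.2
  -- Likewise `W j p` and `B q` have the single common neighbour `s j p q`.
  have WB : ∀ j p q, ∀ e : Sym2 (Vtx J P Q A I), e = s(.s j p q, .core (.W j p)) ∨
      e = s(.s j p q, .core (.B q)) →
      ∃ x ∈ M, ∃ y ∈ M, Monitors (graph P Q A mem) x y e := by
    intro j p q e he
    apply both (.W j p) (.B q) e (by simp)
    have := monitors_of_unique_two (Arc.sW (A := A) (mem := mem) j p q).adj'
      (Arc.sB j p q).adj (by simp)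
      (by intro h; rcases adj_W h with ⟨_, h⟩ | ⟨_, _, h⟩ | h <;> simp at h)
      (by
        intro w h h'
        rcases adj_B h'.symm with ⟨j', p', rfl⟩ | rfl
        · rcases adj_W h with ⟨_, h⟩ | ⟨_, _, h⟩ | h <;> simp at h
          obtain ⟨rfl, rfl, rfl⟩ := h
          rfl
        · have := adj_leaf h.symm
          simp at this)
    rcases he with rfl | rfl
    · rw [Sym2.eq_swap]; exact this.1
    · exact this.2
  have key : ∀ u v, Arc mem u v → ∃ x ∈ M, ∃ y ∈ M, Monitors (graph P Q A mem) x y s(u, v) := by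
    intro u v h
    cases h with
    | sT j p q => exact TY j a₀ p q _ (.inl rfl)
    | sW j p q => exact WB j p q _ (.inl rfl)
    | sB j p q => exact WB j p q _ (.inr rfl)
    | sy j a p q => exact TY j a p q _ (.inr (.inl rfl))
    | yY a p q => exact TY j₀ a p q _ (.inr (.inr rfl))
    | yX a p q i =>
      -- Only here is the cover used: as the set `j` contains `i`, `W j p` is not adjacent to `X i
      -- a`, and the hub is the only common neighbour of `s j p q` and `X i a`.
      obtain ⟨j, hj, hM⟩ := hcover i p q
      refine ⟨_, hM, .leaf (.X i a), hleaf _, ?_⟩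
      refine (Monitors.pendant (pend _) (by simp) (Monitors.symm ?_)).symm
      refine (monitors_of_unique_two (Arc.sy (mem := mem) j a p q).adj (Arc.yX a p q i).adj
        (by simp) (by intro h; rcases adj_s h with h | h | h | ⟨_, h⟩ <;> simp at h) ?_).2
      intro w h h'
      rcases adj_s h with rfl | rfl | rfl | ⟨a', rfl⟩
      · rcases adj_T h' with ⟨_, h⟩ | h <;> simp at h
      · rcases adj_X h'.symm with ⟨_, _, h⟩ | ⟨_, _, hn, h⟩ | h | h <;> simp at h
        obtain ⟨rfl, rfl⟩ := h
        exact absurd hj hn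
      · rcases adj_B h' with ⟨_, _, h⟩ | h <;> simp at h
      · rcases adj_y h' with ⟨_, h⟩ | h | ⟨_, h⟩ <;> simp at h
        obtain ⟨-, rfl⟩ := h
        rfl
    | WX j p i a hn => exact both _ _ _ (by simp) (monitors_of_adj (Arc.WX j p i a hn).adj)
    | DX i a => exact both _ _ _ (by simp) (monitors_of_adj (Arc.DX i a).adj)
    | leaf c =>
      have : ∃ d : Core J P Q A I, d ≠ c := by
        by_cases hc : c = .D
        · exact ⟨.X i₀ a₀, by simp [hc]⟩
        · exact ⟨.D, fun h => hc h.symm⟩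
      obtain ⟨d, hd⟩ := this
      refine ⟨.leaf c, hleaf c, .leaf d, hleaf d, ?_⟩
      rw [Sym2.eq_swap]
      exact monitors_pendant_edge (pend c) (by simpa using hd)
  intro e he
  induction e with
  | _ u v =>
    rcases he with h | h
    · exact key u v h
    · rw [Sym2.eq_swap]; exact key v u h

/-- In a copy with an unchosen hub, the chosen set vertices form a cover. -/
theorem exists_mem_of_isMEGSet [Nonempty J] [Nontrivial P] [Nontrivial Q] [Nonempty I]
    {M : Finset (Vtx J P Q A I)} (hM : IsMEGSet (graph P Q A mem) M) {a : A} {p : P} {q : Q}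
    (hy : .y a p q ∉ M) (i : I) : ∃ j, mem i j ∧ .s j p q ∈ M := by
  obtain ⟨p', hp'⟩ := exists_ne p
  obtain ⟨q', hq'⟩ := exists_ne q
  have : Nonempty A := ⟨a⟩
  have hconn : (graph P Q A mem).Connected := connected_graph
  have hadj : (graph P Q A mem).Adj (.y a p q) (.core (.X i a)) := (Arc.yX a p q i).adj
  -- Name the ends of the monitoring pair so that the geodesic traverses the edge from the hub
  -- towards the item vertex.
  obtain ⟨u, hu, v, hv, hmon, h, p₁, p₂, hlen⟩ : ∃ u ∈ M, ∃ v ∈ M,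
      Monitors (graph P Q A mem) u v s(.y a p q, .core (.X i a)) ∧
      ∃ (h : (graph P Q A mem).Adj (.y a p q) (.core (.X i a)))
        (p₁ : (graph P Q A mem).Walk u (.y a p q))
        (p₂ : (graph P Q A mem).Walk (.core (.X i a)) v),
        (p₁.append (.cons h p₂)).length = (graph P Q A mem).dist u v := by
    obtain ⟨u, hu, v, hv, hmon⟩ := hM s(.y a p q, .core (.X i a)) hadj
    obtain ⟨r, hr⟩ := hconn.exists_walk_length_eq_dist u v
    rcases exists_append_of_mem_edges r (hmon r hr) with ⟨h, p₁, p₂, rfl⟩ | ⟨h, p₁, p₂, rfl⟩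
    · exact ⟨u, hu, v, hv, hmon, h, p₁, p₂, hr⟩
    · refine ⟨v, hv, u, hu, hmon.symm, h.symm, p₂.reverse, p₁.reverse, ?_⟩
      rw [SimpleGraph.dist_comm, ← hr]
      simp
      omega
  obtain ⟨r₁, hr₁⟩ : ∃ r₁ : (graph P Q A mem).Walk (.y a p q) u, p₁ = r₁.reverse :=
    ⟨p₁.reverse, by simp⟩
  subst hr₁
  -- Follow the geodesic backwards from the hub. It cannot start there, since the hub is not in `M`;
  -- let `w` be the preceding vertex.
  cases r₁ with
  | nil => exact absurd hu hy
  | @cons _ w _ hw r₁ =>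
    -- Another common neighbour of `w` and `X i a` would permit a detour avoiding the monitored
    -- edge.
    have two : ∀ m, (graph P Q A mem).Adj w m → (graph P Q A mem).Adj m (.core (.X i a)) →
        m = .y a p q := by
      intro m h₁ h₂
      by_contra hm
      refine not_monitors_of_detour r₁.reverse (.cons hw.symm (.cons h .nil)) p₂ ?_ (by simp)
        (.cons h₁ (.cons h₂ .nil)) rfl ?_ hmon
      · rw [← hlen]; simp; omega
      · simp only [SimpleGraph.Walk.edges_cons, SimpleGraph.Walk.edges_nil, List.mem_cons,
          List.not_mem_nil, or_false, Sym2.eq_iff]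
        have := hw.ne
        rintro ((⟨h, -⟩ | ⟨h, -⟩) | (⟨h, -⟩ | ⟨h, -⟩))
        · exact this h
        · exact hm h.symm
        · exact hm h.symm
        · simp at h
    rcases adj_y hw with ⟨j, rfl⟩ | rfl | ⟨i', rfl⟩
    · have hj : mem i j := by
        by_contra hj
        have := two _ (Arc.sW j p q).adj (Arc.WX j p i a hj).adj
        simp at this
      cases r₁ with
      | nil => exact ⟨j, hj, hu⟩
      | @cons _ z _ hz r₁ =>
        exfalso
        -- If the geodesic began before `s j p q`, at `z` or earlier, every walk of length three
        -- from `z` to `X i a` would have to use the monitored edge.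
        have three : ∀ m m' (h₁ : (graph P Q A mem).Adj z m) (h₂ : (graph P Q A mem).Adj m m')
            (h₃ : (graph P Q A mem).Adj m' (.core (.X i a))),
            s(.y a p q, .core (.X i a)) ∈ (SimpleGraph.Walk.cons h₁ (.cons h₂ (.cons h₃ .nil))).edges
            := by
          intro m m' h₁ h₂ h₃
          by_contra hm
          refine not_monitors_of_detour r₁.reverse
            (.cons hz.symm (.cons hw.symm (.cons h .nil))) p₂ ?_ (by simp)
            (.cons h₁ (.cons h₂ (.cons h₃ .nil))) rfl hm hmon
          rw [← hlen]; simp; omega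
        -- Detours: from `T j p` and `W j p` through the copy `(p, q')`, from `B q` through the copy
        -- `(p', q)`.
        rcases adj_s hz with rfl | rfl | rfl | ⟨a', rfl⟩
        · have := three _ _ (Arc.sT j p q').adj' (Arc.sy j a p q').adj (Arc.yX a p q' i).adj
          simp [hq'.symm] at this
        · have := three _ _ (Arc.sW j p q').adj' (Arc.sy j a p q').adj (Arc.yX a p q' i).adj
          simp [hq'.symm] at this
        · have := three _ _ (Arc.sB j p' q).adj' (Arc.sy j a p' q).adj (Arc.yX a p' q i).adj
          simp [hp'.symm] at this
        · by_cases ha : a' = a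
          · subst ha
            have := three _ _ (Arc.yY a' p q).adj (Arc.yY a' p' q).adj' (Arc.yX a' p' q i).adj
            simp [hp'.symm] at this
          · have := three _ _ (Arc.yX a' p q i).adj (Arc.DX i a').adj' (Arc.DX i a).adj
            simp [Ne.symm ha] at this
    · have := two _ (Arc.yY a p' q).adj' (Arc.yX a p' q i).adj
      simp [hp'] at this
    · have := two _ (Arc.yX a p' q i').adj' (Arc.yX a p' q i).adj
      simp [hp'] at this

end Vtx

end

/-! ### Enumerating the vertices and averaging over the copies -/

section

open Function

namespace Core

variable {J P Q A I : Type}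

/-- All core vertices with indices in the given lists. -/
def list (lj : List J) (lp : List P) (lq : List Q) (la : List A) (li : List I) :
    List (Core J P Q A I) :=
  (lj.flatMap fun j => lp.map fun p => T j p) ++ (lj.flatMap fun j => lp.map fun p => W j p) ++
  (la.flatMap fun a => lq.map fun q => Y a q) ++ (lq.map fun q => B q) ++
  (li.flatMap fun i => la.map fun a => X i a) ++ [D]

variable {lj : List J} {lp : List P} {lq : List Q} {la : List A} {li : List I}

theorem mem_list (hj : ∀ j, j ∈ lj) (hp : ∀ p, p ∈ lp) (hq : ∀ q, q ∈ lq) (ha : ∀ a, a ∈ la)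
    (hi : ∀ i, i ∈ li) (c : Core J P Q A I) : c ∈ list lj lp lq la li := by
  cases c <;> simp [list, hj, hp, hq, ha, hi]

theorem nodup_flatMap_map {α β γ : Type*} {f : α → β → γ} {l : List α} {l' : List β}
    (hl : l.Nodup) (hl' : l'.Nodup) (hf : ∀ a b a' b', f a b = f a' b' → a = a' ∧ b = b') :
    (l.flatMap fun a => l'.map fun b => f a b).Nodup := by
  rw [List.nodup_flatMap]
  refine ⟨fun a _ => hl'.map fun b b' h => (hf _ _ _ _ h).2, hl.imp ?_⟩
  intro a a' haa x hx hx'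
  simp only [List.mem_map] at hx hx'
  obtain ⟨b, -, rfl⟩ := hx
  obtain ⟨b', -, h⟩ := hx'
  exact haa (hf _ _ _ _ h).1.symm

theorem nodup_list (hj : lj.Nodup) (hp : lp.Nodup) (hq : lq.Nodup) (ha : la.Nodup)
    (hi : li.Nodup) : (list lj lp lq la li : List (Core J P Q A I)).Nodup := by
  unfold list
  have h1 := nodup_flatMap_map (f := fun j p => (T j p : Core J P Q A I)) hj hp (by simp)
  have h2 := nodup_flatMap_map (f := fun j p => (W j p : Core J P Q A I)) hj hp (by simp)
  have h3 := nodup_flatMap_map (f := fun a q => (Y a q : Core J P Q A I)) ha hq (by simp)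
  have h4 : (lq.map fun q => (B q : Core J P Q A I)).Nodup := hq.map fun a b h => by simpa using h
  have h5 := nodup_flatMap_map (f := fun i a => (X i a : Core J P Q A I)) hi ha (by simp)
  simp only [List.nodup_append, h1, h2, h3, h4, h5, List.nodup_singleton, true_and]
  simp only [List.mem_append, List.mem_flatMap, List.mem_map, List.mem_singleton]
  refine ⟨⟨⟨⟨?_, ?_⟩, ?_⟩, ?_⟩, ?_⟩ <;> rintro x hx y hy rfl <;> aesop

theorem length_list : (list lj lp lq la li).length = 2 * (lj.length * lp.length) +
    la.length * lq.length + lq.length + li.length * la.length + 1 := by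
  simp [list, List.length_flatMap]
  ring

end Core

namespace Vtx

variable {J P Q A I : Type}

/-- All vertices with indices in the given lists: first, copy by copy, the set vertices and hubs,
then the core vertices, then the leaves. -/
def list (lj : List J) (lp : List P) (lq : List Q) (la : List A) (li : List I) :
    List (Vtx J P Q A I) :=
  (lp.flatMap fun p => lq.flatMap fun q => (lj.map fun j => s j p q) ++ (la.map fun a => y a p q)) ++
  ((Core.list lj lp lq la li).map core ++ (Core.list lj lp lq la li).map leaf)

variable {lj : List J} {lp : List P} {lq : List Q} {la : List A} {li : List I}

theorem mem_list (hj : ∀ j, j ∈ lj) (hp : ∀ p, p ∈ lp) (hq : ∀ q, q ∈ lq) (ha : ∀ a, a ∈ la)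
    (hi : ∀ i, i ∈ li) (v : Vtx J P Q A I) : v ∈ list lj lp lq la li := by
  cases v <;> simp [list, hj, hp, hq, ha, Core.mem_list hj hp hq ha hi]

theorem nodup_list (hj : lj.Nodup) (hp : lp.Nodup) (hq : lq.Nodup) (ha : la.Nodup)
    (hi : li.Nodup) : (list lj lp lq la li : List (Vtx J P Q A I)).Nodup := by
  have hc := Core.nodup_list hj hp hq ha hi
  unfold list
  rw [List.nodup_append, List.nodup_append]
  refine ⟨?_, ⟨hc.map fun a b h => by simpa using h, hc.map fun a b h => by simpa using h, ?_⟩, ?_⟩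
  · rw [List.nodup_flatMap]
    constructor
    · intro p _
      rw [List.nodup_flatMap]
      constructor
      · intro q _
        rw [List.nodup_append]
        refine ⟨hj.map fun a b h => by simpa using h, ha.map fun a b h => by simpa using h, ?_⟩
        simp only [List.mem_map]
        rintro x ⟨j, -, rfl⟩ y ⟨a, -, rfl⟩ h
        simp at h
      · refine hq.imp ?_
        intro q q' hqq x hx hx'
        simp only [List.mem_append, List.mem_map] at hx hx'
        aesop
    · refine hp.imp ?_
      intro p p' hpp x hx hx'
      simp only [List.mem_append, List.mem_map, List.mem_flatMap] at hx hx'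
      aesop
  · simp only [List.mem_map]
    rintro x ⟨c, -, rfl⟩ y ⟨d, -, rfl⟩ h
    simp at h
  · simp only [List.mem_flatMap, List.mem_append, List.mem_map]
    rintro x hx y hy rfl
    aesop

theorem length_list : (list lj lp lq la li).length =
    lp.length * (lq.length * (lj.length + la.length)) +
    2 * (Core.list lj lp lq la li).length := by
  simp [list, List.length_flatMap]
  ring

/-- Renaming of the indices. -/
def map {J' P' Q' A' I' : Type} (fj : J → J') (fp : P → P') (fq : Q → Q') (fa : A → A')
    (fi : I → I') : Vtx J P Q A I → Vtx J' P' Q' A' I' :=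
  let g : Core J P Q A I → Core J' P' Q' A' I' := fun
    | .T j p => .T (fj j) (fp p)
    | .W j p => .W (fj j) (fp p)
    | .Y a q => .Y (fa a) (fq q)
    | .B q => .B (fq q)
    | .X i a => .X (fi i) (fa a)
    | .D => .D
  fun
    | .s j p q => .s (fj j) (fp p) (fq q)
    | .y a p q => .y (fa a) (fp p) (fq q)
    | .core c => .core (g c)
    | .leaf c => .leaf (g c)

/-- Needed because the graph has indices in `Fin`, whereas the loops of the machine run over natural
numbers. -/
theorem map_list {J' P' Q' A' I' : Type} (fj : J → J') (fp : P → P') (fq : Q → Q') (fa : A → A')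
    (fi : I → I') : (list lj lp lq la li).map (map fj fp fq fa fi) =
      list (lj.map fj) (lp.map fp) (lq.map fq) (la.map fa) (li.map fi) := by
  simp [list, Core.list, List.map_flatMap, List.flatMap_map, map, Function.comp_def]

section Counting

open Finset

/-- The set vertices of the copy `(p, q)` in `M`. -/
noncomputable def copySet [Fintype J] (M : Finset (Vtx J P Q A I)) (p : P) (q : Q) : Finset J :=
  open Classical in univ.filter fun j => .s j p q ∈ M

theorem mem_copySet [Fintype J] {M : Finset (Vtx J P Q A I)} {p : P} {q : Q} {j : J} :
    j ∈ copySet M p q ↔ .s j p q ∈ M := by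
  classical
  simp [copySet]

variable [Fintype P] [Fintype Q]

/-- The copy `(p, q)` has a hub outside `M`. -/
def Good (M : Finset (Vtx J P Q A I)) (p : P) (q : Q) : Prop :=
  ∃ a, .y a p q ∉ M

/-- If it failed, every copy would contain more than `τ` elements of `M`: a good copy by its set
vertices, any other by its hubs, all of which are then in `M` and of which there are more than `τ`.
Summing over the copies contradicts the size of `M`. -/
theorem exists_good_copy [Fintype J] [Fintype A] [Nonempty P] [Nonempty Q] (M : Finset (Vtx J P Q A I)) (τ : ℝ)
    (hτ : τ < Fintype.card A)
    (hM : (M.card : ℝ) ≤ Fintype.card P * Fintype.card Q * τ) :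
    ∃ p q, Good M p q ∧ ((copySet M p q).card : ℝ) ≤ τ := by
  classical
  by_contra! hcon
  -- The fibre over `none` consists of the shared vertices in `M`; it only adds to the cardinality.
  let f : Vtx J P Q A I → Option (P × Q) := fun
    | .s _ p q => some (p, q)
    | .y _ p q => some (p, q)
    | _ => none
  have hfib : ∀ pq : P × Q, τ < ((M.filter fun v => f v = some pq).card : ℝ) := by
    rintro ⟨p, q⟩
    by_cases hg : Good M p q
    · refine (hcon p q hg).trans_le ?_
      norm_cast
      refine Finset.card_le_card_of_injOn (fun j => .s j p q) ?_ ?_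
      · intro j hj
        simpa [copySet, f] using hj
      · intro j _ j' _ h
        simpa using h
    · refine hτ.trans_le ?_
      norm_cast
      rw [← Finset.card_univ]
      refine Finset.card_le_card_of_injOn (fun a => .y a p q) ?_ ?_
      · intro a _
        simp only [Good, not_exists, not_not] at hg
        simpa [f] using hg a
      · intro j _ j' _ h
        simpa using h
  have hsum : ∑ pq : P × Q, (M.filter fun v => f v = some pq).card ≤ M.card := by
    rw [Finset.card_eq_sum_card_fiberwise (f := f) (t := univ) (fun _ _ => Finset.mem_coe.2 (mem_univ _)),
      Fintype.sum_option]
    exact Nat.le_add_left _ _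
  have hlt : ∑ _pq : P × Q, τ < ∑ pq : P × Q, ((M.filter fun v => f v = some pq).card : ℝ) :=
    Finset.sum_lt_sum_of_nonempty univ_nonempty fun pq _ => hfib pq
  rw [Finset.sum_const, Finset.card_univ, Fintype.card_prod, nsmul_eq_mul] at hlt
  have : (∑ pq : P × Q, ((M.filter fun v => f v = some pq).card : ℝ)) ≤ M.card := by
    exact_mod_cast hsum
  push_cast at hlt
  linarith

/-- The MEG-set obtained from a cover. -/
theorem exists_isMEGSet_of_cover {mem : I → J → Prop} [Nonempty J] [Nonempty A] [Nonempty I]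
    (cores : List (Core J P Q A I)) (hc : ∀ c, c ∈ cores)
    (C : Finset J) (hC : ∀ i, ∃ j ∈ C, mem i j) :
    ∃ M : Finset (Vtx J P Q A I), IsMEGSet (graph P Q A mem) M ∧
      M.card ≤ Fintype.card P * Fintype.card Q * C.card + cores.length := by
  classical
  refine ⟨(univ : Finset (P × Q)).biUnion (fun pq => C.image fun j => .s j pq.1 pq.2) ∪
    (cores.map leaf).toFinset, ?_, ?_⟩
  · refine isMEGSet_of_cover _ (by simp [hc]) ?_
    intro i p q
    obtain ⟨j, hj, hij⟩ := hC i
    exact ⟨j, hij, by simp [hj]⟩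
  · refine (card_union_le _ _).trans (add_le_add ?_ ?_)
    · refine (card_biUnion_le_card_mul _ _ C.card fun pq _ => card_image_le).trans ?_
      rw [card_univ, Fintype.card_prod]
    · refine (List.toFinset_card_le _).trans ?_
      simp

end Counting

end Vtx

namespace SetCoverInstance

variable (I : SetCoverInstance) (k₁ k₂ r : ℕ)

/-- Vertices of the graph built from a Set Cover instance. -/
abbrev V : Type := Vtx (Fin I.h) (Fin k₁) (Fin k₂) (Fin r) (Fin I.η)

/-- The vertices in the order in which they are numbered. -/
def verts : List (I.V k₁ k₂ r) :=
  Vtx.list (List.finRange _) (List.finRange _) (List.finRange _) (List.finRange _)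
    (List.finRange _)

/-- The number of leaves. -/
def leaves : ℕ := 2 * (I.h * k₁) + r * k₂ + k₂ + I.η * r + 1

theorem length_verts : (I.verts k₁ k₂ r).length =
    k₁ * (k₂ * (I.h + r)) + 2 * I.leaves k₁ k₂ r := by
  simp [verts, Vtx.length_list, Core.length_list, leaves]

theorem mem_verts (v : I.V k₁ k₂ r) : v ∈ I.verts k₁ k₂ r :=
  Vtx.mem_list List.mem_finRange List.mem_finRange List.mem_finRange List.mem_finRange
    List.mem_finRange v

theorem nodup_verts : (I.verts k₁ k₂ r).Nodup :=
  Vtx.nodup_list (List.nodup_finRange _) (List.nodup_finRange _) (List.nodup_finRange _)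
    (List.nodup_finRange _) (List.nodup_finRange _)

open Classical in
/-- The numbering of the vertices. -/
noncomputable def vertEquiv : Fin (I.verts k₁ k₂ r).length ≃ I.V k₁ k₂ r :=
  (I.nodup_verts k₁ k₂ r).getEquivOfForallMemList _ (I.mem_verts k₁ k₂ r)

/-- The graph on the set of vertices. -/
def vgraph : SimpleGraph (I.V k₁ k₂ r) :=
  Vtx.graph _ _ _ fun i j => i ∈ I.sets j

theorem connected_vgraph (hh : 0 < I.h) (hη : 0 < I.η) (h₁ : 0 < k₁) (h₂ : 0 < k₂) (hr : 0 < r) :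
    (I.vgraph k₁ k₂ r).Connected := by
  have := Fin.pos_iff_nonempty.1 hh
  have := Fin.pos_iff_nonempty.1 hη
  have := Fin.pos_iff_nonempty.1 h₁
  have := Fin.pos_iff_nonempty.1 h₂
  have := Fin.pos_iff_nonempty.1 hr
  exact Vtx.connected_graph

/-- The graph built from a Set Cover instance, as an instance of the MEG-set problem. -/
noncomputable def toGraph (hh : 0 < I.h) (hη : 0 < I.η) (h₁ : 0 < k₁) (h₂ : 0 < k₂)
    (hr : 0 < r) : ConnectedGraph where
  n := (I.verts k₁ k₂ r).length
  graph := (I.vgraph k₁ k₂ r).comap (I.vertEquiv k₁ k₂ r)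
  connected := ((SimpleGraph.Iso.comap (I.vertEquiv k₁ k₂ r) (I.vgraph k₁ k₂ r)).connected_iff).2
    (I.connected_vgraph k₁ k₂ r hh hη h₁ h₂ hr)

variable {I k₁ k₂ r}

/-- At least two values of `p` and of `q` are required because the detours run through other copies.
-/
theorem feasible_copySet (hh : 0 < I.h) (hη : 0 < I.η) (h₁ : 2 ≤ k₁) (h₂ : 2 ≤ k₂) (hr : 0 < r)
    {M : Finset (Fin (I.verts k₁ k₂ r).length)}
    (hM : IsMEGSet (I.toGraph k₁ k₂ r hh hη (by omega) (by omega) hr).graph M)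
    {p : Fin k₁} {q : Fin k₂}
    (hg : Vtx.Good (M.map (I.vertEquiv k₁ k₂ r).toEmbedding) p q) :
    setCover.Feasible I (Vtx.copySet (M.map (I.vertEquiv k₁ k₂ r).toEmbedding) p q) := by
  have := Fin.pos_iff_nonempty.1 hh
  have := Fin.pos_iff_nonempty.1 hη
  have : Nontrivial (Fin k₁) := Fin.nontrivial_iff_two_le.2 h₁
  have : Nontrivial (Fin k₂) := Fin.nontrivial_iff_two_le.2 h₂
  intro i
  obtain ⟨a, ha⟩ := hg
  have hM' := hM.map (SimpleGraph.Iso.comap (I.vertEquiv k₁ k₂ r) (I.vgraph k₁ k₂ r))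
  obtain ⟨j, hj, hjM⟩ := Vtx.exists_mem_of_isMEGSet (A := Fin r) hM' ha i
  exact ⟨j, Vtx.mem_copySet.2 hjM, hj⟩

/-- The cover `C`, repeated in every copy, bounds the optimum of the MEG-set instance. `hτ` says
that `ρ` times this bound leaves at most `τ` vertices per copy on average. -/
theorem exists_small_copySet (hh : 0 < I.h) (hη : 0 < I.η) (h₁ : 2 ≤ k₁) (h₂ : 2 ≤ k₂)
    (hr : 0 < r) {M : Finset (Fin (I.verts k₁ k₂ r).length)} {ρ τ : ℝ}
    (hM : ∀ S : Finset (Fin (I.verts k₁ k₂ r).length), IsMEGSet (I.toGraph k₁ k₂ r hh hη (by omega) (by omega) hr).graph S →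
      (M.card : ℝ) ≤ ρ * S.card) (hρ : 0 ≤ ρ)
    {C : Finset (Fin I.h)} (hC : setCover.Feasible I C) (hτr : τ < r)
    (hτ : ρ * ((k₁ * k₂ * C.card + I.leaves k₁ k₂ r : ℕ) : ℝ) ≤ k₁ * k₂ * τ) :
    ∃ p q, Vtx.Good (M.map (I.vertEquiv k₁ k₂ r).toEmbedding) p q ∧
      ((Vtx.copySet (M.map (I.vertEquiv k₁ k₂ r).toEmbedding) p q).card : ℝ) ≤ τ := by
  have := Fin.pos_iff_nonempty.1 hh
  have := Fin.pos_iff_nonempty.1 hη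
  have := Fin.pos_iff_nonempty.1 hr
  have : Nonempty (Fin k₁) := ⟨⟨0, by omega⟩⟩
  have : Nonempty (Fin k₂) := ⟨⟨0, by omega⟩⟩
  obtain ⟨S, hS, hcard⟩ := Vtx.exists_isMEGSet_of_cover (P := Fin k₁) (Q := Fin k₂) (A := Fin r)
    (mem := fun i j => i ∈ I.sets j)
    (Core.list (List.finRange _) (List.finRange _) (List.finRange _) (List.finRange _)
    (List.finRange _)) (Core.mem_list List.mem_finRange List.mem_finRange List.mem_finRange
      List.mem_finRange List.mem_finRange) C hC
  rw [Core.length_list] at hcard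
  simp only [List.length_finRange, Fintype.card_fin] at hcard
  have hS' := hS.map (SimpleGraph.Iso.comap (I.vertEquiv k₁ k₂ r) (I.vgraph k₁ k₂ r)).symm
  have h := hM _ hS'
  rw [Finset.card_map] at h
  apply Vtx.exists_good_copy
  · simpa using hτr
  · rw [Finset.card_map, Fintype.card_fin, Fintype.card_fin]
    refine h.trans (le_trans (mul_le_mul_of_nonneg_left ?_ hρ) hτ)
    exact_mod_cast hcard

end SetCoverInstance

end

section

/-! ### The choice of the parameters -/

/-- A logarithm grows more slowly than any linear function. For `x = ln N` this makes the `ln ln N`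
contribution to `ln n` negligible. The slope `s` is chosen so that `Real.log z ≤ z - 1` at `z = s *
(β * x + 2)` costs `ε / 4 * x`; the threshold lets another `ε / 4 * x` absorb the constants. -/
theorem log_affine_le {α β ε K : ℝ} (hα : 0 < α) (hβ : 0 < β) (hε : 0 < ε) :
    ∃ X : ℝ, ∀ x ≥ X, 0 < x → α * (Real.log (β * x + 2) + K) ≤ ε / 2 * x := by
  set s := ε / (4 * α * β) with hs
  have hs0 : 0 < s := by positivity
  refine ⟨4 / ε * (α * (2 * s - 1 - Real.log s + K)), fun x hx hx0 => ?_⟩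
  have h1 : Real.log (β * x + 2) ≤ s * (β * x + 2) - 1 - Real.log s := by
    have := Real.log_le_sub_one_of_pos (show 0 < s * (β * x + 2) by positivity)
    rw [Real.log_mul hs0.ne' (by positivity)] at this
    linarith
  have h2 : α * (s * β) = ε / 4 := by rw [hs]; field_simp
  have h3 : α * (2 * s - 1 - Real.log s + K) ≤ ε / 4 * x := by
    have := mul_le_mul_of_nonneg_left hx (show 0 ≤ ε / 4 by positivity)
    refine le_trans (le_of_eq ?_) this
    field_simp
  calc α * (Real.log (β * x + 2) + K) ≤ α * (s * (β * x + 2) - 1 - Real.log s + K) := by gcongr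
    _ = α * (s * β) * x + α * (2 * s - 1 - Real.log s + K) := by ring
    _ ≤ ε / 2 * x := by rw [h2]; linarith

-- Here `c` stands for the optimum, `l` for the number of leaves and `k₁ * (k₂ * (h + (r + 1))) + 2
-- * l` for the number of vertices. The first alternative is the case in which the family of all
-- sets is already good enough.
set_option maxHeartbeats 1000000 in
theorem exists_good_parameters (α ε : ℝ) (hα : 0 < α) (hε : 0 < ε) :
    ∃ D N₀ : ℕ, 2 ≤ D ∧ 2 ≤ N₀ ∧ ∀ h η c : ℕ, N₀ ≤ h + η → 1 ≤ c →
      1 ≤ (2 * α + ε) * Real.log ((h + η : ℕ) : ℝ) ∧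
      ((h : ℝ) ≤ (2 * α + ε) * Real.log ((h + η : ℕ) : ℝ) * c ∨
      ∃ κ r : ℕ, κ < h + η ∧ r < h + η ∧
        (2 * α + ε) * Real.log ((h + η : ℕ) : ℝ) * c < (r + 1 : ℕ) ∧
        ∀ k₁ k₂ l : ℕ, k₁ = D * (κ + 1) → k₂ = D * (h + η) →
          l = 2 * (h * k₁) + (r + 1) * k₂ + k₂ + η * (r + 1) + 1 →
          max 1 (α * Real.log ((k₁ * (k₂ * (h + (r + 1))) + 2 * l : ℕ) : ℝ)) *
            ((k₁ * k₂ * c + l : ℕ) : ℝ) ≤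
          k₁ * k₂ * ((2 * α + ε) * Real.log ((h + η : ℕ) : ℝ) * c)) := by
  set β := 2 * α + ε with hβ
  have hβ0 : 0 < β := by positivity
  -- The leaves inflate the MEG-set by a factor `1 + 6 / D`; this `D` makes the loss at most the
  -- half of `ε` that is not spent on the estimate of `ln n`.
  obtain ⟨D, hD⟩ := exists_nat_ge (max 12 (6 * (2 * α + ε / 2) / (ε / 2)))
  have hD12 : (12 : ℝ) ≤ D := (le_max_left _ _).trans hD
  have hD0 : (0 : ℝ) < D := by linarith
  have hDε : (2 * α + ε / 2) * (1 + 6 / D) ≤ β := by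
    have h1 : 6 * (2 * α + ε / 2) / (ε / 2) ≤ D := (le_max_right _ _).trans hD
    rw [div_le_iff₀ (by positivity)] at h1
    have h2 : (2 * α + ε / 2) * (6 / D) ≤ ε / 2 := by
      rw [mul_div_assoc', div_le_iff₀ hD0]
      linarith
    rw [hβ]
    linarith
  obtain ⟨X, hX⟩ := log_affine_le (K := Real.log (14 * D ^ 2)) hα hβ0 hε
  -- Beyond `N₀`, `x = ln N` exceeds the threshold `X` of `log_affine_le`, exceeds `2 * β + 2`,
  -- which gives `β * x + 2 ≤ N`, and exceeds `2 / β`, which gives `2 ≤ β * x`.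
  obtain ⟨N₀, hN₀⟩ := exists_nat_ge (max 2 (Real.exp (max X (max (2 * β + 2) (2 / β)))))
  refine ⟨D, N₀, by exact_mod_cast (show (2 : ℝ) ≤ D by linarith),
    by exact_mod_cast (le_max_left _ _).trans hN₀, fun h η c hN hc => ?_⟩
  set N := h + η with hNdef
  have hN' : Real.exp (max X (max (2 * β + 2) (2 / β))) ≤ N :=
    ((le_max_right _ _).trans hN₀).trans (by exact_mod_cast hN)
  have hNpos : (0 : ℝ) < N := (Real.exp_pos _).trans_le hN'
  set x := Real.log (N : ℝ) with hx
  have hexp : Real.exp x = N := Real.exp_log hNpos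
  have hxX : max X (max (2 * β + 2) (2 / β)) ≤ x := (Real.le_log_iff_exp_le hNpos).2 hN'
  have hx1 : X ≤ x := (le_max_left _ _).trans hxX
  have hx2 : 2 * β + 2 ≤ x := (le_max_left _ _).trans ((le_max_right _ _).trans hxX)
  have hx3 : 2 / β ≤ x := (le_max_right _ _).trans ((le_max_right _ _).trans hxX)
  have hx0 : 0 < x := by linarith
  have hτ2 : 2 ≤ β * x := by
    rw [div_le_iff₀ hβ0] at hx3
    linarith
  have hNx : β * x + 2 ≤ N := by
    have h1 := Real.quadratic_le_exp_of_nonneg hx0.le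
    rw [hexp] at h1
    nlinarith [mul_le_mul_of_nonneg_right hx2 hx0.le]
  refine ⟨by linarith, or_iff_not_imp_left.2 fun hh => ?_⟩
  push Not at hh
  have hc1 : (1 : ℝ) ≤ c := by exact_mod_cast hc
  have hτc0 : 0 ≤ β * x * c := by positivity
  -- The number of hubs is one more than the second witness, hence above the target `β * x * c`; the
  -- target being below `h` keeps the witness inside the search range.
  refine ⟨⌈β * x⌉₊, ⌊β * x * c⌋₊, ?_, ?_, ?_, ?_⟩
  · have := Nat.ceil_lt_add_one (show 0 ≤ β * x by positivity)
    have : (⌈β * x⌉₊ : ℝ) < N := by linarith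
    exact_mod_cast this
  · have : (⌊β * x * c⌋₊ : ℝ) < h := (Nat.floor_le hτc0).trans_lt hh
    have : ⌊β * x * c⌋₊ < h := by exact_mod_cast this
    omega
  · push_cast
    exact Nat.lt_floor_add_one _
  rintro k₁ k₂ l rfl rfl rfl
  set r : ℕ := ⌊β * x * c⌋₊ + 1 with hr
  set κ : ℕ := ⌈β * x⌉₊ + 1 with hκ
  -- This is why `k₁` has to grow like `ln N`: the `r * k₂` leaves at the vertices `Y a q` become at
  -- most `k₁ * k₂ * c / D`.
  have hrκ : (r : ℝ) ≤ κ * c := by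
    have h1 : (r : ℝ) ≤ β * x * c + 1 := by
      rw [hr]; push_cast; linarith [Nat.floor_le hτc0]
    have h2 : β * x + 1 ≤ κ := by rw [hκ]; push_cast; linarith [Nat.le_ceil (β * x)]
    nlinarith
  have hrN : (r : ℝ) ≤ N := by
    have : (⌊β * x * c⌋₊ : ℝ) < h := (Nat.floor_le hτc0).trans_lt hh
    have : ⌊β * x * c⌋₊ < h := by exact_mod_cast this
    exact_mod_cast (show r ≤ N by omega)
  have hκx : (κ : ℝ) ≤ β * x + 2 := by
    have := Nat.ceil_lt_add_one (show 0 ≤ β * x by positivity)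
    rw [hκ]; push_cast; linarith
  have hκ1 : (1 : ℝ) ≤ κ := by rw [hκ]; push_cast; linarith [Nat.cast_nonneg (α := ℝ) ⌈β * x⌉₊]
  have hN1 : (1 : ℝ) ≤ N := by linarith
  have hhN : (h : ℝ) ≤ N := by exact_mod_cast (show h ≤ N by omega)
  have hηN : (η : ℝ) ≤ N := by exact_mod_cast (show η ≤ N by omega)
  have hr0 : (0 : ℝ) ≤ r := Nat.cast_nonneg _
  set l : ℕ := 2 * (h * (D * κ)) + r * (D * N) + D * N + η * r + 1 with hl
  -- Two bounds for the leaves: this one compares them with `k₁ * k₂ * c = D² * κ * N * c`, while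
  -- `hlN` is free of `c` and enters the bound for `ln n`.
  have hlc : (l : ℝ) ≤ 6 * (D * κ * N * c) := by
    have e1 : (h : ℝ) * (D * κ) ≤ D * κ * N * c := by
      calc (h : ℝ) * (D * κ) ≤ N * (D * κ) := by gcongr
        _ = D * κ * N * 1 := by ring
        _ ≤ _ := by gcongr
    have e2 : (r : ℝ) * (D * N) ≤ D * κ * N * c := by
      calc (r : ℝ) * (D * N) ≤ (κ * c) * (D * N) := by gcongr
        _ = _ := by ring
    have e3 : (D : ℝ) * N ≤ D * κ * N * c := by
      calc (D : ℝ) * N = D * 1 * N * 1 := by ring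
        _ ≤ _ := by gcongr
    have e4 : (η : ℝ) * r ≤ D * κ * N * c := by
      calc (η : ℝ) * r ≤ N * (κ * c) := by gcongr
        _ = 1 * κ * N * c := by ring
        _ ≤ _ := by gcongr; linarith
    have e5 : (1 : ℝ) ≤ D * κ * N * c := by
      calc (1 : ℝ) = 1 * 1 * 1 * 1 := by ring
        _ ≤ _ := by gcongr; linarith
    rw [hl]; push_cast; linarith
  have hlN : (l : ℝ) ≤ 6 * (D * κ * N ^ 2) := by
    have e1 : (h : ℝ) * (D * κ) ≤ D * κ * N ^ 2 := by
      calc (h : ℝ) * (D * κ) ≤ N * (D * κ) := by gcongr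
        _ = D * κ * N * 1 := by ring
        _ ≤ D * κ * N * N := by gcongr
        _ = _ := by ring
    have e2 : (r : ℝ) * (D * N) ≤ D * κ * N ^ 2 := by
      calc (r : ℝ) * (D * N) ≤ N * (D * N) := by gcongr
        _ = D * 1 * N ^ 2 := by ring
        _ ≤ _ := by gcongr
    have e3 : (D : ℝ) * N ≤ D * κ * N ^ 2 := by
      calc (D : ℝ) * N = D * 1 * (N * 1) := by ring
        _ ≤ D * κ * (N * N) := by gcongr
        _ = _ := by ring
    have e4 : (η : ℝ) * r ≤ D * κ * N ^ 2 := by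
      calc (η : ℝ) * r ≤ N * N := by gcongr
        _ = 1 * 1 * N ^ 2 := by ring
        _ ≤ _ := by gcongr; linarith
    have e5 : (1 : ℝ) ≤ D * κ * N ^ 2 := by
      calc (1 : ℝ) = 1 * 1 * 1 ^ 2 := by ring
        _ ≤ _ := by gcongr; linarith
    rw [hl]; push_cast; linarith
  set n : ℕ := D * κ * (D * N * (h + r)) + 2 * l with hn
  -- The `14` is `2` from the copies plus twice the `6` of `hlN`. The square of `N` comes from `k₂ =
  -- D * N` and from up to `2 * N` vertices per copy.
  have hnN : (n : ℝ) ≤ 14 * D ^ 2 * κ * N ^ 2 := by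
    have e1 : (D : ℝ) * κ * (D * N * (h + r)) ≤ 2 * D ^ 2 * κ * N ^ 2 := by
      calc (D : ℝ) * κ * (D * N * (h + r)) ≤ D * κ * (D * N * (N + N)) := by gcongr
        _ = _ := by ring
    have e2 : (D : ℝ) * κ * N ^ 2 ≤ D ^ 2 * κ * N ^ 2 := by
      gcongr
      nlinarith
    rw [hn]; push_cast; linarith
  have hlpos : 0 < l := by omega
  have hnpos : (0 : ℝ) < n := by
    have : 0 < n := by omega
    exact_mod_cast this
  have hlogn : α * Real.log n ≤ (2 * α + ε / 2) * x := by
    have h1 : Real.log n ≤ Real.log (14 * D ^ 2) + Real.log κ + 2 * x := by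
      refine (Real.log_le_log hnpos hnN).trans (le_of_eq ?_)
      rw [Real.log_mul (by positivity) (by positivity), Real.log_mul (by positivity) (by positivity),
        Real.log_pow, hx]
      push_cast; ring
    have h2 : Real.log κ ≤ Real.log (β * x + 2) := Real.log_le_log (by linarith) hκx
    have h3 := hX x hx1 hx0
    calc α * Real.log n ≤ α * (Real.log (14 * D ^ 2) + Real.log (β * x + 2) + 2 * x) := by
          gcongr; linarith
      _ = α * (Real.log (β * x + 2) + Real.log (14 * D ^ 2)) + 2 * α * x := by ring
      _ ≤ _ := by linarith
  have h6D : 6 / (D : ℝ) ≤ 1 := by rw [div_le_one hD0]; linarith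
  have hρ : max 1 (α * Real.log n) * (1 + 6 / D) ≤ β * x := by
    rcases max_choice 1 (α * Real.log n) with h | h <;> rw [h]
    · linarith
    · calc α * Real.log n * (1 + 6 / D) ≤ (2 * α + ε / 2) * x * (1 + 6 / D) := by gcongr
        _ = (2 * α + ε / 2) * (1 + 6 / D) * x := by ring
        _ ≤ β * x := by gcongr
  have hsum : ((D * κ * (D * N) * c + l : ℕ) : ℝ) ≤ D * κ * (D * N) * c * (1 + 6 / D) := by
    push_cast
    calc (D : ℝ) * κ * (D * N) * c + l ≤ D * κ * (D * N) * c + 6 * (D * κ * N * c) := by gcongr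
      _ = _ := by field_simp
  calc max 1 (α * Real.log n) * ((D * κ * (D * N) * c + l : ℕ) : ℝ)
      ≤ max 1 (α * Real.log n) * (D * κ * (D * N) * c * (1 + 6 / D)) := by gcongr
    _ = D * κ * (D * N) * c * (max 1 (α * Real.log n) * (1 + 6 / D)) := by ring
    _ ≤ D * κ * (D * N) * c * (β * x) := by gcongr
    _ = ((D * κ : ℕ) : ℝ) * ((D * N : ℕ) : ℝ) * (β * x * c) := by push_cast; ring

end

section

open Turing Function

/-! ### Programs with counters and bit registers -/

namespace StackProg

/-- The stack contents given by the values of the unary counters and of the registers. -/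
def stk {C R : Type} (u : C → ℕ) (w : R → List Bool) : C ⊕ R → List Bool :=
  Sum.elim (fun c => List.replicate (u c) true) w

theorem isSome_head_stk {C R : Type} {u : C → ℕ} {w : R → List Bool} (c : C) : (stk u w (.inl c)).head?.isSome = decide (u c ≠ 0) := by
  simp only [stk, Sum.elim_inl]
  cases u c <;> simp [List.replicate_succ]

variable {C R : Type} [DecidableEq C] [DecidableEq R] {aux : TM2ComputableAux Bool Bool}

theorem update_stk_inl (u : C → ℕ) (w : R → List Bool) (c : C) (n : ℕ) :
    update (stk u w) (.inl c) (List.replicate n true) = stk (update u c n) w := by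
  funext z
  rcases z with z | z
  · by_cases h : z = c
    · subst h; simp [stk]
    · simp [stk, h]
  · simp [stk]

theorem update_stk_inr (u : C → ℕ) (w : R → List Bool) (r : R) (l : List Bool) :
    update (stk u w) (.inr r) l = stk u (update w r l) := by
  funext z
  rcases z with z | z
  · simp [stk]
  · by_cases h : z = r
    · subst h; simp [stk]
    · simp [stk, h]

/-- The fragment `p` transforms counters `u` and registers `w` into `u'` and `w'` in at most `t`
steps. -/
def Exec (p : Frag (C ⊕ R) aux) (u : C → ℕ) (w : R → List Bool) (u' : C → ℕ) (w' : R → List Bool)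
    (t : ℕ) : Prop :=
  Runs p (stk u w) (stk u' w') t

namespace Exec

variable {p q : Frag (C ⊕ R) aux} {u u' u'' : C → ℕ} {w w' w'' : R → List Bool} {t t' : ℕ}

theorem mono (h : Exec p u w u' w' t) (ht : t ≤ t') : Exec p u w u' w' t' :=
  Runs.mono h ht

theorem of_eq (h : Exec p u w u' w' t) (hu : u' = u'') (hw : w' = w'') (ht : t ≤ t') :
    Exec p u w u'' w'' t' := by
  subst hu hw
  exact h.mono ht

theorem of_start {v : C → ℕ} {x : R → List Bool} (h : Exec p u w u' w' t) (hu : u = v)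
    (hw : w = x) : Exec p v x u' w' t := by
  subst hu hw
  exact h

theorem seq (hp : Exec p u w u' w' t) (hq : Exec q u' w' u'' w'' t') :
    Exec (p.seq q) u w u'' w'' (t + t') :=
  Runs.seq hp hq

theorem skip : Exec (aux := aux) .skip u w u w 1 := runs_skip _

end Exec

namespace Frag

/-- Increment a counter. -/
def inc (c : C) : Frag (C ⊕ R) aux := .push (.inl c) true

/-- Decrement a counter. -/
def dec (c : C) : Frag (C ⊕ R) aux := .pop (.inl c)

/-- Push a bit on a register. -/
def pushB (r : R) (b : Bool) : Frag (C ⊕ R) aux := .push (.inr r) b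

/-- Remove the top of a register. -/
def popB (r : R) : Frag (C ⊕ R) aux := .pop (.inr r)

/-- Branch on a counter being nonzero. -/
def ifNZ (c : C) (p q : Frag (C ⊕ R) aux) : Frag (C ⊕ R) aux := .ite (.inl c) Option.isSome p q

/-- Branch on the top of a register being `true`. -/
def ifTop (r : R) (p q : Frag (C ⊕ R) aux) : Frag (C ⊕ R) aux :=
  .ite (.inr r) (fun o => o.getD false) p q

/-- Repeat as long as a counter is nonzero. -/
def whileNZ (c : C) (p : Frag (C ⊕ R) aux) : Frag (C ⊕ R) aux := .loop (.inl c) Option.isSome p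

/-- Repeat as long as a register is nonempty. -/
def whileNE (r : R) (p : Frag (C ⊕ R) aux) : Frag (C ⊕ R) aux := .loop (.inr r) Option.isSome p

/-- Repeat as long as the top of a register is `true`. -/
def whileTop (r : R) (p : Frag (C ⊕ R) aux) : Frag (C ⊕ R) aux :=
  .loop (.inr r) (fun o => o.getD false) p

/-- Repeat `p` as often as the counter `c` says; meanwhile `c` counts down and `d` counts up from
zero; at the end both are restored. -/
def forC (c d : C) (p : Frag (C ⊕ R) aux) : Frag (C ⊕ R) aux :=
  (whileNZ c (p.seq ((dec c).seq (inc d)))).seq (whileNZ d ((dec d).seq (inc c)))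

/-- Pop a bit from `r` and push it on `r'`. -/
def moveBit (r r' : R) : Frag (C ⊕ R) aux :=
  ifTop r ((popB r).seq (pushB r' true)) ((popB r).seq (pushB r' false))

/-- Move all bits of `r` to `r'`, reversing their order. -/
def moveAll (r r' : R) : Frag (C ⊕ R) aux := whileNE r (moveBit r r')

/-- Move the contents of the counter `c` to `d`. -/
def moveC (c d : C) : Frag (C ⊕ R) aux := whileNZ c ((dec c).seq (inc d))

/-- Empty a counter. -/
def clearC (c : C) : Frag (C ⊕ R) aux := whileNZ c (dec c)

/-- Empty a register. -/
def clearR (r : R) : Frag (C ⊕ R) aux := whileNE r (popB r)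

end Frag

open Frag

section Rules

variable {p q : Frag (C ⊕ R) aux} {u u' u'' : C → ℕ} {w w' w'' : R → List Bool} {t t' : ℕ}

theorem exec_inc (c : C) : Exec (aux := aux) (inc c) u w (update u c (u c + 1)) w 1 := by
  have := runs_push (aux := aux) (.inl c) true (stk u w)
  rw [show true :: stk u w (.inl c) = List.replicate (u c + 1) true from
    (List.replicate_succ).symm, update_stk_inl] at this
  exact this

theorem exec_dec (c : C) : Exec (aux := aux) (dec c) u w (update u c (u c - 1)) w 1 := by
  have := runs_pop (aux := aux) (.inl c) (stk u w)
  rw [show (stk u w (.inl c)).tail = List.replicate (u c - 1) true from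
    List.tail_replicate, update_stk_inl] at this
  exact this

theorem exec_pushB (r : R) (b : Bool) :
    Exec (aux := aux) (pushB r b) u w u (update w r (b :: w r)) 1 := by
  have := runs_push (aux := aux) (.inr r) b (stk u w)
  rw [update_stk_inr] at this
  exact this

theorem exec_popB (r : R) : Exec (aux := aux) (popB r) u w u (update w r (w r).tail) 1 := by
  have := runs_pop (aux := aux) (.inr r) (stk u w)
  rw [update_stk_inr] at this
  exact this

theorem exec_ifNZ_pos {c : C} (hc : u c ≠ 0) (h : Exec p u w u' w' t) :
    Exec (ifNZ c p q) u w u' w' (t + 1) :=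
  Runs.ite_true (by rw [isSome_head_stk]; simpa using hc) h

theorem exec_ifNZ_zero {c : C} (hc : u c = 0) (h : Exec q u w u' w' t) :
    Exec (ifNZ c p q) u w u' w' (t + 1) :=
  Runs.ite_false (by rw [isSome_head_stk]; simpa using hc) h

theorem exec_ifTop_true {r : R} {l : List Bool} (hr : w r = true :: l) (h : Exec p u w u' w' t) :
    Exec (ifTop r p q) u w u' w' (t + 1) :=
  Runs.ite_true (by simp [stk, hr]) h

theorem exec_ifTop_false {r : R} (hr : (w r).head?.getD false = false)
    (h : Exec q u w u' w' t) : Exec (ifTop r p q) u w u' w' (t + 1) :=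
  Runs.ite_false (by simpa [stk] using hr) h

theorem exec_whileNZ_zero {c : C} (hc : u c = 0) : Exec (whileNZ c p) u w u w 1 :=
  runs_loop_exit (by rw [isSome_head_stk]; simpa using hc)

theorem exec_whileNZ_pos {c : C} (hc : u c ≠ 0) (h : Exec p u w u' w' t)
    (h' : Exec (whileNZ c p) u' w' u'' w'' t') : Exec (whileNZ c p) u w u'' w'' (1 + t + t') :=
  Runs.loop_step (by rw [isSome_head_stk]; simpa using hc) h h'

theorem exec_whileNE_nil {r : R} (hr : w r = []) : Exec (whileNE r p) u w u w 1 :=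
  runs_loop_exit (by simp [stk, hr])

theorem exec_whileNE_cons {r : R} {b : Bool} {l : List Bool} (hr : w r = b :: l)
    (h : Exec p u w u' w' t) (h' : Exec (whileNE r p) u' w' u'' w'' t') :
    Exec (whileNE r p) u w u'' w'' (1 + t + t') :=
  Runs.loop_step (by simp [stk, hr]) h h'

theorem exec_whileTop_false {r : R} (hr : (w r).head?.getD false = false) :
    Exec (whileTop r p) u w u w 1 :=
  runs_loop_exit (by simpa [stk] using hr)

theorem exec_whileTop_true {r : R} {l : List Bool} (hr : w r = true :: l)
    (h : Exec p u w u' w' t) (h' : Exec (whileTop r p) u' w' u'' w'' t') :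
    Exec (whileTop r p) u w u'' w'' (1 + t + t') :=
  Runs.loop_step (by simp [stk, hr]) h h'

theorem exec_call (r : R) {l l' : List Bool} (hr : w r = l.reverse) (h : Outputs aux l l' t) :
    Exec (aux := aux) (.call (.inr r)) u w u (update w r l'.reverse)
      (l.length + t + l'.length + 2) := by
  have := runs_call (aux := aux) (Sum.inr r : C ⊕ R) (stk u w) l l' t hr h
  rw [update_stk_inr] at this
  exact this

theorem exec_moveC {c d : C} (hcd : c ≠ d) :
    Exec (aux := aux) (moveC c d) u w (update (update u c 0) d (u d + u c)) w (3 * u c + 1) := by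
  induction hn : u c generalizing u with
  | zero =>
    have : update (update u c 0) d (u d + 0) = u := by
      funext z; simp only [update_apply]; split_ifs <;> simp_all
    rw [this]
    exact exec_whileNZ_zero hn
  | succ n ih =>
    have h1 := (exec_dec (aux := aux) (u := u) (w := w) c).seq (exec_inc d)
    have h2 := ih (u := update (update u c (u c - 1)) d (update u c (u c - 1) d + 1))
      (by simp [hcd, hn])
    refine (exec_whileNZ_pos (by omega) h1 h2).of_eq ?_ rfl (by omega)
    funext z
    simp only [update_apply]
    split_ifs <;> simp_all <;> omega

theorem exec_clearC (c : C) :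
    Exec (aux := aux) (clearC c) u w (update u c 0) w (2 * u c + 1) := by
  induction hn : u c generalizing u with
  | zero =>
    have : update u c 0 = u := by rw [← hn, update_eq_self]
    rw [this]
    exact exec_whileNZ_zero hn
  | succ n ih =>
    have h1 := exec_dec (aux := aux) (u := u) (w := w) c
    have h2 := ih (u := update u c (u c - 1)) (by simp [hn])
    rw [update_idem] at h2
    exact (exec_whileNZ_pos (by omega) h1 h2).mono (by omega)

theorem exec_clearR (r : R) :
    Exec (aux := aux) (clearR r) u w u (update w r []) (2 * (w r).length + 1) := by
  induction hl : w r generalizing w with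
  | nil =>
    have : update w r [] = w := by rw [← hl, update_eq_self]
    rw [this]
    exact exec_whileNE_nil hl
  | cons b l ih =>
    have h1 := exec_popB (aux := aux) (u := u) (w := w) r
    have h2 := ih (w := update w r (w r).tail) (by simp [hl])
    rw [update_idem] at h2
    refine (exec_whileNE_cons hl h1 h2).mono ?_
    simp only [List.length_cons]; omega

theorem exec_moveBit {r r' : R} (hr : r ≠ r') {b : Bool} {l : List Bool} (h : w r = b :: l) :
    Exec (aux := aux) (moveBit r r') u w u (update (update w r l) r' (b :: w r')) 3 := by
  cases b with
  | true =>
    refine exec_ifTop_true h (((exec_popB r).seq (exec_pushB r' true)).of_eq rfl ?_ le_rfl)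
    simp [h, hr.symm]
  | false =>
    refine exec_ifTop_false (by simp [h]) (((exec_popB r).seq (exec_pushB r' false)).of_eq rfl ?_ le_rfl)
    simp [h, hr.symm]

theorem exec_moveAll {r r' : R} (hr : r ≠ r') :
    Exec (aux := aux) (moveAll r r') u w u (update (update w r []) r' ((w r).reverse ++ w r'))
      (4 * (w r).length + 1) := by
  induction hl : w r generalizing w with
  | nil =>
    have : update (update w r []) r' (([] : List Bool).reverse ++ w r') = w := by
      funext z; simp only [update_apply]; split_ifs <;> simp_all
    rw [this]
    exact exec_whileNE_nil hl
  | cons b l ih =>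
    have h1 := exec_moveBit (aux := aux) (u := u) hr hl
    have h2 := ih (w := update (update w r l) r' (b :: w r')) (by simp [hr])
    refine (exec_whileNE_cons hl h1 h2).of_eq rfl ?_ (by simp only [List.length_cons]; omega)
    funext z
    simp only [update_apply]
    split_ifs <;> simp_all

/-- The loop rule, with an invariant. -/
theorem exec_forC {c d : C} (hcd : c ≠ d) {n : ℕ} {Inv : ℕ → (C → ℕ) → (R → List Bool) → Prop}
    (hbody : ∀ k < n, ∀ u w, Inv k u w → u c = n - k → u d = k →
      ∃ u' w', Exec p u w u' w' t ∧ u' c = n - k ∧ u' d = k ∧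
        Inv (k + 1) (update (update u' c (n - (k + 1))) d (k + 1)) w')
    (h0 : Inv 0 u w) (hc : u c = n) (hd : u d = 0) :
    ∃ u' w', Exec (forC c d p) u w (update (update u' c n) d 0) w' (n * (t + 6) + 2) ∧
      Inv n u' w' ∧ u' c = 0 ∧ u' d = n := by
  have key : ∀ m k, m + k = n → ∀ u w, Inv k u w → u c = n - k → u d = k →
      ∃ u' w', Exec (whileNZ c (p.seq ((dec c).seq (inc d)))) u w u' w' (m * (t + 3) + 1) ∧
        Inv n u' w' ∧ u' c = 0 ∧ u' d = n := by
    intro m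
    induction m with
    | zero =>
      intro k hk u w hI hc hd
      obtain rfl : k = n := by omega
      exact ⟨u, w, (exec_whileNZ_zero (by omega)).mono (by omega), hI, by omega, hd⟩
    | succ m ih =>
      intro k hk u w hI hc hd
      obtain ⟨u', w', he, hc', hd', hI'⟩ := hbody k (by omega) u w hI hc hd
      have h1 := he.seq ((exec_dec c).seq (exec_inc d))
      have hu : update (update u' c (u' c - 1)) d (update u' c (u' c - 1) d + 1) =
          update (update u' c (n - (k + 1))) d (k + 1) := by
        rw [update_of_ne hcd.symm, hd', hc']
        congr 1
      rw [hu] at h1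
      obtain ⟨u'', w'', he', hI'', hc'', hd''⟩ := ih (k + 1) (by omega) _ _ hI'
        (by simp [hcd]) (by simp)
      refine ⟨u'', w'', (exec_whileNZ_pos (by omega) h1 he').mono ?_, hI'', hc'', hd''⟩
      rw [Nat.succ_mul]; omega
  obtain ⟨u', w', he, hI, hc', hd'⟩ := key n 0 (by omega) u w h0 (by omega) hd
  -- Each round costs `t + 3` steps, and restoring the counter three more per round.
  refine ⟨u', w', (he.seq (exec_moveC (aux := aux) hcd.symm)).of_eq ?_ rfl ?_, hI, hc', hd'⟩
  · rw [hc', hd']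
    funext z
    simp only [update_apply]
    split_ifs <;> simp_all
  · rw [hd']; ring_nf; omega

/-- The loop rule, with explicit intermediate states. -/
theorem exec_forC_of_states {c d : C} (hcd : c ≠ d) {n : ℕ} {U : ℕ → C → ℕ}
    {W : ℕ → R → List Bool}
    (hbody : ∀ k < n, Exec p (update (update (U k) c (n - k)) d k) (W k)
      (update (update (U (k + 1)) c (n - k)) d k) (W (k + 1)) t)
    (hc : U 0 c = n) (hd : U 0 d = 0) (hn : U n c = n) (hn' : U n d = 0) :
    Exec (forC c d p) (U 0) (W 0) (U n) (W n) (n * (t + 6) + 2) := by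
  -- The invariant overwrites the two loop counters of `U k`, so their values in `U k` matter only
  -- at both ends.
  obtain ⟨u', w', he, ⟨rfl, rfl⟩, -, -⟩ := exec_forC (p := p) (t := t) (u := U 0) (w := W 0) hcd
    (Inv := fun k u w => u = update (update (U k) c (n - k)) d k ∧ w = W k) (n := n)
    (fun k hk u w hI _ _ => by
      obtain ⟨rfl, rfl⟩ := hI
      refine ⟨_, _, hbody k hk, by simp [hcd], by simp, ?_, rfl⟩
      funext z
      simp only [update_apply]
      split_ifs <;> simp_all)
    ⟨by
      funext z
      simp only [update_apply]
      split_ifs <;> simp_all, rfl⟩ hc hd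
  refine he.of_eq ?_ rfl le_rfl
  funext z
  simp only [update_apply]
  split_ifs <;> simp_all

/-- The loop rule for a body that leaves the counters alone. -/
theorem exec_forC_const {c d : C} (hcd : c ≠ d) {n : ℕ} {W : ℕ → R → List Bool}
    (hbody : ∀ k < n, Exec p (update (update u c (n - k)) d k) (W k)
      (update (update u c (n - k)) d k) (W (k + 1)) t)
    (hc : u c = n) (hd : u d = 0) :
    Exec (forC c d p) u (W 0) u (W n) (n * (t + 6) + 2) :=
  exec_forC_of_states (U := fun _ => u) hcd hbody hc hd hc hd

end Rules

end StackProg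

end

/-! ### Comparison of counters -/

section

open Turing Function

namespace StackProg

section Compare

variable {C R : Type} [DecidableEq C] [DecidableEq R] {aux : TM2ComputableAux Bool Bool}

namespace Frag

/-- Set the flag `fl`. -/
def raise (fl : C) : Frag (C ⊕ R) aux := ifNZ fl skip (inc fl)

/-- Raise the flag `fl` unless the counter `x` is at most the counter `y`. -/
def leTest (x y d e fl : C) : Frag (C ⊕ R) aux :=
  (forC x d (ifNZ y ((dec y).seq (inc e)) (raise fl))).seq (moveC e y)

end Frag

open Frag

variable {u : C → ℕ} {w : R → List Bool}

theorem exec_raise {fl : C} {c : Bool} (h : u fl = c.toNat) :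
    Exec (aux := aux) (raise fl) u w (update u fl 1) w 2 := by
  cases c with
  | true =>
    refine exec_ifNZ_pos (by simp [h]) (Exec.skip.of_eq ?_ rfl le_rfl)
    rw [← show u fl = 1 by simp [h], update_eq_self]
  | false =>
    refine exec_ifNZ_zero (by simp [h]) ((exec_inc fl).of_eq ?_ rfl le_rfl)
    simp [h]

theorem exec_leTest {x y d e fl : C} (hn : [x, y, d, e, fl].Nodup) {c : Bool}
    (hd : u d = 0) (he : u e = 0) (hf : u fl = c.toNat) :
    Exec (aux := aux) (leTest x y d e fl) u w
      (update u fl (c || !decide (u x ≤ u y)).toNat) w (12 * u x + 3) := by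
  simp only [List.nodup_cons, List.mem_cons, List.not_mem_nil, or_false, not_or, ← ne_eq] at hn
  obtain ⟨⟨hxy, hxd, hxe, hxf⟩, ⟨hyd, hye, hyf⟩, ⟨hde, hdf⟩, hef, -⟩ := hn
  have hyx := hxy.symm
  have hdx := hxd.symm
  have hex := hxe.symm
  have hfx := hxf.symm
  have hdy := hyd.symm
  have hey := hye.symm
  have hfy := hyf.symm
  have hed := hde.symm
  have hfd := hdf.symm
  have hfe := hef.symm
  -- After `k` rounds `y` holds the truncated difference `u y - k`, `e` holds the part `min k (u y)`
  -- taken from it, and the flag also records whether `y` has run out.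
  have key := exec_forC_of_states (aux := aux) (c := x) (d := d) (n := u x)
    (p := ifNZ y ((dec y).seq (inc e)) (raise fl)) hxd (t := 3)
    (U := fun k => update (update (update u y (u y - k)) e (min k (u y))) fl
      (c || decide (u y < k)).toNat) (W := fun _ => w) ?_ ?_ ?_ ?_ ?_
  · have h0 : update (update (update u y (u y - 0)) e (min 0 (u y))) fl
        (c || decide (u y < 0)).toNat = u := by
      funext z
      simp only [update_apply]
      split_ifs <;> simp_all
    have k2 := key.seq (exec_moveC (aux := aux) hey)
    have h1 : update (update (update u y (u y - u x)) e (min (u x) (u y))) fl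
        (c || decide (u y < u x)).toNat e = min (u x) (u y) := by simp [hef]
    simp only [h0, h1] at k2
    refine k2.of_eq ?_ rfl (by omega)
    have h2 : decide (u y < u x) = !decide (u x ≤ u y) := by
      rw [← decide_not, decide_eq_decide]; omega
    rw [h2]
    funext z
    simp only [update_apply]
    split_ifs <;> subst_vars <;> first | contradiction | omega
  · intro k hk
    by_cases hy : k < u y
    · have h1 : decide (u y < k) = false := by simp; omega
      have h2 : decide (u y < k + 1) = false := by simp; omega
      have h3 : min k (u y) = k := by omega
      have h4 : min (k + 1) (u y) = k + 1 := by omega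
      simp only [h1, h2, h3, h4, Bool.or_false]
      refine exec_ifNZ_pos (by simp [hyd, hyx, hyf, hye]; omega)
        (((exec_dec y).seq (exec_inc e)).of_eq ?_ rfl le_rfl)
      funext z
      simp only [update_apply]
      split_ifs <;> subst_vars <;> first | contradiction | omega
    · have h2 : decide (u y < k + 1) = true := by simp; omega
      have h3 : min k (u y) = u y := by omega
      have h4 : min (k + 1) (u y) = u y := by omega
      have h5 : u y - k = 0 := by omega
      have h6 : u y - (k + 1) = 0 := by omega
      simp only [h2, h3, h4, h5, h6, Bool.or_true, Bool.toNat_true]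
      refine exec_ifNZ_zero (by simp [hyd, hyx, hyf, hye])
        ((exec_raise (c := (c || decide (u y < k))) ?_).of_eq ?_ rfl le_rfl)
      · simp [hfd, hfx]
      · funext z
        simp only [update_apply]
        split_ifs <;> subst_vars <;> first | contradiction | omega
  · simp [hxe, hxf]
  · simp [hde, hdf, hd]
  · simp [hxy, hxe, hxf]
  · simp [hdy, hde, hdf, hd]

end Compare

end StackProg

end

section

open Turing Function

/-! ### The state of the reduction machine -/

namespace StackProg

/-- The five index types of the vertices of the constructed graph. -/
inductive Ix
  | j | p | q | a | i
  deriving DecidableEq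

instance : Fintype Ix :=
  ⟨{.j, .p, .q, .a, .i}, fun x => by cases x <;> simp⟩

/-- The counters that do not run through indices. -/
inductive Oth
  | kcnt | krem | rcnt | rrem | icnt | irem | ta | tb | flag | cnum | bnum | good
  deriving DecidableEq

instance : Fintype Oth :=
  ⟨{.kcnt, .krem, .rcnt, .rrem, .icnt, .irem, .ta, .tb, .flag, .cnum, .bnum, .good}, fun x => by cases x <;> simp⟩

/-- The counters. The index counters come in two rows, for the two ends of an edge; a loop over an
index counts `cnt` up and `rem` down. -/
inductive Ctr
  | cnt (row : Bool) (x : Ix)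
  | rem (row : Bool) (x : Ix)
  | oth (o : Oth)
  deriving DecidableEq, Fintype

/-- The bit registers. -/
inductive Reg
  | inp | aside | out | sol | cand | best
  deriving DecidableEq

instance : Fintype Reg :=
  ⟨{.inp, .aside, .out, .sol, .cand, .best}, fun x => by cases x <;> simp⟩

/-- The counter values when the index ranges are `n` and the indices have the values `pos`. -/
def cst (n : Ix → ℕ) (pos : Bool × Ix → ℕ) (g : Oth → ℕ) : Ctr → ℕ
  | .cnt r x => pos (r, x)
  | .rem r x => n x - pos (r, x)
  | .oth o => g o

section State

variable {n : Ix → ℕ} {pos : Bool × Ix → ℕ} {g : Oth → ℕ}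

@[simp] theorem cst_cnt (r : Bool) (x : Ix) : cst n pos g (.cnt r x) = pos (r, x) := rfl

@[simp] theorem cst_rem (r : Bool) (x : Ix) : cst n pos g (.rem r x) = n x - pos (r, x) := rfl

@[simp] theorem cst_oth (o : Oth) : cst n pos g (.oth o) = g o := rfl

theorem update_cst_oth (o : Oth) (m : ℕ) :
    update (cst n pos g) (.oth o) m = cst n pos (update g o m) := by
  funext z
  cases z <;> simp [cst, update_apply]

/-- While an index loop runs, the counters keep the form `cst`; the body of the loop can thus be
specified through `pos` alone. -/
theorem update_cst_cnt (r : Bool) (x : Ix) (k : ℕ) :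
    update (update (cst n pos g) (.rem r x) (n x - k)) (.cnt r x) k =
      cst n (update pos (r, x) k) g := by
  funext z
  cases z with
  | cnt r' x' => simp [cst, update_apply]
  | rem r' x' =>
    simp only [cst, update_apply, Ctr.rem.injEq, reduceCtorEq, if_false, Prod.mk.injEq]
    split_ifs with h
    · rw [h.2]
    · rfl
  | oth o => simp [cst]

end State

variable {aux : TM2ComputableAux Bool Bool}

/-- Programs of the reduction machine. -/
abbrev Prog (aux : TM2ComputableAux Bool Bool) : Type 1 := Frag (Ctr ⊕ Reg) aux

open Frag

/-! ### Emitting bits -/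

/-- With input `bits`, index ranges `n` and index values `pos`, the program `p` appends the bits `l`
to the output. -/
def Emits (n : Ix → ℕ) (g : Oth → ℕ) (bits : List Bool) (p : Prog aux) (pos : Bool × Ix → ℕ)
    (l : List Bool) (t : ℕ) : Prop :=
  ∀ w : Reg → List Bool, w .inp = bits → w .aside = [] →
    Exec p (cst n pos g) w (cst n pos g) (update w .out (l.reverse ++ w .out)) t

/-- The program `p` raises the flag unless `b` holds. -/
def Checks (n : Ix → ℕ) (g : Oth → ℕ) (bits : List Bool) (p : Prog aux) (pos : Bool × Ix → ℕ)
    (b : Bool) (t : ℕ) : Prop :=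
  ∀ (w : Reg → List Bool) (c : Bool), w .inp = bits → w .aside = [] →
    Exec p (cst n pos (update g .flag c.toNat)) w
      (cst n pos (update g .flag (c || !b).toNat)) w t

/-- Time for a loop of at most `B` rounds that take time `t`. -/
def loopTime (B t : ℕ) : ℕ := B * (t + 6) + 2

namespace Frag

/-- Loop over an index. -/
def forX (r : Bool) (x : Ix) (p : Prog aux) : Prog aux := forC (.rem r x) (.cnt r x) p

/-- Emit a bit. -/
def emit (b : Bool) : Prog aux := pushB .out b

/-- Emit the conjunction of checks. -/
def emitAll (ps : List (Prog aux)) : Prog aux :=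
  (ps.foldr seq skip).seq
    (ifNZ (.oth .flag) ((dec (.oth .flag)).seq (emit false)) (emit true))

/-- Check that the two rows agree on an index. -/
def eqCheck (x : Ix) : Prog aux :=
  (leTest (.cnt false x) (.cnt true x) (.oth .ta) (.oth .tb) (.oth .flag)).seq
    (leTest (.cnt true x) (.cnt false x) (.oth .ta) (.oth .tb) (.oth .flag))

/-- Check that the bit of the input at the indices `j` of the row `r` and `i` of the other row is
`false`. -/
def bitCheck (r : Bool) : Prog aux :=
  (forC (.cnt r .j) (.oth .ta) (forC (.oth .irem) (.oth .icnt) (moveBit .inp .aside))).seq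
    ((forC (.cnt (!r) .i) (.oth .ta) (moveBit .inp .aside)).seq
      ((ifTop .inp (raise (.oth .flag)) skip).seq (moveAll .aside .inp)))

end Frag

section Rules

variable {n : Ix → ℕ} {g : Oth → ℕ} {bits : List Bool} {pos : Bool × Ix → ℕ}

theorem emits_emit (b : Bool) : Emits (aux := aux) n g bits (emit b) pos [b] 1 :=
  fun _ _ _ => exec_pushB _ _

theorem Emits.mono {p : Prog aux} {l : List Bool} {t t' : ℕ} (h : Emits n g bits p pos l t)
    (ht : t ≤ t') : Emits n g bits p pos l t' :=
  fun w hw hw' => (h w hw hw').mono ht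

theorem Emits.seq {p p' : Prog aux} {l l' : List Bool} {t t' : ℕ} (h : Emits n g bits p pos l t)
    (h' : Emits n g bits p' pos l' t') : Emits n g bits (p.seq p') pos (l ++ l') (t + t') := by
  intro w hw hw'
  refine ((h w hw hw').seq (h' _ (by simpa using hw) (by simpa using hw'))).of_eq rfl ?_ le_rfl
  simp

theorem Emits.forX {r : Bool} {x : Ix} {p : Prog aux} {l : ℕ → List Bool} {t B : ℕ}
    (hB : n x ≤ B) (h0 : pos (r, x) = 0)
    (h : ∀ k < n x, Emits n g bits p (update pos (r, x) k) (l k) t) :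
    Emits n g bits (forX r x p) pos ((List.range (n x)).flatMap l) (loopTime B t) := by
  intro w hw hw'
  have key := exec_forC_const (aux := aux) (c := Ctr.rem r x) (d := .cnt r x) (p := p) (t := t)
    (u := cst n pos g) (n := n x) (by simp)
    (W := fun k => update w .out (((List.range k).flatMap l).reverse ++ w .out)) ?_
    (by simp [h0]) (by simp [h0])
  · refine (key.of_start rfl (by simp)).of_eq rfl rfl ?_
    unfold loopTime; gcongr
  · intro k hk
    rw [update_cst_cnt]
    refine (h k hk _ (by simpa using hw) (by simpa using hw')).of_eq rfl ?_ le_rfl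
    simp [List.range_succ]

theorem Checks.foldr {ι : Type*} (f : ι → Prog aux) (b : ι → Bool) {t : ℕ} (l : List ι)
    (h : ∀ x ∈ l, Checks n g bits (f x) pos (b x) t) :
    Checks n g bits ((l.map f).foldr Frag.seq .skip) pos (l.all b) (l.length * t + 1) := by
  induction l with
  | nil => intro w c _ _; simpa using Exec.skip.mono (by simp)
  | cons x l ih =>
    intro w c hw hw'
    refine ((h x (by simp) w c hw hw').seq (ih (fun y hy => h y (by simp [hy])) w _ hw hw')).of_eq
      ?_ rfl (by simp only [List.length_cons]; ring_nf; omega)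
    cases c <;> cases hb : b x <;> simp [hb]

theorem emits_emitAll {ι : Type*} (f : ι → Prog aux) (b : ι → Bool) {t : ℕ} (l : List ι)
    (hg : g .flag = 0) (h : ∀ x ∈ l, Checks n g bits (f x) pos (b x) t) :
    Emits n g bits (emitAll (l.map f)) pos [l.all b] (l.length * t + 4) := by
  intro w hw hw'
  have h1 := Checks.foldr f b l h w false hw hw'
  have e : update g .flag (Bool.toNat false) = g := by
    rw [show Bool.toNat false = g .flag by simp [hg], update_eq_self]
  rw [e] at h1
  cases hb : l.all b with
  | true =>
    rw [hb, Bool.not_true, Bool.or_false, e] at h1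
    exact (h1.seq (exec_ifNZ_zero (by simpa using hg) (emits_emit true w hw hw'))).mono (by omega)
  | false =>
    rw [hb] at h1
    refine (h1.seq (exec_ifNZ_pos (by simp) ((exec_dec _).seq (exec_pushB _ _)))).of_eq ?_ rfl
      (by omega)
    have : update g .flag 0 = g := by rw [← hg, update_eq_self]
    simp [update_cst_oth, this]

end Rules

end StackProg

end

/-! ### Testing indices and incidence bits -/

section

open Turing Function

namespace StackProg

variable {aux : TM2ComputableAux Bool Bool}

open Frag

/-- The auxiliary counters are in their resting state, `η` being the number of items. -/
structure Ready (η : ℕ) (g : Oth → ℕ) : Prop where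
  ta : g .ta = 0
  tb : g .tb = 0
  flag : g .flag = 0
  icnt : g .icnt = 0
  irem : g .irem = η

section Checks

variable {n : Ix → ℕ} {g : Oth → ℕ} {bits : List Bool} {pos : Bool × Ix → ℕ} {η : ℕ}

theorem checks_leTest (hg : Ready η g) {x y : Ctr} (hx : ∀ o, x ≠ .oth o) (hy : ∀ o, y ≠ .oth o)
    (hxy : x ≠ y) :
    Checks (aux := aux) n g bits (leTest x y (.oth .ta) (.oth .tb) (.oth .flag)) pos
      (decide (cst n pos g x ≤ cst n pos g y)) (12 * cst n pos g x + 3) := by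
  intro w c _ _
  have hf : ∀ z : Ctr, (∀ o, z ≠ .oth o) →
      cst n pos (update g .flag c.toNat) z = cst n pos g z := by
    intro z hz
    cases z with
    | oth o => exact absurd rfl (hz o)
    | _ => rfl
  have h1 := exec_leTest (aux := aux) (w := w) (u := cst n pos (update g .flag c.toNat))
    (x := x) (y := y) (d := .oth .ta) (e := .oth .tb) (fl := .oth .flag) (c := c)
    (by simp [hx, hy, hxy]) (by simp [hg.ta]) (by simp [hg.tb]) (by simp)
  rw [hf x hx, hf y hy, update_cst_oth, update_idem] at h1
  exact h1

theorem checks_eqCheck (hg : Ready η g) {x : Ix} {B : ℕ} (h₁ : pos (false, x) ≤ B)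
    (h₂ : pos (true, x) ≤ B) :
    Checks (aux := aux) n g bits (eqCheck x) pos (decide (pos (false, x) = pos (true, x)))
      (24 * B + 6) := by
  intro w c hw hw'
  have h := (checks_leTest (aux := aux) (n := n) (bits := bits) (pos := pos) hg
    (x := .cnt false x) (y := .cnt true x) (by simp) (by simp) (by simp) w c hw hw').seq
    (checks_leTest hg (x := .cnt true x) (y := .cnt false x) (by simp) (by simp) (by simp) w _ hw hw')
  refine h.of_eq ?_ rfl (by simp only [cst_cnt]; omega)
  have : decide (pos (false, x) = pos (true, x)) =
      (decide (pos (false, x) ≤ pos (true, x)) && decide (pos (true, x) ≤ pos (false, x))) := by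
    rw [← Bool.decide_and, decide_eq_decide, le_antisymm_iff]
  rw [this]
  cases c
  · simp only [Bool.false_or, Bool.not_and]
    rfl
  · simp

/-- The registers when the first `k` bits of the input have been put aside. -/
def shifted (bits : List Bool) (k : ℕ) (w : Reg → List Bool) : Reg → List Bool :=
  update (update w .inp (bits.drop k)) .aside (bits.take k).reverse

theorem exec_moveBit_shifted {u : Ctr → ℕ} {w : Reg → List Bool} {k : ℕ} (hk : k < bits.length) :
    Exec (aux := aux) (moveBit .inp .aside) u (shifted bits k w) u (shifted bits (k + 1) w) 3 := by
  refine (exec_moveBit (b := bits[k]) (l := bits.drop (k + 1)) (by simp) ?_).of_eq rfl ?_ le_rfl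
  · simp [shifted]
  · funext z
    cases z with
    | aside =>
      simp only [shifted, update_self, List.take_succ_eq_append_getElem hk, List.reverse_append]
      rfl
    | _ => simp [shifted]

/-- The incidence matrix is stored set by set, so the bit is reached by putting aside `j` rows of
`η` bits and `i` further bits, which are moved back afterwards. The rows are measured by `irem`, as
the item counters of both rows may belong to running loops. -/
theorem checks_bitCheck (hg : Ready η g) {r : Bool} {h B : ℕ} (hb : bits.length = h * η)
    (hj : pos (r, .j) < h) (hi : pos (!r, .i) < η) (hB : h ≤ B) (hB' : η ≤ B) :
    Checks (aux := aux) n g bits (bitCheck r) pos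
      (!(bits.getD (pos (r, .j) * η + pos (!r, .i)) false))
      (loopTime B (loopTime B 3) + loopTime B 3 + 4 * (B * B) + 4) := by
  intro w c hw hw'
  set g' := update g .flag c.toNat with hg'
  set j := pos (r, .j)
  set i := pos (!r, .i)
  have hlt : j * η + i < bits.length := by
    rw [hb]; nlinarith
  have h0 : shifted bits 0 w = w := by
    funext z
    cases z <;> simp [shifted, hw, hw']
  have e1 : Exec (aux := aux) (forC (.cnt r .j) (.oth .ta)
      (forC (.oth .irem) (.oth .icnt) (moveBit .inp .aside))) (cst n pos g') w (cst n pos g')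
      (shifted bits (j * η) w) (loopTime B (loopTime B 3)) := by
    have := exec_forC_const (aux := aux) (c := Ctr.cnt r .j) (d := .oth .ta) (u := cst n pos g')
      (p := forC (.oth .irem) (.oth .icnt) (moveBit .inp .aside)) (t := loopTime B 3) (n := j)
      (by simp) (W := fun k => shifted bits (k * η) w) ?_ rfl (by simp [hg', hg.ta])
    · refine (this.of_start rfl (by simp [h0])).mono ?_
      unfold loopTime
      gcongr
      omega
    · intro k hk
      have := exec_forC_const (aux := aux) (c := Ctr.oth .irem) (d := .oth .icnt)
        (u := update (update (cst n pos g') (.cnt r .j) (j - k)) (.oth .ta) k)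
        (p := moveBit .inp .aside) (t := 3) (n := η)
        (by simp) (W := fun m => shifted bits (k * η + m) w)
        (fun m hm => exec_moveBit_shifted (by rw [hb]; nlinarith))
        (by simp [hg', hg.irem]) (by simp [hg', hg.icnt])
      refine this.of_eq rfl (by rw [Nat.succ_mul]) ?_
      unfold loopTime
      gcongr
  have e2 : Exec (aux := aux) (forC (.cnt (!r) .i) (.oth .ta) (moveBit .inp .aside)) (cst n pos g')
      (shifted bits (j * η) w) (cst n pos g') (shifted bits (j * η + i) w) (loopTime B 3) := by
    have := exec_forC_const (aux := aux) (c := Ctr.cnt (!r) .i) (d := .oth .ta) (u := cst n pos g')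
      (p := moveBit .inp .aside) (t := 3) (n := i)
      (by simp) (W := fun k => shifted bits (j * η + k) w)
      (fun m hm => exec_moveBit_shifted (by omega)) rfl (by simp [hg', hg.ta])
    refine this.mono ?_
    unfold loopTime
    gcongr
    omega
  have e3 : Exec (aux := aux) (ifTop .inp (raise (.oth .flag)) skip) (cst n pos g')
      (shifted bits (j * η + i) w) (cst n pos (update g .flag
        (c || !(!(bits.getD (j * η + i) false))).toNat)) (shifted bits (j * η + i) w) 3 := by
    have hs : shifted bits (j * η + i) w .inp = bits[j * η + i] :: bits.drop (j * η + i + 1) := by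
      simp [shifted]
    rw [List.getD_eq_getElem _ _ hlt]
    cases hbit : bits[j * η + i] with
    | true =>
      rw [hbit] at hs
      refine exec_ifTop_true hs ((exec_raise (c := c) (by simp [hg'])).of_eq ?_ rfl le_rfl)
      rw [update_cst_oth, hg', update_idem]
      simp
    | false =>
      rw [hbit] at hs
      refine (exec_ifTop_false (by rw [hs]; rfl) Exec.skip).of_eq ?_ rfl (by omega)
      simp [hg']
  have e4 : Exec (aux := aux) (moveAll .aside .inp) (cst n pos (update g .flag
        (c || !(!(bits.getD (j * η + i) false))).toNat)) (shifted bits (j * η + i) w)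
      (cst n pos (update g .flag (c || !(!(bits.getD (j * η + i) false))).toNat)) w
      (4 * (B * B) + 1) := by
    refine (exec_moveAll (by simp)).of_eq rfl ?_ ?_
    · funext z
      cases z <;> simp [shifted, hw, hw']
    · have : (shifted bits (j * η + i) w .aside).length ≤ h * η := by
        simp [shifted, hb]
      have : h * η ≤ B * B := Nat.mul_le_mul hB hB'
      omega
  exact (e1.seq (e2.seq (e3.seq e4))).mono (by omega)

end Checks

end StackProg

end

/-! ### The edge relation as tests on indices -/

section

open Turing Function

namespace Vtx

variable {J P Q A I : Type} {mem : I → J → Prop}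

/-- The edges of the graph, by cases. -/
def ArcSpec (mem : I → J → Prop) : Vtx J P Q A I → Vtx J P Q A I → Prop
  | .s j p _, .core (.T j' p') => j = j' ∧ p = p'
  | .s j p _, .core (.W j' p') => j = j' ∧ p = p'
  | .s _ _ q, .core (.B q') => q = q'
  | .s _ p q, .y _ p' q' => p = p' ∧ q = q'
  | .y a _ q, .core (.Y a' q') => a = a' ∧ q = q'
  | .y a _ _, .core (.X _ a') => a = a'
  | .core (.W j _), .core (.X i _) => ¬ mem i j
  | .core .D, .core (.X _ _) => True
  | .core c, .leaf c' => c = c'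
  | _, _ => False

theorem arc_iff {u v : Vtx J P Q A I} : Arc mem u v ↔ ArcSpec mem u v := by
  constructor
  · rintro ⟨⟩ <;> simp_all [ArcSpec]
  · intro h
    unfold ArcSpec at h
    split at h
    · obtain ⟨rfl, rfl⟩ := h; exact .sT ..
    · obtain ⟨rfl, rfl⟩ := h; exact .sW ..
    · subst h; exact .sB ..
    · obtain ⟨rfl, rfl⟩ := h; exact .sy ..
    · obtain ⟨rfl, rfl⟩ := h; exact .yY ..
    · subst h; exact .yX ..
    · exact .WX _ _ _ _ h
    · exact .DX ..
    · subst h; exact .leaf _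
    · exact h.elim

/-- Edges depend only on equalities between indices and on membership, both of which survive
injective renaming. This carries the graph from `Fin` to natural numbers. -/
theorem arc_map_iff {J' P' Q' A' I' : Type} {fj : J → J'} {fp : P → P'} {fq : Q → Q'} {fa : A → A'}
    {fi : I → I'} (hj : Injective fj) (hp : Injective fp) (hq : Injective fq) (ha : Injective fa)
    (hi : Injective fi) {mem' : I' → J' → Prop} (hm : ∀ i j, mem' (fi i) (fj j) ↔ mem i j)
    {u v : Vtx J P Q A I} :
    Arc mem' (u.map fj fp fq fa fi) (v.map fj fp fq fa fi) ↔ Arc mem u v := by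
  rw [arc_iff, arc_iff]
  rcases u with _ | _ | (_ | _) | (_ | _) <;> rcases v with _ | _ | (_ | _) | (_ | _) <;>
    simp [map, ArcSpec, hj.eq_iff, hp.eq_iff, hq.eq_iff, ha.eq_iff, hi.eq_iff, hm]

end Vtx

namespace StackProg

variable {aux : TM2ComputableAux Bool Bool}

open Frag

/-- The classes of core vertices. -/
abbrev CoreClass : Type := Core Unit Unit Unit Unit Unit

/-- The classes of vertices. -/
abbrev VtxClass : Type := Vtx Unit Unit Unit Unit Unit

/-- The core vertex of the class `c` whose indices are those of the row `r`. -/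
def coreAt (r : Bool) (pos : Bool × Ix → ℕ) : CoreClass → Core ℕ ℕ ℕ ℕ ℕ
  | .T _ _ => .T (pos (r, .j)) (pos (r, .p))
  | .W _ _ => .W (pos (r, .j)) (pos (r, .p))
  | .Y _ _ => .Y (pos (r, .a)) (pos (r, .q))
  | .B _ => .B (pos (r, .q))
  | .X _ _ => .X (pos (r, .i)) (pos (r, .a))
  | .D => .D

/-- The vertex of the class `c` whose indices are those of the row `r`. -/
def vtxAt (r : Bool) (pos : Bool × Ix → ℕ) : VtxClass → Vtx ℕ ℕ ℕ ℕ ℕ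
  | .s _ _ _ => .s (pos (r, .j)) (pos (r, .p)) (pos (r, .q))
  | .y _ _ _ => .y (pos (r, .a)) (pos (r, .p)) (pos (r, .q))
  | .core c => .core (coreAt r pos c)
  | .leaf c => .leaf (coreAt r pos c)

/-! ### Running through all vertices -/

namespace Frag

/-- Loop over the core vertices, with indices in the row `r`. -/
def coreLoop (r : Bool) (b : CoreClass → Prog aux) : Prog aux :=
  (forX r .j (forX r .p (b (.T () ())))).seq <|
  (forX r .j (forX r .p (b (.W () ())))).seq <|
  (forX r .a (forX r .q (b (.Y () ())))).seq <|
  (forX r .q (b (.B ()))).seq <|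
  (forX r .i (forX r .a (b (.X () ())))).seq (b .D)

/-- Loop over the vertices, with indices in the row `r`. -/
def vtxLoop (r : Bool) (b : VtxClass → Prog aux) : Prog aux :=
  (forX r .p (forX r .q ((forX r .j (b (.s () () ()))).seq (forX r .a (b (.y () () ())))))).seq <|
  (coreLoop r fun c => b (.core c)).seq (coreLoop r fun c => b (.leaf c))

end Frag

/-- Time for a loop over the core vertices. -/
def coreLoopTime (B t : ℕ) : ℕ := 4 * loopTime B (loopTime B t) + loopTime B t + t

/-- Time for a loop over the vertices. -/
def vtxLoopTime (B t : ℕ) : ℕ :=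
  loopTime B (loopTime B (2 * loopTime B t)) + 2 * coreLoopTime B t

/-- Outside the row `r`, the index values `pos'` are as in `pos`; inside, they are in range. -/
def Off (r : Bool) (n : Ix → ℕ) (pos pos' : Bool × Ix → ℕ) : Prop :=
  (∀ z : Bool × Ix, z.1 ≠ r → pos' z = pos z) ∧ ∀ x, pos' (r, x) < n x

section Loops

variable {n : Ix → ℕ} {g : Oth → ℕ} {bits : List Bool} {pos pos' : Bool × Ix → ℕ} {r : Bool}
  {B t : ℕ}

theorem Off.update (h : Off r n pos pos') {x : Ix} {k : ℕ} (hk : k < n x) :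
    Off r n pos (update pos' (r, x) k) := by
  refine ⟨fun z hz => ?_, fun y => ?_⟩
  · rw [update_of_ne (by rintro rfl; exact hz rfl)]
    exact h.1 z hz
  · by_cases hy : y = x
    · subst hy; simpa using hk
    · rw [update_of_ne (by simpa using hy)]
      exact h.2 y

theorem Off.refl (h : ∀ x, pos (r, x) < n x) : Off r n pos pos :=
  ⟨fun _ _ => rfl, h⟩

theorem emits_forX₂ {x y : Ix} (hxy : x ≠ y) {p : Prog aux} {l : ℕ → ℕ → List Bool}
    (hB : ∀ x, n x ≤ B) (h0 : ∀ x, pos (r, x) = 0)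
    (h : ∀ k < n x, ∀ m < n y, Emits n g bits p (update (update pos (r, x) k) (r, y) m) (l k m) t) :
    Emits n g bits (forX r x (forX r y p)) pos
      ((List.range (n x)).flatMap fun k => (List.range (n y)).flatMap fun m => l k m)
      (loopTime B (loopTime B t)) :=
  Emits.forX (hB x) (h0 x) fun k hk => Emits.forX (hB y)
    (by rw [update_of_ne (by simpa using hxy.symm), h0]) (h k hk)

/-- The ranges must be nonempty: an index that a class of vertices does not use rests at `0`, and
`Off` still asks it to be in range. -/
theorem emits_coreLoop {b : CoreClass → Prog aux} {F : Core ℕ ℕ ℕ ℕ ℕ → List Bool}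
    (hB : ∀ x, n x ≤ B) (hn : ∀ x, 0 < n x) (h0 : ∀ x, pos (r, x) = 0)
    (h : ∀ pos', Off r n pos pos' → ∀ c, Emits n g bits (b c) pos' (F (coreAt r pos' c)) t) :
    Emits n g bits (coreLoop r b) pos ((Core.list (.range (n .j)) (.range (n .p)) (.range (n .q))
      (.range (n .a)) (.range (n .i))).flatMap F) (coreLoopTime B t) := by
  have ho : Off r n pos pos := Off.refl fun x => by rw [h0]; exact hn x
  have h1 := emits_forX₂ (aux := aux) (g := g) (bits := bits) (r := r) (x := .j) (y := .p)
    (by simp) (p := b (.T () ())) (l := fun k m => F (.T k m)) hB h0 fun k hk m hm => by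
      simpa [coreAt, update_apply] using h _ ((ho.update hk).update hm) (.T () ())
  have h2 := emits_forX₂ (aux := aux) (g := g) (bits := bits) (r := r) (x := .j) (y := .p)
    (by simp) (p := b (.W () ())) (l := fun k m => F (.W k m)) hB h0 fun k hk m hm => by
      simpa [coreAt, update_apply] using h _ ((ho.update hk).update hm) (.W () ())
  have h3 := emits_forX₂ (aux := aux) (g := g) (bits := bits) (r := r) (x := .a) (y := .q)
    (by simp) (p := b (.Y () ())) (l := fun k m => F (.Y k m)) hB h0 fun k hk m hm => by
      simpa [coreAt, update_apply] using h _ ((ho.update hk).update hm) (.Y () ())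
  have h4 := Emits.forX (aux := aux) (g := g) (bits := bits) (r := r) (x := .q)
    (p := b (.B ())) (l := fun k => F (.B k)) (hB _) (h0 _) fun k hk => by
      simpa [coreAt, update_apply] using h _ (ho.update hk) (.B ())
  have h5 := emits_forX₂ (aux := aux) (g := g) (bits := bits) (r := r) (x := .i) (y := .a)
    (by simp) (p := b (.X () ())) (l := fun k m => F (.X k m)) hB h0 fun k hk m hm => by
      simpa [coreAt, update_apply] using h _ ((ho.update hk).update hm) (.X () ())
  have h6 := h pos ho .D
  have := h1.seq (h2.seq (h3.seq (h4.seq (h5.seq h6))))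
  rw [show (Core.list (.range (n .j)) (.range (n .p)) (.range (n .q)) (.range (n .a))
      (.range (n .i))).flatMap F = _ from ?_]
  · exact this.mono (by unfold coreLoopTime; omega)
  · simp [Core.list, List.flatMap_append, List.flatMap_assoc, List.flatMap_map, coreAt]

theorem emits_vtxLoop {b : VtxClass → Prog aux} {F : Vtx ℕ ℕ ℕ ℕ ℕ → List Bool}
    (hB : ∀ x, n x ≤ B) (hn : ∀ x, 0 < n x) (h0 : ∀ x, pos (r, x) = 0)
    (h : ∀ pos', Off r n pos pos' → ∀ c, Emits n g bits (b c) pos' (F (vtxAt r pos' c)) t) :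
    Emits n g bits (vtxLoop r b) pos ((Vtx.list (.range (n .j)) (.range (n .p)) (.range (n .q))
      (.range (n .a)) (.range (n .i))).flatMap F) (vtxLoopTime B t) := by
  have ho : Off r n pos pos := Off.refl fun x => by rw [h0]; exact hn x
  have h1 := emits_forX₂ (aux := aux) (g := g) (bits := bits) (r := r) (x := .p) (y := .q)
    (by simp) (p := (forX r .j (b (.s () () ()))).seq (forX r .a (b (.y () () ()))))
    (l := fun k m => ((List.range (n .j)).flatMap fun j => F (.s j k m)) ++
      (List.range (n .a)).flatMap fun a => F (.y a k m)) hB h0 (t := loopTime B t + loopTime B t)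
    fun k hk m hm => (Emits.forX (hB _) (by simp [h0]) fun j hj => by
        simpa [vtxAt, update_apply] using
          h _ (((ho.update hk).update hm).update hj) (.s () () ())).seq
      (Emits.forX (hB _) (by simp [h0]) fun a ha => by
        simpa [vtxAt, update_apply] using
          h _ (((ho.update hk).update hm).update ha) (.y () () ()))
  have h2 := emits_coreLoop (b := fun c => b (.core c)) (F := fun c => F (.core c)) hB hn h0
    fun pos' hp c => h pos' hp (.core c)
  have h3 := emits_coreLoop (b := fun c => b (.leaf c)) (F := fun c => F (.leaf c)) hB hn h0
    fun pos' hp c => h pos' hp (.leaf c)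
  have := h1.seq (h2.seq h3)
  rw [show (Vtx.list (.range (n .j)) (.range (n .p)) (.range (n .q)) (.range (n .a))
      (.range (n .i))).flatMap F = _ from ?_]
  · exact this.mono (by unfold vtxLoopTime; rw [two_mul]; omega)
  · simp [Vtx.list, List.flatMap_append, List.flatMap_assoc, List.flatMap_map]

end Loops

/-! ### Adjacency of two vertices -/

/-- A condition for two vertices to be joined: they agree on an index, or a set does not contain an
item. -/
inductive EdgeTest
  | eq (x : Ix)
  | bit

/-- The conditions under which there is an edge from a vertex of one class to one of another. -/
def arcTests : VtxClass → VtxClass → Option (List EdgeTest)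
  | .s _ _ _, .core (.T _ _) => some [.eq .j, .eq .p]
  | .s _ _ _, .core (.W _ _) => some [.eq .j, .eq .p]
  | .s _ _ _, .core (.B _) => some [.eq .q]
  | .s _ _ _, .y _ _ _ => some [.eq .p, .eq .q]
  | .y _ _ _, .core (.Y _ _) => some [.eq .a, .eq .q]
  | .y _ _ _, .core (.X _ _) => some [.eq .a]
  | .core (.W _ _), .core (.X _ _) => some [.bit]
  | .core .D, .core (.X _ _) => some []
  | .core (.T _ _), .leaf (.T _ _) => some [.eq .j, .eq .p]
  | .core (.W _ _), .leaf (.W _ _) => some [.eq .j, .eq .p]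
  | .core (.Y _ _), .leaf (.Y _ _) => some [.eq .a, .eq .q]
  | .core (.B _), .leaf (.B _) => some [.eq .q]
  | .core (.X _ _), .leaf (.X _ _) => some [.eq .i, .eq .a]
  | .core .D, .leaf .D => some []
  | _, _ => none

/-- The outcome of a test for an edge from the row `r` to the other one. -/
def EdgeTest.val (η : ℕ) (bits : List Bool) (pos : Bool × Ix → ℕ) (r : Bool) : EdgeTest → Bool
  | .eq x => decide (pos (false, x) = pos (true, x))
  | .bit => !(bits.getD (pos (r, .j) * η + pos (!r, .i)) false)

/-- Set membership as read off the incidence matrix. -/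
def bitMem (η : ℕ) (bits : List Bool) (i j : ℕ) : Prop := bits.getD (j * η + i) false = true

theorem arc_iff_tests {η : ℕ} {bits : List Bool} {pos : Bool × Ix → ℕ} {r : Bool}
    {c c' : VtxClass} : Vtx.Arc (bitMem η bits) (vtxAt r pos c) (vtxAt (!r) pos c') ↔
      ∃ l, arcTests c c' = some l ∧ l.all (EdgeTest.val η bits pos r) = true := by
  rw [Vtx.arc_iff]
  cases r <;>
  rcases c with _ | _ | (_ | _) | (_ | _) <;> rcases c' with _ | _ | (_ | _) | (_ | _) <;>
    simp [vtxAt, coreAt, Vtx.ArcSpec, arcTests, EdgeTest.val, bitMem, eq_comm (a := pos (true, _))]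

/-- Between two classes edges are oriented in one way only, so a single list of tests decides
adjacency. -/
theorem arcTests_asymm {c c' : VtxClass} {l : List EdgeTest} (h : arcTests c c' = some l) :
    arcTests c' c = none := by
  unfold arcTests at h
  split at h <;> first | rfl | cases h

theorem length_arcTests {c c' : VtxClass} {l : List EdgeTest} (h : arcTests c c' = some l) :
    l.length ≤ 2 := by
  unfold arcTests at h
  split at h <;> simp at h <;> subst h <;> simp

namespace Frag

/-- Carry out a test for an edge from the row `r` to the other one. -/
def edgeTest (r : Bool) : EdgeTest → Prog aux
  | .eq x => eqCheck x
  | .bit => bitCheck r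

/-- Emit whether the vertices of given classes with indices in the two rows are adjacent. -/
def emitAdj (c c' : VtxClass) : Prog aux :=
  match arcTests c c' with
  | some l => emitAll (l.map (edgeTest false))
  | none =>
    match arcTests c' c with
    | some l => emitAll (l.map (edgeTest true))
    | none => emit false

end Frag

/-- Time for an adjacency test. -/
def adjTime (B : ℕ) : ℕ :=
  2 * ((24 * B + 6) + (loopTime B (loopTime B 3) + loopTime B 3 + 4 * (B * B) + 4)) + 4

open Classical in
theorem emits_emitAdj {n : Ix → ℕ} {g : Oth → ℕ} {bits : List Bool} {pos : Bool × Ix → ℕ} {η B : ℕ}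
    (hg : Ready η g) (hb : bits.length = n .j * η) (hη : n .i = η) (hB : ∀ x, n x ≤ B)
    (hpos : ∀ z, pos z < n z.2) (c c' : VtxClass) :
    Emits (aux := aux) n g bits (emitAdj c c') pos
      [decide (Vtx.Arc (bitMem η bits) (vtxAt false pos c) (vtxAt true pos c') ∨
        Vtx.Arc (bitMem η bits) (vtxAt true pos c') (vtxAt false pos c))] (adjTime B) := by
  have key : ∀ r : Bool, ∀ l : List EdgeTest, l.length ≤ 2 →
      Emits (aux := aux) n g bits (emitAll (l.map (edgeTest r))) pos
        [l.all (EdgeTest.val η bits pos r)] (adjTime B) := by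
    intro r l hl
    refine (emits_emitAll (edgeTest r) (EdgeTest.val η bits pos r) l hg.flag
      (t := (24 * B + 6) + (loopTime B (loopTime B 3) + loopTime B 3 + 4 * (B * B) + 4)) ?_).mono ?_
    · intro x _
      cases x with
      | eq x =>
        intro w d hw hw'
        exact (checks_eqCheck hg (((hpos (false, x)).le).trans (hB x))
          (((hpos (true, x)).le).trans (hB x)) w d hw hw').mono (by omega)
      | bit =>
        intro w d hw hw'
        exact (checks_bitCheck hg hb (hpos (r, .j)) (hη ▸ hpos (!r, .i)) (hB _) (hη ▸ hB .i)
          w d hw hw').mono (by omega)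
    · unfold adjTime; gcongr
  have h1 := arc_iff_tests (η := η) (bits := bits) (pos := pos) (r := false) (c := c) (c' := c')
  have h2 := arc_iff_tests (η := η) (bits := bits) (pos := pos) (r := true) (c := c') (c' := c)
  simp only [Bool.not_false, Bool.not_true] at h1 h2
  unfold emitAdj
  split
  · next l hl =>
    have h3 := arcTests_asymm hl
    simp only [hl, h3, Option.some.injEq, exists_eq_left', reduceCtorEq, false_and,
      exists_false] at h1 h2
    simp only [h1, h2, or_false, Bool.decide_eq_true]
    exact key false l (length_arcTests hl)
  · next hl =>
    split
    · next l hl' =>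
      simp only [hl, hl', Option.some.injEq, exists_eq_left', reduceCtorEq, false_and,
        exists_false] at h1 h2
      simp only [h1, h2, false_or, Bool.decide_eq_true]
      exact key true l (length_arcTests hl')
    · next hl' =>
      simp only [hl, hl', reduceCtorEq, false_and, exists_false] at h1 h2
      simp only [h1, h2, or_false, decide_false]
      exact (emits_emit false).mono (by unfold adjTime; omega)

end StackProg

end

/-! ### Emitting the encoding of the graph -/

section

open Turing Function

namespace SetCoverInstance

variable (I : SetCoverInstance)

/-- The incidence matrix, set by set. -/
def matrix : List Bool :=
  (List.ofFn fun j : Fin I.h => List.ofFn fun i : Fin I.η => decide (i ∈ I.sets j)).flatten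

theorem length_matrix : I.matrix.length = I.h * I.η := by
  simp [matrix, List.length_flatten, List.map_ofFn, Function.comp_def]

theorem getD_flatten_ofFn {h m : ℕ} (f : Fin h → Fin m → Bool) (j : Fin h) (i : Fin m) :
    ((List.ofFn fun j => List.ofFn fun i => f j i).flatten).getD (j * m + i) false = f j i := by
  induction h with
  | zero => exact j.elim0
  | succ h ih =>
    rw [List.ofFn_succ, List.flatten_cons]
    refine Fin.cases ?_ (fun j => ?_) j
    · rw [List.getD_append _ _ _ _ (by simp)]
      have hi : ((0 : Fin (h + 1)) : ℕ) * m + i < (List.ofFn fun i => f 0 i).length := by simp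
      rw [List.getD_eq_getElem _ _ hi]
      simp
    · rw [List.getD_append_right _ _ _ _ (by simp; nlinarith [i.2])]
      rw [← ih (fun j => f j.succ) j]
      congr 1
      simp only [Fin.val_succ, List.length_ofFn, Nat.succ_mul]
      omega

theorem getD_matrix (j : Fin I.h) (i : Fin I.η) :
    I.matrix.getD (j * I.η + i) false = decide (i ∈ I.sets j) :=
  getD_flatten_ofFn (fun j i => decide (i ∈ I.sets j)) j i

theorem encode_eq : I.encode =
    List.replicate I.h true ++ [false] ++ List.replicate I.η true ++ [false] ++ I.matrix := rfl

end SetCoverInstance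

namespace StackProg

variable {aux : TM2ComputableAux Bool Bool}

open Frag

/-- The index ranges when emitting the graph. -/
def ranges (h k₁ k₂ r η : ℕ) : Ix → ℕ
  | .j => h
  | .p => k₁
  | .q => k₂
  | .a => r
  | .i => η

namespace Frag

/-- Emit the encoding of the graph. -/
def emitGraph : Prog aux :=
  (vtxLoop false fun _ => emit true).seq <| (emit false).seq <|
    vtxLoop false fun c => vtxLoop true fun c' => emitAdj c c'

end Frag

/-- Time to emit the graph. -/
def graphTime (B : ℕ) : ℕ := vtxLoopTime B 1 + 1 + vtxLoopTime B (vtxLoopTime B (adjTime B))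

theorem vtxAt_congr {r : Bool} {pos pos' : Bool × Ix → ℕ} (h : ∀ x, pos (r, x) = pos' (r, x))
    (c : VtxClass) : vtxAt r pos c = vtxAt r pos' c := by
  rcases c with _ | _ | (_ | _) | (_ | _) <;> simp [vtxAt, coreAt, h]

open Classical in
theorem emits_emitGraph (I : SetCoverInstance) {k₁ k₂ r B : ℕ} (hh : 0 < I.h) (hη : 0 < I.η)
    (h₁ : 0 < k₁) (h₂ : 0 < k₂) (hr : 0 < r) {g : Oth → ℕ} (hg : Ready I.η g)
    (hB : ∀ x, ranges I.h k₁ k₂ r I.η x ≤ B) :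
    Emits (aux := aux) (ranges I.h k₁ k₂ r I.η) g I.matrix emitGraph (fun _ => 0)
      (I.toGraph k₁ k₂ r hh hη h₁ h₂ hr).encode (graphTime B) := by
  set n := ranges I.h k₁ k₂ r I.η with hn_def
  have hn : ∀ x, 0 < n x := by intro x; cases x <;> simpa [hn_def, ranges]
  set L := Vtx.list (.range I.h) (.range k₁) (.range k₂) (.range r) (.range I.η) with hL
  have hL' : L = (I.verts k₁ k₂ r).map (Vtx.map (fun j => j.val) (fun j => j.val) (fun j => j.val)
      (fun j => j.val) (fun j => j.val)) := by
    rw [SetCoverInstance.verts, Vtx.map_list]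
    simp only [List.map_coe_finRange_eq_range]
    rfl
  have e1 : Emits (aux := aux) n g I.matrix (vtxLoop false fun _ => emit true) (fun _ => 0)
      (L.flatMap fun _ => [true]) (vtxLoopTime B 1) :=
    emits_vtxLoop hB hn (fun _ => rfl) fun pos' _ c => emits_emit true
  let A : Vtx ℕ ℕ ℕ ℕ ℕ → Vtx ℕ ℕ ℕ ℕ ℕ → Bool := fun u v =>
    decide (Vtx.Arc (bitMem I.η I.matrix) u v ∨ Vtx.Arc (bitMem I.η I.matrix) v u)
  have e3 : Emits (aux := aux) n g I.matrix
      (vtxLoop false fun c => vtxLoop true fun c' => emitAdj c c') (fun _ => 0)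
      (L.flatMap fun u => L.flatMap fun v => [A u v])
      (vtxLoopTime B (vtxLoopTime B (adjTime B))) := by
    refine emits_vtxLoop (F := fun u => L.flatMap fun v => [A u v]) hB hn (fun _ => rfl)
      fun pos hpos c => ?_
    refine emits_vtxLoop (F := fun v => [A (vtxAt false pos c) v]) hB hn
      (fun x => hpos.1 (true, x) (by simp)) fun pos' hpos' c' => ?_
    -- The inner loop leaves the first row alone, so the vertex of the outer loop stays fixed while
    -- a row of the adjacency matrix is written.
    have h0 : ∀ x, pos' (false, x) = pos (false, x) := fun x => hpos'.1 (false, x) (by simp)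
    rw [← vtxAt_congr h0 c]
    refine emits_emitAdj hg I.length_matrix rfl hB ?_ c c'
    rintro ⟨b, x⟩
    cases b
    · rw [h0]; exact hpos.2 x
    · exact hpos'.2 x
  have := e1.seq ((emits_emit false).seq e3)
  rw [show (I.toGraph k₁ k₂ r hh hη h₁ h₂ hr).encode = _ from ?_]
  · exact this.mono (by unfold graphTime; omega)
  rw [ConnectedGraph.encode, List.append_assoc]
  have hmem : ∀ (i : Fin I.η) (j : Fin I.h), bitMem I.η I.matrix i j ↔ i ∈ I.sets j := by
    intro i j
    rw [bitMem, I.getD_matrix, decide_eq_true_eq]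
  congr 1
  · rw [← List.map_eq_flatMap, List.map_const', hL', List.length_map]
    rfl
  · congr 1
    let D : I.V k₁ k₂ r → I.V k₁ k₂ r → Bool := fun u v => decide ((I.vgraph k₁ k₂ r).Adj u v)
    have hD : (List.ofFn fun u : Fin (I.verts k₁ k₂ r).length =>
        List.ofFn fun v : Fin (I.verts k₁ k₂ r).length =>
          D (I.verts k₁ k₂ r)[u] (I.verts k₁ k₂ r)[v]).flatten =
        (I.verts k₁ k₂ r).flatMap fun u => (I.verts k₁ k₂ r).map fun v => D u v := by
      have h1 : ∀ {β : Type} (f : I.V k₁ k₂ r → β),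
          (List.ofFn fun u : Fin (I.verts k₁ k₂ r).length => f (I.verts k₁ k₂ r)[u]) =
            (I.verts k₁ k₂ r).map f := by
        intro β f
        apply List.ext_getElem <;> simp
      rw [List.flatMap, ← h1]
      simp only [← h1]
    refine Eq.trans hD ?_
    rw [hL']
    simp only [List.flatMap_map, ← List.map_eq_flatMap]
    congr 1
    funext u
    congr 1
    funext v
    simp only [D, A, decide_eq_decide]
    rw [Vtx.arc_map_iff Fin.val_injective Fin.val_injective Fin.val_injective Fin.val_injective
      Fin.val_injective hmem, Vtx.arc_map_iff Fin.val_injective Fin.val_injective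
      Fin.val_injective Fin.val_injective Fin.val_injective hmem]
    rfl

end StackProg

end

/-! ### Extracting candidate covers from a solution -/

section

open Turing Function

theorem length_indicator {n : ℕ} (S : Finset (Fin n)) : (indicator S).length = n := by
  simp [indicator]

theorem count_indicator {n : ℕ} (S : Finset (Fin n)) : (indicator S).count true = S.card := by
  have h : ∀ l : List (Fin n), (l.map fun i => decide (i ∈ S)).count true =
      (l.filter fun i => decide (i ∈ S)).length := by
    intro l
    induction l with
    | nil => rfl
    | cons a l ih =>
      by_cases ha : a ∈ S <;> simp [ha, ih]
  rw [indicator, List.ofFn_eq_map, h, ← List.toFinset_card_of_nodup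
    ((List.nodup_finRange n).filter _)]
  congr 1
  ext i
  simp

/-- Apply `f 0`, …, `f (n - 1)` in turn. -/
def foldRange {β : Type*} (f : ℕ → β → β) (n : ℕ) (x : β) : β :=
  (List.range n).foldl (fun y k => f k y) x

theorem foldRange_succ {β : Type*} (f : ℕ → β → β) (n : ℕ) (x : β) :
    foldRange f (n + 1) x = f n (foldRange f n x) := by
  simp [foldRange, List.range_succ]

@[simp] theorem foldRange_zero {β : Type*} (f : ℕ → β → β) (x : β) : foldRange f 0 x = x := rfl

namespace StackProg

variable {aux : TM2ComputableAux Bool Bool}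

open Frag

/-- Replace the set `cur` by `C` if `C` is good and smaller. -/
def pick {h : ℕ} (good : Bool) (C cur : Finset (Fin h)) : Finset (Fin h) :=
  if good = true ∧ C.card < cur.card then C else cur

namespace Frag

/-- Read the part of the solution on the set vertices of a copy. -/
def readSets : Prog aux :=
  forX false .j ((ifTop .sol ((inc (.oth .cnum)).seq (pushB .cand true)) (pushB .cand false)).seq
    (popB .sol))

/-- Read the part of the solution on the hubs of a copy. -/
def readHubs : Prog aux :=
  forX false .a ((ifTop .sol skip (raise (.oth .good))).seq (popB .sol))

/-- Forget the candidate. -/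
def discard : Prog aux := (clearR .cand).seq (clearC (.oth .cnum))

/-- Make the candidate the best solution. -/
def replace : Prog aux :=
  (clearR .best).seq <| (moveAll .cand .best).seq <| (clearC (.oth .bnum)).seq <|
    moveC (.oth .cnum) (.oth .bnum)

/-- Keep the better one of the candidate and the best solution. -/
def judge : Prog aux :=
  (ifNZ (.oth .good)
    ((inc (.oth .cnum)).seq <|
      (leTest (.oth .cnum) (.oth .bnum) (.oth .ta) (.oth .tb) (.oth .flag)).seq <|
      (dec (.oth .cnum)).seq <|
      ifNZ (.oth .flag) ((dec (.oth .flag)).seq discard) replace)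
    discard).seq (clearC (.oth .good))

/-- Extract the candidate solutions of all copies. -/
def scan : Prog aux := forX false .p (forX false .q (readSets.seq (readHubs.seq judge)))

end Frag

section Scan

variable {n : Ix → ℕ} {pos : Bool × Ix → ℕ} {g : Oth → ℕ} {w : Reg → List Bool} {B : ℕ}

theorem exec_readSets {l rest : List Bool} (hl : l.length = n .j) (hB : n .j ≤ B)
    (h0 : pos (false, .j) = 0) (hc : g .cnum = 0) (hs : w .sol = l ++ rest) (hw : w .cand = []) :
    Exec (aux := aux) readSets (cst n pos g) w (cst n pos (update g .cnum (l.count true)))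
      (update (update w .sol rest) .cand l.reverse) (loopTime B 4) := by
  have key := exec_forC_of_states (aux := aux) (c := Ctr.rem false .j) (d := .cnt false .j)
    (n := n .j) (t := 4)
    (p := (ifTop .sol ((inc (.oth .cnum)).seq (pushB .cand true)) (pushB .cand false)).seq
      (popB .sol)) (by simp)
    (U := fun k => cst n pos (update g .cnum ((l.take k).count true)))
    (W := fun k => update (update w .sol (l.drop k ++ rest)) .cand (l.take k).reverse)
    ?_ (by simp [h0]) (by simp [h0]) (by simp [h0]) (by simp [h0])
  · refine (key.of_start ?_ ?_).of_eq ?_ ?_ ?_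
    · simp only [List.take_zero, List.count_nil]
      rw [← hc, update_eq_self]
    · simp only [List.take_zero, List.drop_zero, List.reverse_nil]
      rw [← hs, update_eq_self, ← hw, update_eq_self]
    · simp [← hl]
    · simp [← hl]
    · unfold loopTime; gcongr
  · intro k hk
    rw [← hl] at hk
    simp only [update_cst_cnt]
    have hd : l.drop k = l[k] :: l.drop (k + 1) := List.drop_eq_getElem_cons hk
    have ht : l.take (k + 1) = l.take k ++ [l[k]] := List.take_succ_eq_append_getElem hk
    have h1 : Exec (aux := aux) (ifTop .sol ((inc (.oth .cnum)).seq (pushB .cand true))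
        (pushB .cand false)) (cst n (update pos (false, .j) k) (update g .cnum ((l.take k).count true)))
        (update (update w .sol (l.drop k ++ rest)) .cand (l.take k).reverse)
        (cst n (update pos (false, .j) k) (update g .cnum ((l.take (k + 1)).count true)))
        (update (update w .sol (l.drop k ++ rest)) .cand (l.take (k + 1)).reverse) 3 := by
      cases hb : l[k] with
      | true =>
        rw [hb] at hd ht
        refine exec_ifTop_true (l := l.drop (k + 1) ++ rest) (by simp [hd])
          (((exec_inc _).seq (exec_pushB _ _)).of_eq ?_ ?_ le_rfl)
        · simp [update_cst_oth, ht]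
        · simp [ht]
      | false =>
        rw [hb] at hd ht
        refine exec_ifTop_false (by simp [hd]) ((exec_pushB _ _).of_eq ?_ ?_ (by omega))
        · simp [ht]
        · simp [ht]
    have htail : (l.drop k ++ rest).tail = l.drop (k + 1) ++ rest := by rw [hd]; rfl
    refine (h1.seq (exec_popB _)).of_eq rfl ?_ le_rfl
    funext z
    cases z <;> simp [htail]

theorem exec_readHubs {l rest : List Bool} (hl : l.length = n .a) (hB : n .a ≤ B)
    (h0 : pos (false, .a) = 0) (hc : g .good = 0) (hs : w .sol = l ++ rest) :
    Exec (aux := aux) readHubs (cst n pos g) w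
      (cst n pos (update g .good (decide (false ∈ l)).toNat)) (update w .sol rest)
      (loopTime B 4) := by
  have key := exec_forC_of_states (aux := aux) (c := Ctr.rem false .a) (d := .cnt false .a)
    (n := n .a) (t := 4)
    (p := (ifTop .sol skip (raise (.oth .good))).seq (popB .sol)) (by simp)
    (U := fun k => cst n pos (update g .good (decide (false ∈ l.take k)).toNat))
    (W := fun k => update w .sol (l.drop k ++ rest))
    ?_ (by simp [h0]) (by simp [h0]) (by simp [h0]) (by simp [h0])
  · refine (key.of_start ?_ ?_).of_eq ?_ ?_ ?_
    · simp only [List.take_zero, List.not_mem_nil, decide_false, Bool.toNat_false]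
      rw [← hc, update_eq_self]
    · simp only [List.drop_zero]
      rw [← hs, update_eq_self]
    · simp [← hl]
    · simp [← hl]
    · unfold loopTime; gcongr
  · intro k hk
    rw [← hl] at hk
    simp only [update_cst_cnt]
    have hd : l.drop k = l[k] :: l.drop (k + 1) := List.drop_eq_getElem_cons hk
    have ht : l.take (k + 1) = l.take k ++ [l[k]] := List.take_succ_eq_append_getElem hk
    have h1 : Exec (aux := aux) (ifTop .sol skip (raise (.oth .good)))
        (cst n (update pos (false, .a) k) (update g .good (decide (false ∈ l.take k)).toNat))
        (update w .sol (l.drop k ++ rest))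
        (cst n (update pos (false, .a) k) (update g .good (decide (false ∈ l.take (k + 1))).toNat))
        (update w .sol (l.drop k ++ rest)) 3 := by
      cases hb : l[k] with
      | true =>
        rw [hb] at hd ht
        refine exec_ifTop_true (l := l.drop (k + 1) ++ rest) (by simp [hd])
          (Exec.skip.of_eq ?_ rfl (by omega))
        simp [ht]
      | false =>
        rw [hb] at hd ht
        refine exec_ifTop_false (by simp [hd]) ((exec_raise (c := decide (false ∈ l.take k))
          (by simp)).of_eq ?_ rfl (by omega))
        simp [update_cst_oth, ht]
    have htail : (l.drop k ++ rest).tail = l.drop (k + 1) ++ rest := by rw [hd]; rfl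
    refine (h1.seq (exec_popB _)).of_eq rfl ?_ le_rfl
    simp [htail]

theorem exec_discard {h : ℕ} {C : Finset (Fin h)} (hc : g .cnum = C.card)
    (hw : w .cand = (indicator C).reverse) (hB : h ≤ B) :
    Exec (aux := aux) discard (cst n pos g) w (cst n pos (update g .cnum 0)) (update w .cand [])
      (4 * B + 2) := by
  have hC := card_finset_fin_le C
  refine ((exec_clearR _).seq (exec_clearC _)).of_eq ?_ rfl ?_
  · rw [update_cst_oth]
  · simp only [hw, cst_oth, hc, List.length_reverse, length_indicator]
    omega

theorem exec_replace {h : ℕ} {C cur : Finset (Fin h)} (hc : g .cnum = C.card)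
    (hb : g .bnum = cur.card) (hw : w .cand = (indicator C).reverse)
    (hw' : w .best = indicator cur) (hB : h ≤ B) :
    Exec (aux := aux) replace (cst n pos g) w (cst n pos (update (update g .cnum 0) .bnum C.card))
      (update (update w .cand []) .best (indicator C)) (11 * B + 4) := by
  have hC := card_finset_fin_le C
  have hC' := card_finset_fin_le cur
  refine ((exec_clearR _).seq ((exec_moveAll (by simp)).seq ((exec_clearC _).seq
    (exec_moveC (by simp))))).of_eq ?_ ?_ ?_
  · simp only [update_cst_oth]
    congr 1
    funext z
    cases z <;> simp [hc]
  · funext z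
    cases z <;> simp [hw]
  · simp [hw, hw', hb, hc, length_indicator]
    omega

theorem exec_judge {h η : ℕ} (hg : Ready η g) {C cur : Finset (Fin h)} {b : Bool}
    (hc : g .cnum = C.card) (hb : g .bnum = cur.card) (hgood : g .good = b.toNat)
    (hw : w .cand = (indicator C).reverse) (hw' : w .best = indicator cur) (hB : h ≤ B) :
    Exec (aux := aux) judge (cst n pos g) w
      (cst n pos (update (update (update g .cnum 0) .good 0) .bnum (pick b C cur).card))
      (update (update w .cand []) .best (indicator (pick b C cur))) (24 * B + 40) := by
  have hC := card_finset_fin_le C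
  have clean : ∀ {p : Prog aux} {g' : Oth → ℕ} {w' : Reg → List Bool} {t : ℕ},
      Exec p (cst n pos g) w (cst n pos g') w' t → g' .good ≤ 1 →
      Exec (p.seq (clearC (.oth .good))) (cst n pos g) w (cst n pos (update g' .good 0)) w'
        (t + 3) := by
    intro p g' w' t hp hle
    refine (hp.seq (exec_clearC _)).of_eq ?_ rfl ?_
    · rw [update_cst_oth]
    · simp only [cst_oth]; omega
  cases b with
  | false =>
    have h1 := clean (exec_ifNZ_zero (c := Ctr.oth .good)
      (p := (inc (.oth .cnum)).seq <|
      (leTest (.oth .cnum) (.oth .bnum) (.oth .ta) (.oth .tb) (.oth .flag)).seq <|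
      (dec (.oth .cnum)).seq <|
      ifNZ (.oth .flag) ((dec (.oth .flag)).seq discard) replace) (by simp [hgood])
      (exec_discard (n := n) (pos := pos) hc hw hB)) (by simp [hgood])
    refine h1.of_eq ?_ ?_ (by omega)
    · congr 1
      funext z
      cases z <;> simp [pick, hb]
    · simp only [pick]
      funext z
      cases z <;> simp [hw']
  | true =>
    -- Incrementing `cnum` first turns the test `≤` into the strict comparison made by `pick`.
    have h1 : Exec (aux := aux) (inc (.oth .cnum)) (cst n pos g) w
        (cst n pos (update g .cnum (C.card + 1))) w 1 :=
      (exec_inc _).of_eq (by rw [update_cst_oth, cst_oth, hc]) rfl le_rfl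
    have h2 := exec_leTest (aux := aux) (w := w) (u := cst n pos (update g .cnum (C.card + 1)))
      (x := .oth .cnum) (y := .oth .bnum) (d := .oth .ta) (e := .oth .tb) (fl := .oth .flag)
      (c := false) (by simp) (by simp [hg.ta]) (by simp [hg.tb]) (by simp [hg.flag])
    have h3 : Exec (aux := aux) (dec (.oth .cnum)) (update (cst n pos (update g .cnum (C.card + 1)))
        (.oth .flag) (false || !decide (cst n pos (update g .cnum (C.card + 1)) (.oth .cnum) ≤
        cst n pos (update g .cnum (C.card + 1)) (.oth .bnum))).toNat) w
        (cst n pos (update g .flag (!decide (C.card < cur.card)).toNat)) w 1 := by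
      refine (exec_dec _).of_eq ?_ rfl le_rfl
      simp only [update_cst_oth]
      congr 1
      funext z
      cases z <;> simp [hb, hc]
    have h4 := h1.seq (h2.seq h3)
    by_cases hlt : C.card < cur.card
    · have h5 := exec_replace (aux := aux) (n := n) (pos := pos) (g := g) hc hb hw hw' hB
      have hgf : update g .flag (!decide (C.card < cur.card)).toNat = g := by
        simp only [hlt, decide_true, Bool.not_true, Bool.toNat_false]
        rw [← hg.flag, update_eq_self]
      rw [hgf] at h3
      have h6 := clean (exec_ifNZ_pos (c := Ctr.oth .good) (q := discard) (by simp [hgood])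
        (h1.seq (h2.seq (h3.seq (exec_ifNZ_zero (c := .oth .flag)
          (p := (dec (.oth .flag)).seq discard) (by simp [hg.flag]) h5))))) (by simp [hgood])
      refine h6.of_eq ?_ ?_ ?_
      · congr 1
        funext z
        cases z <;> simp [pick, hlt]
      · simp [pick, hlt]
      · simp only [cst_oth, update_self]
        omega
    · have h5 := exec_discard (aux := aux) (n := n) (pos := pos) (g := g) hc hw hB
      have hd : Exec (aux := aux) (dec (.oth .flag))
          (cst n pos (update g .flag (!decide (C.card < cur.card)).toNat)) w (cst n pos g) w 1 := by
        refine (exec_dec _).of_eq ?_ rfl le_rfl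
        rw [update_cst_oth]
        congr 1
        funext z
        cases z <;> simp [hlt, hg.flag]
      have h6 := clean (exec_ifNZ_pos (c := Ctr.oth .good) (q := discard) (by simp [hgood])
        (h1.seq (h2.seq (h3.seq (exec_ifNZ_pos (c := .oth .flag) (q := replace)
          (by simp [hlt]) (hd.seq h5)))))) (by simp [hgood])
      refine h6.of_eq ?_ ?_ ?_
      · congr 1
        funext z
        cases z <;> simp [pick, hlt, hb]
      · funext z
        cases z <;> simp [pick, hlt, hw']
      · simp only [cst_oth, update_self]
        omega

/-- Time to scan the solution. -/
def scanTime (B : ℕ) : ℕ := loopTime B (loopTime B (2 * loopTime B 4 + (24 * B + 40)))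

/-- The best solution after a scan, given the set and the hub bits of every copy. -/
def scanResult {h : ℕ} (C : ℕ → ℕ → Finset (Fin h)) (hub : ℕ → ℕ → List Bool) (k₁ k₂ : ℕ)
    (cur : Finset (Fin h)) : Finset (Fin h) :=
  foldRange (fun p => foldRange (fun q => pick (decide (false ∈ hub p q)) (C p q)) k₂) k₁ cur

theorem drop_range_flatMap {β : Type*} {m k : ℕ} (hk : k < m) (f : ℕ → List β) :
    ((List.range m).drop k).flatMap f = f k ++ ((List.range m).drop (k + 1)).flatMap f := by
  rw [List.drop_eq_getElem_cons (by simpa using hk), List.flatMap_cons, List.getElem_range]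

/-- Every copy consumes its own block from the front of `sol`, the set bits and then the hub bits;
what remains afterwards is `rest`. -/
theorem exec_scan {η : ℕ} (hg : Ready η g) {C : ℕ → ℕ → Finset (Fin (n .j))}
    {hub : ℕ → ℕ → List Bool} (hhub : ∀ p < n .p, ∀ q < n .q, (hub p q).length = n .a)
    {rest : List Bool} (hsol : w .sol = ((List.range (n .p)).flatMap fun p =>
      (List.range (n .q)).flatMap fun q => indicator (C p q) ++ hub p q) ++ rest)
    (hcand : w .cand = []) {cur : Finset (Fin (n .j))} (hbest : w .best = indicator cur)
    (hpos : ∀ x, pos (false, x) = 0) (hB : ∀ x, n x ≤ B)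
    (hcnum : g .cnum = 0) (hgood : g .good = 0) (hbnum : g .bnum = cur.card) :
    Exec (aux := aux) scan (cst n pos g) w
      (cst n pos (update g .bnum (scanResult C hub (n .p) (n .q) cur).card))
      (update (update w .sol rest) .best (indicator (scanResult C hub (n .p) (n .q) cur)))
      (scanTime B) := by
  have copy : ∀ p < n .p, ∀ q < n .q, ∀ (cur : Finset (Fin (n .j))) (rest : List Bool)
      (pos : Bool × Ix → ℕ), pos (false, .j) = 0 → pos (false, .a) = 0 →
      Exec (aux := aux) (readSets.seq (readHubs.seq judge)) (cst n pos (update g .bnum cur.card))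
        (update (update w .sol (indicator (C p q) ++ hub p q ++ rest)) .best (indicator cur))
        (cst n pos (update g .bnum (pick (decide (false ∈ hub p q)) (C p q) cur).card))
        (update (update w .sol rest) .best
          (indicator (pick (decide (false ∈ hub p q)) (C p q) cur)))
        (2 * loopTime B 4 + (24 * B + 40)) := by
    intro p hp q hq cur rest pos hj ha
    have h1 := exec_readSets (aux := aux) (n := n) (pos := pos) (g := update g .bnum cur.card)
      (w := update (update w .sol (indicator (C p q) ++ hub p q ++ rest)) .best (indicator cur))
      (l := indicator (C p q)) (rest := hub p q ++ rest) (length_indicator _) (hB .j) hj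
      (by simp [hcnum]) (by simp) (by simp [hcand])
    have h2 := exec_readHubs (aux := aux) (n := n) (pos := pos)
      (g := update (update g .bnum cur.card) .cnum (C p q).card)
      (w := update (update (update (update w .sol (indicator (C p q) ++ hub p q ++ rest)) .best
        (indicator cur)) .sol (hub p q ++ rest)) .cand (indicator (C p q)).reverse)
      (l := hub p q) (rest := rest) (hhub p hp q hq) (hB .a) ha (by simp [hgood]) (by simp)
    have h3 := exec_judge (aux := aux) (n := n) (pos := pos) (η := η) (C := C p q) (cur := cur)
      (b := decide (false ∈ hub p q)) (B := B)
      (g := update (update (update g .bnum cur.card) .cnum (C p q).card) .good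
        (decide (false ∈ hub p q)).toNat)
      (w := update (update (update (update (update w .sol (indicator (C p q) ++ hub p q ++ rest))
        .best (indicator cur)) .sol (hub p q ++ rest)) .cand (indicator (C p q)).reverse)
        .sol rest)
      ⟨by simp [hg.ta], by simp [hg.tb], by simp [hg.flag], by simp [hg.icnt], by simp [hg.irem]⟩
      (by simp) (by simp) (by simp) (by simp) (by simp) (hB .j)
    rw [count_indicator] at h1
    refine (h1.seq (h2.seq h3)).of_eq ?_ ?_ (by omega)
    · congr 1
      funext z
      cases z <;> simp [hcnum, hgood]
    · funext z
      cases z <;> simp [hcand]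
  have row : ∀ p < n .p, ∀ (cur : Finset (Fin (n .j))) (rest : List Bool)
      (pos : Bool × Ix → ℕ), pos (false, .j) = 0 → pos (false, .a) = 0 → pos (false, .q) = 0 →
      Exec (aux := aux) (forX false .q (readSets.seq (readHubs.seq judge)))
        (cst n pos (update g .bnum cur.card))
        (update (update w .sol (((List.range (n .q)).flatMap fun q => indicator (C p q) ++ hub p q)
          ++ rest)) .best (indicator cur))
        (cst n pos (update g .bnum (foldRange (fun q => pick (decide (false ∈ hub p q)) (C p q))
          (n .q) cur).card))
        (update (update w .sol rest) .best (indicator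
          (foldRange (fun q => pick (decide (false ∈ hub p q)) (C p q)) (n .q) cur)))
        (loopTime B (2 * loopTime B 4 + (24 * B + 40))) := by
    intro p hp cur rest pos hj ha hq
    have key := exec_forC_of_states (aux := aux) (c := Ctr.rem false .q) (d := .cnt false .q)
      (n := n .q) (t := 2 * loopTime B 4 + (24 * B + 40))
      (p := readSets.seq (readHubs.seq judge)) (by simp)
      (U := fun k => cst n pos (update g .bnum (foldRange (fun q =>
        pick (decide (false ∈ hub p q)) (C p q)) k cur).card))
      (W := fun k => update (update w .sol ((((List.range (n .q)).drop k).flatMap fun q =>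
        indicator (C p q) ++ hub p q) ++ rest)) .best (indicator (foldRange (fun q =>
        pick (decide (false ∈ hub p q)) (C p q)) k cur)))
      ?_ (by simp [hq]) (by simp [hq]) (by simp [hq]) (by simp [hq])
    · refine (key.of_start (by simp) (by simp)).of_eq rfl (by simp [List.drop_of_length_le]) ?_
      have := hB .q
      unfold loopTime; gcongr
    · intro k hk
      simp only [update_cst_cnt, foldRange_succ]
      rw [drop_range_flatMap hk, List.append_assoc _ _ rest]
      exact copy p hp k hk _ _ _ (by simp [hj]) (by simp [ha])
  have key := exec_forC_of_states (aux := aux) (c := Ctr.rem false .p) (d := .cnt false .p)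
    (n := n .p) (t := loopTime B (2 * loopTime B 4 + (24 * B + 40)))
    (p := forX false .q (readSets.seq (readHubs.seq judge))) (by simp)
    (U := fun k => cst n pos (update g .bnum (scanResult C hub k (n .q) cur).card))
    (W := fun k => update (update w .sol ((((List.range (n .p)).drop k).flatMap fun p =>
      (List.range (n .q)).flatMap fun q => indicator (C p q) ++ hub p q) ++ rest)) .best
      (indicator (scanResult C hub k (n .q) cur)))
    ?_ (by simp [hpos]) (by simp [hpos]) (by simp [hpos]) (by simp [hpos])
  · refine (key.of_start ?_ ?_).of_eq rfl (by simp [List.drop_of_length_le]) ?_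
    · simp only [scanResult, foldRange_zero]
      rw [← hbnum, update_eq_self]
    · funext z
      cases z <;> simp [scanResult, hsol, hbest]
    · have := hB .p
      change _ ≤ B * (_ + 6) + 2
      gcongr
  · intro k hk
    simp only [update_cst_cnt, scanResult, foldRange_succ]
    rw [drop_range_flatMap hk, List.append_assoc _ _ rest]
    exact row k hk _ _ _ (by simp [hpos]) (by simp [hpos]) (by simp [hpos])

end Scan

end StackProg

end

/-! ### Correctness of the search -/

section

open Turing Function

section Fold

variable {β : Type*} {f : ℕ → β → β} {n : ℕ} {x : β}

theorem foldRange_induction {P : β → Prop} (hx : P x) (hf : ∀ k < n, ∀ y, P y → P (f k y)) :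
    P (foldRange f n x) := by
  induction n with
  | zero => exact hx
  | succ n ih =>
    rw [foldRange_succ]
    exact hf n (by omega) _ (ih fun k hk => hf k (by omega))

/-- Since no step increases the measure, a bound attained at step `k` persists to the end. -/
theorem foldRange_le_of_lt {m : β → ℕ} (hf : ∀ k < n, ∀ y, m (f k y) ≤ m y) {k : ℕ} (hk : k < n)
    {c : ℕ} (hc : ∀ y, m (f k y) ≤ c) : m (foldRange f n x) ≤ c := by
  induction n with
  | zero => omega
  | succ n ih =>
    rw [foldRange_succ]
    rcases Nat.lt_succ_iff_lt_or_eq.1 hk with h | rfl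
    · exact (hf n (by omega) _).trans (ih (fun k hk => hf k (by omega)) h)
    · exact hc _

theorem foldRange_le {m : β → ℕ} (hf : ∀ k < n, ∀ y, m (f k y) ≤ m y) :
    m (foldRange f n x) ≤ m x :=
  foldRange_induction (P := fun y => m y ≤ m x) le_rfl fun k hk y hy => (hf k hk y).trans hy

end Fold

namespace StackProg

section ScanResult

variable {h : ℕ} {C : ℕ → ℕ → Finset (Fin h)} {hub : ℕ → ℕ → List Bool} {k₁ k₂ : ℕ}
  {cur : Finset (Fin h)}

theorem card_pick_le (b : Bool) (D cur : Finset (Fin h)) : (pick b D cur).card ≤ cur.card := by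
  unfold pick
  split_ifs with hlt
  · exact hlt.2.le
  · exact le_rfl

theorem card_pick_true_le (D cur : Finset (Fin h)) : (pick true D cur).card ≤ D.card := by
  unfold pick
  split_ifs with hlt
  · exact le_rfl
  · simpa using hlt

theorem scanResult_induction {P : Finset (Fin h) → Prop} (hcur : P cur)
    (hC : ∀ p < k₁, ∀ q < k₂, false ∈ hub p q → P (C p q)) :
    P (scanResult C hub k₁ k₂ cur) := by
  refine foldRange_induction hcur fun p hp y hy => foldRange_induction hy fun q hq z hz => ?_
  unfold pick
  split_ifs with hlt
  · exact hC p hp q hq (by simpa using hlt.1)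
  · exact hz

theorem card_scanResult_le : (scanResult C hub k₁ k₂ cur).card ≤ cur.card :=
  foldRange_le fun _ _ _ => foldRange_le fun _ _ _ => card_pick_le _ _ _

theorem card_scanResult_le_of_good {p q : ℕ} (hp : p < k₁) (hq : q < k₂) (hg : false ∈ hub p q) :
    (scanResult C hub k₁ k₂ cur).card ≤ (C p q).card := by
  refine foldRange_le_of_lt (m := Finset.card)
    (fun _ _ _ => foldRange_le fun _ _ _ => card_pick_le _ _ _) hp fun y =>
    foldRange_le_of_lt (m := Finset.card) (fun _ _ _ => card_pick_le _ _ _) hq fun z => ?_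
  simp only [hg, decide_true]
  exact card_pick_true_le _ _

end ScanResult

open Classical in
/-- The sets chosen in the copy `(p, q)`. -/
noncomputable def copyPart {I : SetCoverInstance} {k₁ k₂ r : ℕ} (M : Finset (I.V k₁ k₂ r))
    (p q : ℕ) : Finset (Fin I.h) :=
  if hp : p < k₁ then if hq : q < k₂ then Vtx.copySet M ⟨p, hp⟩ ⟨q, hq⟩ else ∅ else ∅

open Classical in
/-- The membership bits of the hubs of the copy `(p, q)`. -/
noncomputable def hubPart {I : SetCoverInstance} {k₁ k₂ r : ℕ} (M : Finset (I.V k₁ k₂ r))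
    (p q : ℕ) : List Bool :=
  if hp : p < k₁ then if hq : q < k₂ then
    List.ofFn fun a : Fin r => decide (Vtx.y a ⟨p, hp⟩ ⟨q, hq⟩ ∈ M) else [] else []

section Parts

variable {I : SetCoverInstance} {k₁ k₂ r : ℕ}

theorem copyPart_eq {M : Finset (I.V k₁ k₂ r)} (p : Fin k₁) (q : Fin k₂) :
    copyPart M p q = Vtx.copySet M p q := by
  simp [copyPart]

open Classical in
theorem hubPart_eq {M : Finset (I.V k₁ k₂ r)} (p : Fin k₁) (q : Fin k₂) :
    hubPart M p q = List.ofFn fun a : Fin r => decide (Vtx.y a p q ∈ M) := by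
  simp [hubPart]

theorem false_mem_hubPart {M : Finset (I.V k₁ k₂ r)} {p : Fin k₁} {q : Fin k₂} :
    false ∈ hubPart M p q ↔ Vtx.Good M p q := by
  rw [hubPart_eq]
  simp [Vtx.Good]

theorem range_flatMap_eq {β : Type*} (n : ℕ) (f : ℕ → List β) :
    (List.range n).flatMap f = (List.finRange n).flatMap fun i : Fin n => f i := by
  rw [← List.map_coe_finRange_eq_range, List.flatMap_map]

/-- The numbering of the vertices puts the set vertices and hubs, copy by copy, before all others.
The characteristic vector therefore begins with the blocks that `scan` reads, and `rest` belongs to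
core vertices and leaves. -/
theorem exists_indicator_eq (M : Finset (Fin (I.verts k₁ k₂ r).length)) :
    ∃ rest : List Bool, rest.length ≤ (I.verts k₁ k₂ r).length ∧
      indicator M = ((List.range k₁).flatMap fun p => (List.range k₂).flatMap fun q =>
        indicator (copyPart (M.map (I.vertEquiv k₁ k₂ r).toEmbedding) p q) ++
          hubPart (M.map (I.vertEquiv k₁ k₂ r).toEmbedding) p q) ++ rest := by
  classical
  set M' := M.map (I.vertEquiv k₁ k₂ r).toEmbedding with hM'
  have h1 : indicator M = (I.verts k₁ k₂ r).map fun v => decide (v ∈ M') := by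
    apply List.ext_getElem
    · simp [indicator]
    · intro i h₁ h₂
      have hi : i < (I.verts k₁ k₂ r).length := by simpa using h₂
      simp only [indicator, List.getElem_ofFn, List.getElem_map, decide_eq_decide]
      exact (Finset.mem_map' (s := M) (a := ⟨i, hi⟩) (I.vertEquiv k₁ k₂ r).toEmbedding).symm
  have h2 : ∃ l₁ l₂, I.verts k₁ k₂ r = l₁ ++ l₂ ∧ l₁ = (List.finRange k₁).flatMap fun p =>
      (List.finRange k₂).flatMap fun q => ((List.finRange I.h).map fun j => Vtx.s j p q) ++
        ((List.finRange r).map fun a => Vtx.y a p q) := ⟨_, _, rfl, rfl⟩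
  obtain ⟨l₁, l₂, h2, h3⟩ := h2
  have h4 : ∀ f : I.V k₁ k₂ r → Bool, (I.verts k₁ k₂ r).map f = l₁.map f ++ l₂.map f := by
    intro f
    rw [h2, List.map_append]
  refine ⟨l₂.map fun v => decide (v ∈ M'), ?_, (h1.trans (h4 _)).trans ?_⟩
  · rw [List.length_map, h2, List.length_append]
    omega
  · congr 1
    simp only [h3, range_flatMap_eq, List.map_flatMap, copyPart_eq, hubPart_eq, List.map_append,
      List.map_map]
    congr 1
    funext p
    congr 1
    funext q
    congr 1
    · rw [indicator, List.ofFn_eq_map]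
      congr 1
      funext j
      simp [Vtx.mem_copySet]
    · rw [List.ofFn_eq_map]
      rfl

end Parts

/-- One round: the best solution after solving the MEG-set instance with the given parameters. -/
noncomputable def roundResult (A : (G : ConnectedGraph) → Finset (Fin G.n)) (I : SetCoverInstance)
    (hh : 0 < I.h) (hη : 0 < I.η) (k₁ k₂ r : ℕ) (h₁ : 0 < k₁) (h₂ : 0 < k₂) (hr : 0 < r)
    (cur : Finset (Fin I.h)) : Finset (Fin I.h) :=
  let M : Finset (I.V k₁ k₂ r) := Finset.map (I.vertEquiv k₁ k₂ r).toEmbedding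
    (A (I.toGraph k₁ k₂ r hh hη h₁ h₂ hr))
  scanResult (copyPart M) (hubPart M) k₁ k₂ cur

/-- The outcome of all rounds. -/
noncomputable def searchResult (A : (G : ConnectedGraph) → Finset (Fin G.n)) (D : ℕ) (hD : 0 < D)
    (I : SetCoverInstance) (hh : 0 < I.h) (hη : 0 < I.η) : Finset (Fin I.h) :=
  foldRange (fun κ => foldRange (fun ρ => roundResult A I hh hη (D * (κ + 1)) (D * (I.h + I.η))
    (ρ + 1) (by positivity) (by positivity) (by positivity)) (I.h + I.η)) (I.h + I.η) Finset.univ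

section Result

variable {A : (G : ConnectedGraph) → Finset (Fin G.n)} {I : SetCoverInstance} {hh : 0 < I.h}
  {hη : 0 < I.η}

theorem feasible_roundResult (hA : ∀ G, IsMEGSet G.graph (A G)) {k₁ k₂ r : ℕ} (h₁ : 2 ≤ k₁)
    (h₂ : 2 ≤ k₂) (hr : 0 < r) {cur : Finset (Fin I.h)} (hcur : setCover.Feasible I cur) :
    setCover.Feasible I
      (roundResult A I hh hη k₁ k₂ r (by omega) (by omega) hr cur) := by
  refine scanResult_induction hcur fun p hp q hq hg => ?_
  rw [show p = ((⟨p, hp⟩ : Fin k₁) : ℕ) from rfl, show q = ((⟨q, hq⟩ : Fin k₂) : ℕ) from rfl] at hg ⊢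
  rw [copyPart_eq]
  rw [false_mem_hubPart] at hg
  exact SetCoverInstance.feasible_copySet hh hη h₁ h₂ hr (hA _) hg

/-- The search starts from the family of all sets, and only covers from good copies ever replace the
current one. -/
theorem feasible_searchResult (hA : ∀ G, IsMEGSet G.graph (A G)) {D : ℕ} (hD : 2 ≤ D) :
    setCover.Feasible I (searchResult A D (by omega) I hh hη) := by
  refine foldRange_induction ?_ fun κ _ y hy => foldRange_induction hy fun ρ _ z hz =>
    feasible_roundResult hA ?_ ?_ _ hz
  · intro i
    obtain ⟨j, hj⟩ := I.covered i
    exact ⟨j, Finset.mem_univ _, hj⟩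
  · nlinarith
  · nlinarith

theorem card_searchResult_le {D : ℕ} {hD : 0 < D} :
    (searchResult A D hD I hh hη).card ≤ I.h := by
  refine (foldRange_le (m := Finset.card) fun _ _ _ => foldRange_le (m := Finset.card)
    fun _ _ _ => card_scanResult_le).trans ?_
  simp

theorem card_searchResult_le_copySet {D : ℕ} {hD : 0 < D} {κ ρ : ℕ} (hκ : κ < I.h + I.η)
    (hρ : ρ < I.h + I.η) {p : Fin (D * (κ + 1))} {q : Fin (D * (I.h + I.η))}
    (hg : Vtx.Good (Finset.map (I.vertEquiv (D * (κ + 1)) (D * (I.h + I.η)) (ρ + 1)).toEmbedding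
      (A (I.toGraph (D * (κ + 1)) (D * (I.h + I.η)) (ρ + 1) hh hη (by positivity)
        (by positivity) (by positivity)))) p q) :
    (searchResult A D hD I hh hη).card ≤
      (Vtx.copySet (Finset.map
        (I.vertEquiv (D * (κ + 1)) (D * (I.h + I.η)) (ρ + 1)).toEmbedding
        (A (I.toGraph (D * (κ + 1)) (D * (I.h + I.η)) (ρ + 1) hh hη (by positivity)
        (by positivity) (by positivity)))) p q).card := by
  refine foldRange_le_of_lt (m := Finset.card)
    (fun _ _ _ => foldRange_le fun _ _ _ => card_scanResult_le) hκ fun y =>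
    foldRange_le_of_lt (m := Finset.card) (fun _ _ _ => card_scanResult_le) hρ fun z => ?_
  rw [← copyPart_eq]
  exact card_scanResult_le_of_good p.2 q.2 (false_mem_hubPart.2 hg)

end Result

end StackProg

end

/-! ### The search program and its running time -/

section

open Turing Function

theorem ConnectedGraph.length_encode (G : ConnectedGraph) :
    G.encode.length = G.n + 1 + G.n * G.n := by
  simp [ConnectedGraph.encode, List.length_flatten, List.map_ofFn, Function.comp_def]
  ring

theorem eval_mono_nat (P : Polynomial ℕ) {a b : ℕ} (h : a ≤ b) : P.eval a ≤ P.eval b := by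
  simp only [Polynomial.eval_eq_sum, Polynomial.sum]
  gcongr

namespace StackProg

variable {aux : TM2ComputableAux Bool Bool}

open Frag

/-- The registers when only the input and the best solution are present. -/
def wst (inp best : List Bool) : Reg → List Bool
  | .inp => inp
  | .best => best
  | _ => []

/-- No index loop is running. -/
abbrev zeroPos : Bool × Ix → ℕ := fun _ => 0

/-- The remaining counters between two rounds, given the size of the instance, the number of items
and the cardinality of the best solution. -/
def pg (N η b : ℕ) : Oth → ℕ
  | .krem => N
  | .rrem => N
  | .irem => η
  | .bnum => b
  | _ => 0

namespace Frag

/-- One round: build the graph, solve it, extract solutions. -/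
def round : Prog aux :=
  emitGraph.seq <| (call (.inr .out)).seq <| (moveAll .out .sol).seq <| scan.seq (clearR .sol)

/-- Increase the range of the index `x` by `m`. -/
def addTo (x : Ix) : ℕ → Prog aux
  | 0 => skip
  | m + 1 => (inc (.rem false x)).seq ((inc (.rem true x)).seq (addTo x m))

/-- Make the range of the index `x` empty. -/
def clearX (x : Ix) : Prog aux := (clearC (.rem false x)).seq (clearC (.rem true x))

/-- All rounds with a given number of copies. -/
def rounds : Prog aux := forC (.oth .rrem) (.oth .rcnt) ((addTo .a 1).seq round)

/-- All rounds. -/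
def search (D : ℕ) : Prog aux :=
  forC (.oth .krem) (.oth .kcnt) ((addTo .p D).seq (rounds.seq (clearX .a)))

/-- Empty all counters in a list. -/
def clearCs (l : List Ctr) : Prog aux := l.foldr (fun c p => (clearC c).seq p) skip

/-- Read the numbers of sets and items. -/
def parse (D : ℕ) : Prog aux :=
  (whileTop .inp ((popB .inp).seq <| (addTo .j 1).seq <| (addTo .q D).seq <|
    (inc (.oth .krem)).seq <| (inc (.oth .rrem)).seq <| (inc (.oth .bnum)).seq <|
      pushB .best true)).seq <|
  (popB .inp).seq <|
  (whileTop .inp ((popB .inp).seq <| (addTo .i 1).seq <| (addTo .q D).seq <|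
    (inc (.oth .krem)).seq <| (inc (.oth .rrem)).seq <| inc (.oth .irem))).seq (popB .inp)

/-- The whole search. -/
noncomputable def solve (D : ℕ) : Prog aux :=
  (parse D).seq <| (search D).seq <|
    (clearCs (Finset.univ : Finset Ctr).toList).seq (clearR .inp)

end Frag

/-- A bound for the number of vertices of the graph. -/
def vertBound (B : ℕ) : ℕ := B * (B * (B + B)) + 2 * (2 * (B * B) + B * B + B + B * B + 1)

/-- A bound for the length of the encoding of the graph. -/
def codeBound (B : ℕ) : ℕ := vertBound B + 1 + vertBound B * vertBound B

/-- Time for a round. -/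
def roundTime (P : Polynomial ℕ) (B : ℕ) : ℕ :=
  graphTime B + (codeBound B + P.eval (codeBound B) + vertBound B + 2) + (4 * vertBound B + 1) +
    scanTime B + (2 * vertBound B + 1)

/-- Time for all rounds with a given number of copies. -/
def roundsTime (P : Polynomial ℕ) (B : ℕ) : ℕ := loopTime B (3 + roundTime P B)

/-- Time for all rounds. -/
def searchTime (P : Polynomial ℕ) (D B : ℕ) : ℕ :=
  loopTime B ((2 * D + 1) + (roundsTime P B + (4 * B + 2)))

/-- Time to read the input. -/
def parseTime (D B : ℕ) : ℕ := 2 * (B * (2 * D + 11) + 1) + 2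

/-- Time for the whole search. -/
noncomputable def solveTime (P : Polynomial ℕ) (D B : ℕ) : ℕ :=
  parseTime D B + (searchTime P D B +
    (((Finset.univ : Finset Ctr).toList.length * (2 * B + 1) + 1) + (2 * (B * B) + 1)))

theorem ranges_le {h k₁ k₂ r η B : ℕ} (hh : h ≤ B) (h₁ : k₁ ≤ B) (h₂ : k₂ ≤ B) (hr : r ≤ B)
    (hη : η ≤ B) (x : Ix) : ranges h k₁ k₂ r η x ≤ B := by
  cases x <;> assumption

theorem length_verts_le {I : SetCoverInstance} {k₁ k₂ r B : ℕ} (hh : I.h ≤ B) (h₁ : k₁ ≤ B)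
    (h₂ : k₂ ≤ B) (hr : r ≤ B) (hη : I.η ≤ B) : (I.verts k₁ k₂ r).length ≤ vertBound B := by
  rw [I.length_verts, SetCoverInstance.leaves, vertBound]
  gcongr

section Round

variable {A : (G : ConnectedGraph) → Finset (Fin G.n)} {P : Polynomial ℕ} {I : SetCoverInstance}
  {hh : 0 < I.h} {hη : 0 < I.η} {k₁ k₂ r B : ℕ} {g : Oth → ℕ} {cur : Finset (Fin I.h)}

/-- Pushing bits leaves the encoding reversed on `out`, which is what `call` expects; the answer
comes back reversed, and moving it to `sol` restores its order. -/
theorem exec_round (hA : ∀ G, Outputs aux G.encode (indicator (A G)) (P.eval G.encode.length))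
    (hk₁ : 0 < k₁) (hk₂ : 0 < k₂) (hr : 0 < r)
    (bh : I.h ≤ B) (b₁ : k₁ ≤ B) (b₂ : k₂ ≤ B) (br : r ≤ B) (bη : I.η ≤ B) (hg : Ready I.η g)
    (hcnum : g .cnum = 0) (hgood : g .good = 0) (hbnum : g .bnum = cur.card) :
    Exec (aux := aux) round (cst (ranges I.h k₁ k₂ r I.η) zeroPos g) (wst I.matrix (indicator cur))
      (cst (ranges I.h k₁ k₂ r I.η) zeroPos
        (update g .bnum (roundResult A I hh hη k₁ k₂ r hk₁ hk₂ hr cur).card))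
      (wst I.matrix (indicator (roundResult A I hh hη k₁ k₂ r hk₁ hk₂ hr cur)))
      (roundTime P B) := by
  have hB := ranges_le bh b₁ b₂ br bη
  set G := I.toGraph k₁ k₂ r hh hη hk₁ hk₂ hr with hG
  have hGn : G.n ≤ vertBound B := length_verts_le bh b₁ b₂ br bη
  have hcode : G.encode.length ≤ codeBound B := by
    rw [ConnectedGraph.length_encode, codeBound]
    gcongr
  have e1 := emits_emitGraph (aux := aux) I hh hη hk₁ hk₂ hr hg hB
    (wst I.matrix (indicator cur)) rfl rfl
  have e2 := exec_call (aux := aux) (u := cst (ranges I.h k₁ k₂ r I.η) zeroPos g)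
    (w := update (wst I.matrix (indicator cur)) .out
      (G.encode.reverse ++ wst I.matrix (indicator cur) .out)) .out
    (by simp [wst]) (hA G)
  have e3 := exec_moveAll (aux := aux) (u := cst (ranges I.h k₁ k₂ r I.η) zeroPos g)
    (w := update (update (wst I.matrix (indicator cur)) .out
      (G.encode.reverse ++ wst I.matrix (indicator cur) .out)) .out (indicator (A G)).reverse)
    (show Reg.out ≠ .sol by simp)
  obtain ⟨rest, hlen, hrest⟩ := exists_indicator_eq (I := I) (k₁ := k₁) (k₂ := k₂) (r := r) (A G)
  have hrest' : rest.length ≤ vertBound B := hlen.trans (length_verts_le bh b₁ b₂ br bη)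
  set M := Finset.map (I.vertEquiv k₁ k₂ r).toEmbedding (A G) with hM
  have e4 := exec_scan (aux := aux) (n := ranges I.h k₁ k₂ r I.η) (g := g) (pos := zeroPos)
    (w := update (wst I.matrix (indicator cur)) .sol (indicator (A G)))
    hg (C := copyPart M) (hub := hubPart M) ?_ (rest := rest)
    (by rw [update_self]; exact hrest) (by simp [wst]) (cur := cur) (by simp [wst]; rfl) (fun _ => rfl) hB
    hcnum hgood hbnum
  · have e5 := exec_clearR (aux := aux) (u := cst (ranges I.h k₁ k₂ r I.η) zeroPos
      (update g .bnum (roundResult A I hh hη k₁ k₂ r hk₁ hk₂ hr cur).card))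
      (w := update (update (update (wst I.matrix (indicator cur)) .sol (indicator (A G))) .sol rest)
        .best (indicator (roundResult A I hh hη k₁ k₂ r hk₁ hk₂ hr cur))) .sol
    have e3' := e3.of_eq (w'' := update (wst I.matrix (indicator cur)) .sol (indicator (A G))) rfl
      (by funext z; cases z <;> simp [wst]) le_rfl
    refine (e1.seq (e2.seq (e3'.seq (e4.seq e5)))).of_eq rfl ?_ ?_
    · funext z
      cases z <;> simp [wst]
    · have h1 := eval_mono_nat P hcode
      have h2 : (indicator (A G)).length ≤ vertBound B := by rwa [length_indicator]
      simp only [update_self, List.length_reverse, roundTime, ne_eq, reduceCtorEq,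
        not_false_eq_true, update_of_ne]
      omega
  · intro p hp q hq
    have := hubPart_eq (M := M) ⟨p, hp⟩ ⟨q, hq⟩
    simp only at this
    rw [this, List.length_ofFn]
    rfl

end Round

section Ranges

variable {n : Ix → ℕ} {g : Oth → ℕ} {w : Reg → List Bool} {B : ℕ}

theorem exec_addTo (x : Ix) (m : ℕ) :
    Exec (aux := aux) (addTo x m) (cst n zeroPos g) w
      (cst (update n x (n x + m)) zeroPos g) w (2 * m + 1) := by
  induction m generalizing n with
  | zero => exact Exec.skip.of_eq (by simp) rfl (by omega)
  | succ m ih =>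
    have h1 := ih (n := update n x (n x + 1))
    have h2 : Exec (aux := aux) (inc (.rem true x)) (update (cst n zeroPos g) (.rem false x) (n x + 1))
        w (cst (update n x (n x + 1)) zeroPos g) w 1 := by
      refine (exec_inc _).of_eq ?_ rfl le_rfl
      funext z
      rcases z with ⟨r, y⟩ | ⟨r, y⟩ | o
      · simp
      · cases r <;> simp [update_apply]
      · simp
    refine ((exec_inc _).seq (h2.seq h1)).of_eq ?_ rfl (by omega)
    simp only [update_idem, update_self]
    ring_nf

theorem exec_clearX (x : Ix) (hB : n x ≤ B) :
    Exec (aux := aux) (clearX x) (cst n zeroPos g) w (cst (update n x 0) zeroPos g) w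
      (4 * B + 2) := by
  refine ((exec_clearC _).seq (exec_clearC _)).of_eq ?_ rfl ?_
  · funext z
    rcases z with ⟨r, y⟩ | ⟨r, y⟩ | o
    · simp
    · cases r <;> simp [update_apply]
    · simp
  · simp
    omega

theorem exec_clearCs (l : List Ctr) {u : Ctr → ℕ} (hu : ∀ c, u c ≤ B) :
    Exec (aux := aux) (clearCs l) u w (fun c => if c ∈ l then 0 else u c) w
      (l.length * (2 * B + 1) + 1) := by
  induction l generalizing u with
  | nil => exact Exec.skip.of_eq (by simp) rfl (by omega)
  | cons c l ih =>
    have h1 := ih (u := update u c 0) fun d => by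
      rw [update_apply]
      split_ifs
      · omega
      · exact hu d
    refine ((exec_clearC c).seq h1).of_eq ?_ rfl ?_
    · funext d
      simp only [update_apply, List.mem_cons]
      split_ifs <;> simp_all
    · have := hu c
      simp only [List.length_cons, Nat.succ_mul]
      omega

theorem update_ranges_j {h k₁ k₂ r η m : ℕ} :
    update (ranges h k₁ k₂ r η) .j m = ranges m k₁ k₂ r η := by
  funext x; cases x <;> simp [ranges]

theorem update_ranges_p {h k₁ k₂ r η m : ℕ} :
    update (ranges h k₁ k₂ r η) .p m = ranges h m k₂ r η := by
  funext x; cases x <;> simp [ranges]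

theorem update_ranges_q {h k₁ k₂ r η m : ℕ} :
    update (ranges h k₁ k₂ r η) .q m = ranges h k₁ m r η := by
  funext x; cases x <;> simp [ranges]

theorem update_ranges_a {h k₁ k₂ r η m : ℕ} :
    update (ranges h k₁ k₂ r η) .a m = ranges h k₁ k₂ m η := by
  funext x; cases x <;> simp [ranges]

theorem update_ranges_i {h k₁ k₂ r η m : ℕ} :
    update (ranges h k₁ k₂ r η) .i m = ranges h k₁ k₂ r m := by
  funext x; cases x <;> simp [ranges]

/-- The rule for reading a unary number. -/
theorem exec_whileTop {C R : Type} [DecidableEq C] [DecidableEq R] {r : R}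
    {p : Frag (C ⊕ R) aux} {t m : ℕ} {U : ℕ → C → ℕ} {W : ℕ → R → List Bool}
    (htop : ∀ k < m, ∃ l, W k r = true :: l) (hend : (W m r).head?.getD false = false)
    (hbody : ∀ k < m, Exec p (U k) (W k) (U (k + 1)) (W (k + 1)) t) :
    Exec (whileTop r p) (U 0) (W 0) (U m) (W m) (m * (t + 1) + 1) := by
  have key : ∀ d k, d + k = m →
      Exec (whileTop r p) (U k) (W k) (U m) (W m) (d * (t + 1) + 1) := by
    intro d
    induction d with
    | zero =>
      intro k hk
      obtain rfl : k = m := by omega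
      exact (exec_whileTop_false hend).mono (by omega)
    | succ d ih =>
      intro k hk
      obtain ⟨l, hl⟩ := htop k (by omega)
      refine (exec_whileTop_true hl (hbody k (by omega)) (ih (k + 1) (by omega))).mono ?_
      rw [Nat.succ_mul]
      omega
  exact key m 0 (by omega)

end Ranges

section Search

variable {A : (G : ConnectedGraph) → Finset (Fin G.n)} {P : Polynomial ℕ} {I : SetCoverInstance}
  {hh : 0 < I.h} {hη : 0 < I.η} {k₁ k₂ N B : ℕ} {g : Oth → ℕ}

theorem exec_rounds (hA : ∀ G, Outputs aux G.encode (indicator (A G)) (P.eval G.encode.length))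
    (hk₁ : 0 < k₁) (hk₂ : 0 < k₂) (bh : I.h ≤ B) (b₁ : k₁ ≤ B) (b₂ : k₂ ≤ B) (bN : N ≤ B)
    (bη : I.η ≤ B) (hg : Ready I.η g) (hcnum : g .cnum = 0) (hgood : g .good = 0)
    (hrrem : g .rrem = N) (hrcnt : g .rcnt = 0) (cur : Finset (Fin I.h)) :
    let res := foldRange (fun ρ => roundResult A I hh hη k₁ k₂ (ρ + 1) hk₁ hk₂ ρ.succ_pos) N cur
    Exec (aux := aux) rounds (cst (ranges I.h k₁ k₂ 0 I.η) zeroPos (update g .bnum cur.card))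
      (wst I.matrix (indicator cur))
      (cst (ranges I.h k₁ k₂ N I.η) zeroPos (update g .bnum res.card))
      (wst I.matrix (indicator res)) (roundsTime P B) := by
  intro res
  -- The range of `a` grows by one at the start of each round, so the round `ρ` works with `ρ + 1`
  -- hubs per copy.
  have key := exec_forC_of_states (aux := aux) (c := Ctr.oth .rrem) (d := .oth .rcnt) (n := N)
    (t := 3 + roundTime P B) (p := (addTo .a 1).seq round) (by simp)
    (U := fun ρ => cst (ranges I.h k₁ k₂ ρ I.η) zeroPos (update g .bnum (foldRange
      (fun ρ => roundResult A I hh hη k₁ k₂ (ρ + 1) hk₁ hk₂ ρ.succ_pos) ρ cur).card))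
    (W := fun ρ => wst I.matrix (indicator (foldRange
      (fun ρ => roundResult A I hh hη k₁ k₂ (ρ + 1) hk₁ hk₂ ρ.succ_pos) ρ cur)))
    ?_ (by simp [hrrem]) (by simp [hrcnt]) (by simp [hrrem]) (by simp [hrcnt])
  · refine key.mono ?_
    unfold roundsTime loopTime
    gcongr
  · intro ρ hρ
    simp only [update_cst_oth, foldRange_succ]
    set y := foldRange
      (fun ρ => roundResult A I hh hη k₁ k₂ (ρ + 1) hk₁ hk₂ ρ.succ_pos) ρ cur
    have h1 := exec_addTo (aux := aux) (n := ranges I.h k₁ k₂ ρ I.η)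
      (g := update (update (update g .bnum y.card) .rrem (N - ρ)) .rcnt ρ)
      (w := wst I.matrix (indicator y)) .a 1
    rw [update_ranges_a] at h1
    have h2 := exec_round (aux := aux) (hh := hh) (hη := hη) (r := ρ + 1) (B := B) (cur := y)
      (g := update (update (update g .bnum y.card) .rrem (N - ρ)) .rcnt ρ) hA hk₁ hk₂ ρ.succ_pos
      bh b₁ b₂ (by omega) bη
      ⟨by simp [hg.ta], by simp [hg.tb], by simp [hg.flag], by simp [hg.icnt], by simp [hg.irem]⟩
      (by simp [hcnum]) (by simp [hgood]) (by simp)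
    refine (h1.seq h2).of_eq ?_ rfl le_rfl
    congr 1
    funext z
    cases z <;> simp

theorem exec_search {D : ℕ} (hD : 0 < D)
    (hA : ∀ G, Outputs aux G.encode (indicator (A G)) (P.eval G.encode.length))
    (hB : D * (I.h + I.η) ≤ B) :
    Exec (aux := aux) (search D)
      (cst (ranges I.h 0 (D * (I.h + I.η)) 0 I.η) zeroPos (pg (I.h + I.η) I.η I.h))
      (wst I.matrix (indicator (Finset.univ : Finset (Fin I.h))))
      (cst (ranges I.h (D * (I.h + I.η)) (D * (I.h + I.η)) 0 I.η) zeroPos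
        (pg (I.h + I.η) I.η (searchResult A D hD I hh hη).card))
      (wst I.matrix (indicator (searchResult A D hD I hh hη))) (searchTime P D B) := by
  have hN : I.h + I.η ≤ B := le_trans (Nat.le_mul_of_pos_left _ hD) hB
  have hpg : ∀ b b', update (pg (I.h + I.η) I.η b) .bnum b' = pg (I.h + I.η) I.η b' := by
    intro b b'
    funext z
    cases z <;> simp [pg]
  let f : ℕ → Finset (Fin I.h) → Finset (Fin I.h) := fun κ =>
    foldRange (fun ρ => roundResult A I hh hη (D * (κ + 1)) (D * (I.h + I.η))
      (ρ + 1) (by positivity) (by positivity) (by positivity)) (I.h + I.η)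
  have key := exec_forC_of_states (aux := aux) (c := Ctr.oth .krem) (d := .oth .kcnt)
    (n := I.h + I.η) (t := (2 * D + 1) + (roundsTime P B + (4 * B + 2)))
    (p := (addTo .p D).seq (rounds.seq (clearX .a))) (by simp)
    (U := fun κ => cst (ranges I.h (D * κ) (D * (I.h + I.η)) 0 I.η) zeroPos
      (pg (I.h + I.η) I.η (foldRange f κ Finset.univ).card))
    (W := fun κ => wst I.matrix (indicator (foldRange f κ Finset.univ)))
    ?_ (by simp [pg]) (by simp [pg]) (by simp [pg]) (by simp [pg])
  · refine (key.of_start (by simp) (by simp)).mono ?_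
    unfold searchTime
    rw [loopTime]
    gcongr
  · intro κ hκ
    -- As `κ < N`, the bound `B` for `D * N` also bounds `k₁`, and with it every index range that
    -- occurs.
    have hκ' : D * (κ + 1) ≤ B := le_trans (Nat.mul_le_mul_left _ hκ) hB
    simp only [update_cst_oth, foldRange_succ]
    set y := foldRange f κ Finset.univ
    set g := update (update (pg (I.h + I.η) I.η y.card) .krem (I.h + I.η - κ)) .kcnt κ with hg
    have h1 := exec_addTo (aux := aux) (n := ranges I.h (D * κ) (D * (I.h + I.η)) 0 I.η)
      (g := g) (w := wst I.matrix (indicator y)) .p D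
    rw [update_ranges_p, show ranges I.h (D * κ) (D * (I.h + I.η)) 0 I.η .p + D = D * (κ + 1) from
      by simp only [ranges]; ring] at h1
    have h2 := exec_rounds (aux := aux) (hh := hh) (hη := hη) (k₁ := D * (κ + 1))
      (k₂ := D * (I.h + I.η)) (N := I.h + I.η) (B := B) (g := g) hA (by positivity)
      (by positivity) (by omega) hκ' hB hN (by omega)
      ⟨by simp [hg, pg], by simp [hg, pg], by simp [hg, pg], by simp [hg, pg], by simp [hg, pg]⟩
      (by simp [hg, pg]) (by simp [hg, pg]) (by simp [hg, pg]) (by simp [hg, pg]) y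
    rw [show update g .bnum y.card = g from by
      funext z; cases z <;> simp [hg, pg]] at h2
    have h3 := exec_clearX (aux := aux) (n := ranges I.h (D * (κ + 1)) (D * (I.h + I.η))
      (I.h + I.η) I.η) (g := update g .bnum (f κ y).card) (w := wst I.matrix (indicator (f κ y)))
      (B := B) .a hN
    rw [update_ranges_a] at h3
    refine (h1.seq (h2.seq h3)).of_eq ?_ rfl le_rfl
    congr 1
    funext z
    cases z <;> simp [hg, pg]

end Search

theorem indicator_univ (n : ℕ) : indicator (Finset.univ : Finset (Fin n)) = List.replicate n true := by
  simp [indicator]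

/-- Every symbol of the two unary numbers adds `D` to the range of `q`, which ends as `D * N`
without any multiplication. Meanwhile `best` is filled with one `true` per set, the family of all
sets. -/
theorem exec_parse {I : SetCoverInstance} {D B : ℕ} (hB : I.h + I.η ≤ B) :
    Exec (aux := aux) (parse D) (cst (ranges 0 0 0 0 0) zeroPos (pg 0 0 0)) (wst I.encode [])
      (cst (ranges I.h 0 (D * (I.h + I.η)) 0 I.η) zeroPos (pg (I.h + I.η) I.η I.h))
      (wst I.matrix (indicator (Finset.univ : Finset (Fin I.h)))) (parseTime D B) := by
  have e1 := exec_whileTop (aux := aux) (r := Reg.inp) (m := I.h) (t := 2 * D + 10)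
    (p := (popB .inp).seq <| (addTo .j 1).seq <| (addTo .q D).seq <|
      (inc (.oth .krem)).seq <| (inc (.oth .rrem)).seq <| (inc (.oth .bnum)).seq <|
        pushB .best true)
    (U := fun k => cst (ranges k 0 (D * k) 0 0) zeroPos (pg k 0 k))
    (W := fun k => wst (List.replicate (I.h - k) true ++ (false :: (List.replicate I.η true ++
      (false :: I.matrix)))) (List.replicate k true)) ?_ (by simp [wst]) ?_
  · have e2 := exec_popB (aux := aux) (u := cst (ranges I.h 0 (D * I.h) 0 0) zeroPos (pg I.h 0 I.h))
      (w := wst (List.replicate (I.h - I.h) true ++ (false :: (List.replicate I.η true ++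
      (false :: I.matrix)))) (List.replicate I.h true)) .inp
    have e3 := exec_whileTop (aux := aux) (r := Reg.inp) (m := I.η) (t := 2 * D + 10)
      (p := (popB .inp).seq <| (addTo .i 1).seq <| (addTo .q D).seq <|
        (inc (.oth .krem)).seq <| (inc (.oth .rrem)).seq <| inc (.oth .irem))
      (U := fun k => cst (ranges I.h 0 (D * (I.h + k)) 0 k) zeroPos (pg (I.h + k) k I.h))
      (W := fun k => wst (List.replicate (I.η - k) true ++ (false :: I.matrix))
        (List.replicate I.h true)) ?_ (by simp [wst]) ?_
    · have e4 := exec_popB (aux := aux)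
        (u := cst (ranges I.h 0 (D * (I.h + I.η)) 0 I.η) zeroPos (pg (I.h + I.η) I.η I.h))
        (w := wst (List.replicate (I.η - I.η) true ++ (false :: I.matrix))
        (List.replicate I.h true)) .inp
      refine ((e1.seq ((e2.of_eq rfl ?_ le_rfl).seq (e3.seq e4))).of_start ?_ ?_).of_eq rfl ?_ ?_
      · funext z
        cases z <;> simp [wst]
      · simp
      · simp [I.encode_eq]
      · rw [indicator_univ]
        funext z
        cases z <;> simp [wst]
      · have h1 : I.h * (2 * D + 10 + 1) ≤ B * (2 * D + 11) := Nat.mul_le_mul_right _ (by omega)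
        have h2 : I.η * (2 * D + 10 + 1) ≤ B * (2 * D + 11) := Nat.mul_le_mul_right _ (by omega)
        unfold parseTime
        omega
    · intro k hk
      refine ⟨List.replicate (I.η - (k + 1)) true ++ (false :: I.matrix), ?_⟩
      simp only [wst]
      rw [show I.η - k = (I.η - (k + 1)) + 1 by omega, List.replicate_succ]
      rfl
    · intro k hk
      refine ((exec_popB _).seq ((exec_addTo .i 1).seq ((exec_addTo .q D).seq ((exec_inc _).seq
        ((exec_inc _).seq (exec_inc _)))))).of_eq ?_ ?_ (by omega)
      · simp only [update_cst_oth, update_ranges_i, update_ranges_q]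
        congr 1
        funext z
        cases z <;> simp [pg] <;> omega
      · funext z
        cases z <;> simp [wst]
        rw [show I.η - k = (I.η - (k + 1)) + 1 by omega, List.replicate_succ]
        rfl
  · intro k hk
    refine ⟨List.replicate (I.h - (k + 1)) true ++ (false :: (List.replicate I.η true ++
      (false :: I.matrix))), ?_⟩
    simp only [wst]
    rw [show I.h - k = (I.h - (k + 1)) + 1 by omega, List.replicate_succ]
    rfl
  · intro k hk
    refine ((exec_popB _).seq ((exec_addTo .j 1).seq ((exec_addTo .q D).seq ((exec_inc _).seq
      ((exec_inc _).seq ((exec_inc _).seq (exec_pushB _ _))))))).of_eq ?_ ?_ (by omega)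
    · simp only [update_cst_oth, update_ranges_j, update_ranges_q]
      congr 1
      funext z
      cases z <;> simp [pg]
    · funext z
      cases z <;> simp [wst, List.replicate_succ]
      rw [show I.h - k = (I.h - (k + 1)) + 1 by omega, List.replicate_succ]
      rfl

/-- The counters and the input are cleared at the end because a machine may halt with nothing but
its output on the stacks. -/
theorem exec_solve {A : (G : ConnectedGraph) → Finset (Fin G.n)} {P : Polynomial ℕ}
    {I : SetCoverInstance} {hh : 0 < I.h} {hη : 0 < I.η} {D : ℕ} (hD : 0 < D)
    (hA : ∀ G, Outputs aux G.encode (indicator (A G)) (P.eval G.encode.length)) :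
    Exec (aux := aux) (solve D) (fun _ => 0) (wst I.encode []) (fun _ => 0)
      (wst [] (indicator (searchResult A D hD I hh hη))) (solveTime P D (D * (I.h + I.η))) := by
  set B := D * (I.h + I.η) with hB
  have hN : I.h + I.η ≤ B := Nat.le_mul_of_pos_left _ hD
  have e1 := exec_parse (aux := aux) (I := I) (D := D) hN
  have e2 := exec_search (aux := aux) (I := I) (hh := hh) (hη := hη) hD hA hB.ge
  have e3 := exec_clearCs (aux := aux) (B := B) (Finset.univ : Finset Ctr).toList
    (u := cst (ranges I.h (D * (I.h + I.η)) (D * (I.h + I.η)) 0 I.η) zeroPos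
        (pg (I.h + I.η) I.η (searchResult A D hD I hh hη).card))
    (w := wst I.matrix (indicator (searchResult A D hD I hh hη))) ?_
  · have e4 := exec_clearR (aux := aux) (u := fun _ : Ctr => 0)
      (w := wst I.matrix (indicator (searchResult A D hD I hh hη))) .inp
    refine ((e1.seq (e2.seq ((e3.of_eq ?_ rfl le_rfl).seq e4))).of_start ?_ rfl).of_eq rfl ?_ ?_
    · funext c
      simp
    · funext z
      rcases z with ⟨r, y⟩ | ⟨r, y⟩ | o
      · rfl
      · cases y <;> rfl
      · cases o <;> rfl
    · funext z
      cases z <;> simp [wst]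
    · have : I.matrix.length ≤ B * B := by
        rw [I.length_matrix]
        exact Nat.mul_le_mul (by omega) (by omega)
      simp only [wst, solveTime]
      omega
  · have hc := card_finset_fin_le (searchResult A D hD I hh hη)
    rintro (⟨r, y⟩ | ⟨r, y⟩ | o)
    · simp
    · simp only [cst_rem, Nat.sub_zero]
      exact ranges_le (by omega) le_rfl le_rfl (by omega) (by omega) y
    · cases o <;> simp [pg] <;> omega

end StackProg

end

section

open Turing Function

/-! ### Polynomial bounds -/

/-- The function is given by a polynomial. -/
def IsPolyNat (f : ℕ → ℕ) : Prop := ∃ P : Polynomial ℕ, ∀ x, f x = P.eval x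

namespace IsPolyNat

variable {f g : ℕ → ℕ}

theorem const (c : ℕ) : IsPolyNat fun _ => c := ⟨.C c, by simp⟩

theorem id : IsPolyNat fun x => x := ⟨.X, by simp⟩

theorem add (hf : IsPolyNat f) (hg : IsPolyNat g) : IsPolyNat fun x => f x + g x := by
  obtain ⟨P, hP⟩ := hf
  obtain ⟨Q, hQ⟩ := hg
  exact ⟨P + Q, by simp [hP, hQ]⟩

theorem mul (hf : IsPolyNat f) (hg : IsPolyNat g) : IsPolyNat fun x => f x * g x := by
  obtain ⟨P, hP⟩ := hf
  obtain ⟨Q, hQ⟩ := hg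
  exact ⟨P * Q, by simp [hP, hQ]⟩

theorem comp (hg : IsPolyNat g) (hf : IsPolyNat f) : IsPolyNat fun x => g (f x) := by
  obtain ⟨P, hP⟩ := hf
  obtain ⟨Q, hQ⟩ := hg
  exact ⟨Q.comp P, by simp [hP, hQ]⟩

theorem eval (P : Polynomial ℕ) (hf : IsPolyNat f) : IsPolyNat fun x => P.eval (f x) :=
  comp ⟨P, fun _ => rfl⟩ hf

theorem mono (hf : IsPolyNat f) {a b : ℕ} (h : a ≤ b) : f a ≤ f b := by
  obtain ⟨P, hP⟩ := hf
  rw [hP, hP]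
  exact eval_mono_nat P h

end IsPolyNat

namespace StackProg

open IsPolyNat

section Poly

variable {f : ℕ → ℕ}

theorem isPoly_loopTime (hf : IsPolyNat f) : IsPolyNat fun B => loopTime B (f B) :=
  (id.mul (hf.add (const _))).add (const _)

theorem isPoly_coreLoopTime (hf : IsPolyNat f) : IsPolyNat fun B => coreLoopTime B (f B) :=
  (((const 4).mul (isPoly_loopTime (isPoly_loopTime hf))).add (isPoly_loopTime hf)).add hf

theorem isPoly_vtxLoopTime (hf : IsPolyNat f) : IsPolyNat fun B => vtxLoopTime B (f B) :=
  (isPoly_loopTime (isPoly_loopTime ((const 2).mul (isPoly_loopTime hf)))).add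
    ((const 2).mul (isPoly_coreLoopTime hf))

theorem isPoly_adjTime : IsPolyNat adjTime :=
  ((const 2).mul ((((const 24).mul id).add (const 6)).add
    ((((isPoly_loopTime (isPoly_loopTime (const 3))).add (isPoly_loopTime (const 3))).add
      ((const 4).mul (id.mul id))).add (const 4)))).add (const 4)

theorem isPoly_graphTime : IsPolyNat graphTime :=
  ((isPoly_vtxLoopTime (const 1)).add (const 1)).add
    (isPoly_vtxLoopTime (isPoly_vtxLoopTime isPoly_adjTime))

theorem isPoly_scanTime : IsPolyNat scanTime :=
  isPoly_loopTime (isPoly_loopTime (((const 2).mul (isPoly_loopTime (const 4))).add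
    (((const 24).mul id).add (const 40))))

theorem isPoly_vertBound : IsPolyNat vertBound :=
  (id.mul (id.mul (id.add id))).add ((const 2).mul ((((((const 2).mul (id.mul id)).add
    (id.mul id)).add id).add (id.mul id)).add (const 1)))

theorem isPoly_codeBound : IsPolyNat codeBound :=
  (isPoly_vertBound.add (const 1)).add (isPoly_vertBound.mul isPoly_vertBound)

theorem isPoly_roundTime (P : Polynomial ℕ) : IsPolyNat (roundTime P) :=
  (((isPoly_graphTime.add (((isPoly_codeBound.add (eval P isPoly_codeBound)).add
    isPoly_vertBound).add (IsPolyNat.const 2))).add (((IsPolyNat.const 4).mul isPoly_vertBound).add (IsPolyNat.const 1))).add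
    isPoly_scanTime).add (((IsPolyNat.const 2).mul isPoly_vertBound).add (IsPolyNat.const 1))

theorem isPoly_searchTime (P : Polynomial ℕ) (D : ℕ) : IsPolyNat (searchTime P D) :=
  isPoly_loopTime ((IsPolyNat.const (2 * D + 1)).add
    ((isPoly_loopTime ((IsPolyNat.const 3).add (isPoly_roundTime P))).add
      (((IsPolyNat.const 4).mul id).add (IsPolyNat.const 2))))

theorem isPoly_solveTime (P : Polynomial ℕ) (D : ℕ) : IsPolyNat (solveTime P D) :=
  (((IsPolyNat.const 2).mul ((id.mul (IsPolyNat.const (2 * D + 11))).add (IsPolyNat.const 1))).add (IsPolyNat.const 2)).add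
    ((isPoly_searchTime P D).add ((((IsPolyNat.const _).mul (((IsPolyNat.const 2).mul id).add (IsPolyNat.const 1))).add
      (IsPolyNat.const 1)).add (((IsPolyNat.const 2).mul (id.mul id)).add (IsPolyNat.const 1))))

end Poly

/-! ### Small instances -/

variable {aux : TM2ComputableAux Bool Bool}

open Frag

namespace Frag

/-- Branch on a register being nonempty. -/
def ifNE (r : Reg) (p q : Prog aux) : Prog aux := .ite (.inr r) Option.isSome p q

/-- Put a list of bits on top of a register. -/
def pushBits (r : Reg) : List Bool → Prog aux
  | [] => skip
  | b :: l => (pushBits r l).seq (pushB r b)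

/-- Having read the bits `pre` of the input, read up to `L` further ones. If the input is exhausted
before that, answer with the help of the table `f`; otherwise restore the input and run `p`. -/
def readTable (f : List Bool → List Bool) (p : Prog aux) : ℕ → List Bool → Prog aux
  | 0, pre => (pushBits .inp pre).seq p
  | L + 1, pre => ifNE .inp
      (ifTop .inp ((popB .inp).seq (readTable f p L (pre ++ [true])))
        ((popB .inp).seq (readTable f p L (pre ++ [false]))))
      (pushBits .best (f pre))

end Frag

section Table

variable {u u' : Ctr → ℕ} {w w' : Reg → List Bool} {p q : Prog aux} {t : ℕ}

theorem exec_ifNE_cons {r : Reg} {b : Bool} {l : List Bool} (hr : w r = b :: l)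
    (h : Exec p u w u' w' t) : Exec (ifNE r p q) u w u' w' (t + 1) :=
  Runs.ite_true (by simp [stk, hr]) h

theorem exec_ifNE_nil {r : Reg} (hr : w r = []) (h : Exec q u w u' w' t) :
    Exec (ifNE r p q) u w u' w' (t + 1) :=
  Runs.ite_false (by simp [stk, hr]) h

theorem exec_pushBits (r : Reg) (l : List Bool) :
    Exec (aux := aux) (pushBits r l) u w u (update w r (l ++ w r)) (l.length + 1) := by
  induction l with
  | nil => exact Exec.skip.of_eq rfl (by simp) (by simp)
  | cons b l ih =>
    refine (ih.seq (exec_pushB r b)).of_eq rfl (by simp) (by simp)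

variable {f : List Bool → List Bool}

theorem exec_readTable_step {L : ℕ} {pre l : List Bool} {b : Bool}
    (h : Exec (readTable f p L (pre ++ [b])) u (wst l []) u' w' t) :
    Exec (readTable f p (L + 1) pre) u (wst (b :: l) []) u' w' (t + 3) := by
  have hp : update (wst (b :: l) []) Reg.inp (wst (b :: l) [] Reg.inp).tail = wst l [] := by
    funext z
    cases z <;> simp [wst]
  refine exec_ifNE_cons (b := b) (l := l) rfl (Exec.mono (t := 1 + t + 1) ?_ (by omega))
  cases b with
  | true => exact exec_ifTop_true (l := l) rfl (((exec_popB _).of_eq rfl hp le_rfl).seq h)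
  | false => exact exec_ifTop_false rfl (((exec_popB _).of_eq rfl hp le_rfl).seq h)

theorem exec_readTable_of_lt {L : ℕ} {pre l : List Bool} (h : l.length < L) :
    Exec (readTable f p L pre) u (wst l []) u (wst [] (f (pre ++ l)))
      (3 * l.length + (f (pre ++ l)).length + 2) := by
  induction L generalizing pre l with
  | zero => omega
  | succ L ih =>
    cases l with
    | nil =>
      refine (exec_ifNE_nil (q := pushBits .best (f pre)) rfl (exec_pushBits _ _)).of_eq rfl ?_ ?_
      · funext z
        cases z <;> simp [wst]
      · simp
    | cons b l =>
      have := ih (pre := pre ++ [b]) (l := l) (by simpa using h)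
      rw [List.append_assoc, List.singleton_append] at this
      exact (exec_readTable_step this).mono (by simp only [List.length_cons]; omega)

/-- The bits read so far are remembered by the position in the program, not on a stack, so they can
be pushed back before `p` starts. -/
theorem exec_readTable_of_le {L : ℕ} {pre l : List Bool} (h : L ≤ l.length)
    (hp : Exec p u (wst (pre ++ l) []) u' w' t) :
    Exec (readTable f p L pre) u (wst l []) u' w' (4 * L + pre.length + 1 + t) := by
  induction L generalizing pre l with
  | zero =>
    have h1 : update (wst l []) Reg.inp (pre ++ wst l [] Reg.inp) = wst (pre ++ l) [] := by
      funext z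
      cases z <;> simp [wst]
    exact (((exec_pushBits _ _).of_eq rfl h1 le_rfl).seq hp).mono (by omega)
  | succ L ih =>
    cases l with
    | nil => simp at h
    | cons b l =>
      have := ih (pre := pre ++ [b]) (l := l) (by simpa using h)
        (by rwa [List.append_assoc, List.singleton_append])
      refine (exec_readTable_step this).mono ?_
      simp only [List.length_append, List.length_singleton]
      omega

end Table

end StackProg

namespace SetCoverInstance

theorem length_encode (I : SetCoverInstance) :
    I.encode.length = I.h + I.η + 2 + I.h * I.η := by
  rw [encode_eq]
  simp [length_matrix]
  ring

theorem replicate_append_cons_inj {a b : ℕ} {X Y : List Bool}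
    (h : List.replicate a true ++ false :: X = List.replicate b true ++ false :: Y) :
    a = b ∧ X = Y := by
  induction a generalizing b with
  | zero =>
    cases b with
    | zero => simpa using h
    | succ b => simp [List.replicate_succ] at h
  | succ a ih =>
    cases b with
    | zero => simp [List.replicate_succ] at h
    | succ b =>
      rw [List.replicate_succ, List.replicate_succ] at h
      obtain ⟨h1, h2⟩ := ih (List.cons.inj h).2
      exact ⟨by omega, h2⟩

/-- The two unary numbers are self-delimiting and determine how the matrix is read. Consequently a
table indexed by bit strings can store an answer for each instance. -/
theorem encode_injective : Injective SetCoverInstance.encode := by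
  intro I J h
  rw [encode_eq, encode_eq] at h
  simp only [List.append_assoc, List.singleton_append] at h
  obtain ⟨h1, h⟩ := replicate_append_cons_inj h
  obtain ⟨h2, h⟩ := replicate_append_cons_inj h
  have hI := I.getD_matrix
  have hJ := J.getD_matrix
  rw [h] at hI
  obtain ⟨η, k, s, d, c⟩ := I
  obtain ⟨η', k', s', d', c'⟩ := J
  simp only at h1 h2
  subst h1 h2
  congr 1
  funext j
  ext i
  have := (hI j i).symm.trans (hJ j i)
  simpa using this

/-- Without items, distinctness allows only one set, the empty one, and then `h + η ≤ 1`. With an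
item, some set must contain it. -/
theorem pos_of_two_le (I : SetCoverInstance) (h : 2 ≤ I.h + I.η) : 0 < I.h ∧ 0 < I.η := by
  have h1 : 0 < I.η := by
    by_contra h0
    have h0 : I.η = 0 := by omega
    have : IsEmpty (Fin I.η) := by rw [h0]; infer_instance
    have := Fintype.card_le_of_injective _ I.distinct
    rw [Fintype.card_fin, Fintype.card_finset, Fintype.card_fin, h0] at this
    omega
  obtain ⟨j, -⟩ := I.covered ⟨0, h1⟩
  exact ⟨j.pos, h1⟩

theorem _root_.Finset.exists_min_card {ι : Type*} {P : Finset ι → Prop} (h : ∃ C, P C) :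
    ∃ C, P C ∧ ∀ S, P S → C.card ≤ S.card := by
  classical
  have h' : ∃ n, ∃ C, P C ∧ C.card = n := h.imp' Finset.card fun C hC => ⟨C, hC, rfl⟩
  obtain ⟨C, hC, hn⟩ := Nat.find_spec h'
  exact ⟨C, hC, fun S hS => hn.trans_le (Nat.find_min' h' ⟨S, hS, rfl⟩)⟩

theorem exists_optimal (I : SetCoverInstance) : ∃ C : Finset (Fin I.h), setCover.Feasible I C ∧
    ∀ S : Finset (Fin I.h), setCover.Feasible I S → C.card ≤ S.card := by
  refine Finset.exists_min_card (P := fun C : Finset (Fin I.h) => setCover.Feasible I C)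
    ⟨Finset.univ, fun i => ?_⟩
  obtain ⟨j, hj⟩ := I.covered i
  exact ⟨j, Finset.mem_univ _, hj⟩

/-- An optimal solution. -/
noncomputable def optimal (I : SetCoverInstance) : Finset (Fin I.h) := I.exists_optimal.choose

theorem feasible_optimal (I : SetCoverInstance) : setCover.Feasible I I.optimal :=
  I.exists_optimal.choose_spec.1

theorem card_optimal_le (I : SetCoverInstance) {S : Finset (Fin I.h)}
    (hS : setCover.Feasible I S) : I.optimal.card ≤ S.card :=
  I.exists_optimal.choose_spec.2 S hS

open Classical in
/-- The optimal solution, as a function of the encoding. -/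
noncomputable def optimalBits (l : List Bool) : List Bool :=
  if h : ∃ I : SetCoverInstance, I.encode = l then indicator h.choose.optimal else []

theorem optimalBits_encode (I : SetCoverInstance) :
    optimalBits I.encode = indicator I.optimal := by
  have h : ∃ J : SetCoverInstance, J.encode = I.encode := ⟨I, rfl⟩
  rw [optimalBits, dif_pos h]
  exact congrArg (fun J : SetCoverInstance => indicator J.optimal)
    (encode_injective h.choose_spec)

/-- The algorithm: instances with short encodings are solved optimally, the others by the search. -/
noncomputable def approx (A : (G : ConnectedGraph) → Finset (Fin G.n)) (D : ℕ) (hD : 0 < D) (L : ℕ)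
    (I : SetCoverInstance) : Finset (Fin I.h) :=
  if I.encode.length ≤ L then I.optimal
  else if h : 0 < I.h ∧ 0 < I.η then StackProg.searchResult A D hD I h.1 h.2 else ∅

end SetCoverInstance

namespace StackProg

section Approx

variable {A : (G : ConnectedGraph) → Finset (Fin G.n)} {aux : TM2ComputableAux Bool Bool}
  {P : Polynomial ℕ} {D : ℕ} {L : ℕ}

theorem exec_approx
    (hA : ∀ G : ConnectedGraph, Outputs aux G.encode (indicator (A G)) (P.eval G.encode.length))
    (hD : 0 < D) (hL : ∀ I : SetCoverInstance, L < I.encode.length → 0 < I.h ∧ 0 < I.η)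
    (I : SetCoverInstance) :
    Exec (aux := aux) (Frag.readTable SetCoverInstance.optimalBits (Frag.solve D) (L + 1) [])
      (fun _ => 0) (wst I.encode []) (fun _ => 0)
      (wst [] (indicator (SetCoverInstance.approx A D hD L I)))
      ((4 * I.encode.length + 2) +
        ((4 * (L + 1) + 1) + solveTime P D (D * I.encode.length))) := by
  have hlen := I.length_encode
  by_cases hI : I.encode.length ≤ L
  · have := exec_readTable_of_lt (u := fun _ => 0) (p := (Frag.solve D : Prog aux))
      (f := SetCoverInstance.optimalBits) (L := L + 1) (pre := []) (l := I.encode) (by omega)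
    rw [List.nil_append, SetCoverInstance.optimalBits_encode, length_indicator] at this
    rw [SetCoverInstance.approx, if_pos hI]
    exact this.mono (by omega)
  · have hpos := hL I (by omega)
    have := exec_readTable_of_le (f := SetCoverInstance.optimalBits) (L := L + 1) (pre := [])
      (l := I.encode) (by omega)
      (exec_solve (aux := aux) (I := I) (hh := hpos.1) (hη := hpos.2) hD hA)
    rw [SetCoverInstance.approx, if_neg hI, dif_pos hpos]
    refine this.mono ?_
    have := (isPoly_solveTime P D).mono
      (Nat.mul_le_mul_left D (show I.h + I.η ≤ I.encode.length by omega))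
    simp only [List.length_nil]
    omega

theorem nonempty_polyTime_approx
    (hA : ∀ G : ConnectedGraph, Outputs aux G.encode (indicator (A G)) (P.eval G.encode.length))
    (hD : 0 < D) (hL : ∀ I : SetCoverInstance, L < I.encode.length → 0 < I.h ∧ 0 < I.η) :
    Nonempty (TM2ComputableInPolyTime setCover.encode (id : List Bool → List Bool)
      (fun I => indicator (SetCoverInstance.approx A D hD L I))) := by
  have hpoly : IsPolyNat fun x => (4 * x + 2) + ((4 * (L + 1) + 1) + solveTime P D (D * x)) :=
    (((IsPolyNat.const 4).mul .id).add (.const 2)).add ((IsPolyNat.const _).add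
      ((isPoly_solveTime P D).comp ((IsPolyNat.const D).mul .id)))
  obtain ⟨T, hT⟩ := hpoly
  refine nonempty_polyTime_of_runs
    (Frag.readTable SetCoverInstance.optimalBits (Frag.solve D) (L + 1) [] : Prog aux)
    (.inr .inp) (.inr .best) _ _ T fun I => ?_
  have hs : ∀ (x : Reg) (l : List Bool), update (fun _ => []) (Sum.inr x : Ctr ⊕ Reg) l =
      stk (fun _ => 0) (update (fun _ => []) x l) := by
    intro x l
    rw [← update_stk_inr]
    congr 1
    funext z
    cases z <;> rfl
  have h1 : ∀ l, update (fun _ => []) Reg.inp l = wst l [] := by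
    intro l
    funext z
    cases z <;> rfl
  have h2 : ∀ l, update (fun _ => []) Reg.best l = wst [] l := by
    intro l
    funext z
    cases z <;> rfl
  rw [hs, hs, ← hT, h1, h2]
  exact exec_approx hA hD hL I

end Approx

end StackProg

/-! ### The approximation guarantee -/

theorem card_searchResult_le_mul {α ε : ℝ} {A : (G : ConnectedGraph) → Finset (Fin G.n)}
    (hA : ∀ G : ConnectedGraph, IsMEGSet G.graph (A G) ∧
      ∀ S : Finset (Fin G.n), IsMEGSet G.graph S →
        ((A G).card : ℝ) ≤ max 1 (α * Real.log (G.n : ℝ)) * (S.card : ℝ))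
    {D : ℕ} (hD : 2 ≤ D) {I : SetCoverInstance} (hh : 0 < I.h) (hη : 0 < I.η)
    (hpar : (I.h : ℝ) ≤ (2 * α + ε) * Real.log ((I.h + I.η : ℕ) : ℝ) * (I.optimal.card : ℝ) ∨
      ∃ κ r : ℕ, κ < I.h + I.η ∧ r < I.h + I.η ∧
        (2 * α + ε) * Real.log ((I.h + I.η : ℕ) : ℝ) * (I.optimal.card : ℝ) < ((r + 1 : ℕ) : ℝ) ∧
        ∀ k₁ k₂ l : ℕ, k₁ = D * (κ + 1) → k₂ = D * (I.h + I.η) →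
          l = 2 * (I.h * k₁) + (r + 1) * k₂ + k₂ + I.η * (r + 1) + 1 →
          max 1 (α * Real.log ((k₁ * (k₂ * (I.h + (r + 1))) + 2 * l : ℕ) : ℝ)) *
            ((k₁ * k₂ * I.optimal.card + l : ℕ) : ℝ) ≤
          (k₁ : ℝ) * k₂ * ((2 * α + ε) * Real.log ((I.h + I.η : ℕ) : ℝ) * (I.optimal.card : ℝ))) :
    ((StackProg.searchResult A D (by omega) I hh hη).card : ℝ) ≤
      (2 * α + ε) * Real.log ((I.h + I.η : ℕ) : ℝ) * (I.optimal.card : ℝ) := by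
  obtain h | ⟨κ, r, hκ, hr, hlt, hpar⟩ := hpar
  · exact (Nat.cast_le.2 StackProg.card_searchResult_le).trans h
  · have h₁ : 2 ≤ D * (κ + 1) := by nlinarith
    have h₂ : 2 ≤ D * (I.h + I.η) := by nlinarith
    have hpar := hpar _ _ _ rfl rfl rfl
    -- In the round with the right parameters, `l` and the argument of the logarithm are the actual
    -- numbers of leaves and vertices.
    rw [← SetCoverInstance.leaves, ← I.length_verts] at hpar
    have hM := (hA (I.toGraph (D * (κ + 1)) (D * (I.h + I.η)) (r + 1) hh hη (by omega) (by omega)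
      r.succ_pos)).2
    have hρ : 0 ≤ max 1 (α * Real.log
        ((I.verts (D * (κ + 1)) (D * (I.h + I.η)) (r + 1)).length : ℝ)) :=
      zero_le_one.trans (le_max_left _ _)
    obtain ⟨p, q, hgood, hcard⟩ := SetCoverInstance.exists_small_copySet hh hη h₁ h₂ r.succ_pos
      hM hρ I.feasible_optimal hlt hpar
    exact (Nat.cast_le.2 (StackProg.card_searchResult_le_copySet hκ hr hgood)).trans hcard

theorem approx_spec {α ε : ℝ} {A : (G : ConnectedGraph) → Finset (Fin G.n)}
    (hA : ∀ G : ConnectedGraph, IsMEGSet G.graph (A G) ∧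
      ∀ S : Finset (Fin G.n), IsMEGSet G.graph S →
        ((A G).card : ℝ) ≤ max 1 (α * Real.log (G.n : ℝ)) * (S.card : ℝ))
    {D L N₀ : ℕ} (hD : 2 ≤ D) (hL : ∀ I : SetCoverInstance, L < I.encode.length →
      N₀ ≤ I.h + I.η ∧ 0 < I.h ∧ 0 < I.η)
    (hpar : ∀ h η c : ℕ, N₀ ≤ h + η → 1 ≤ c →
      1 ≤ (2 * α + ε) * Real.log ((h + η : ℕ) : ℝ) ∧
      ((h : ℝ) ≤ (2 * α + ε) * Real.log ((h + η : ℕ) : ℝ) * c ∨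
      ∃ κ r : ℕ, κ < h + η ∧ r < h + η ∧
        (2 * α + ε) * Real.log ((h + η : ℕ) : ℝ) * c < (r + 1 : ℕ) ∧
        ∀ k₁ k₂ l : ℕ, k₁ = D * (κ + 1) → k₂ = D * (h + η) →
          l = 2 * (h * k₁) + (r + 1) * k₂ + k₂ + η * (r + 1) + 1 →
          max 1 (α * Real.log ((k₁ * (k₂ * (h + (r + 1))) + 2 * l : ℕ) : ℝ)) *
            ((k₁ * k₂ * c + l : ℕ) : ℝ) ≤
          k₁ * k₂ * ((2 * α + ε) * Real.log ((h + η : ℕ) : ℝ) * c)))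
    (I : SetCoverInstance) :
    setCover.Feasible I (SetCoverInstance.approx A D (by omega) L I) ∧
      ∀ S : Finset (Fin I.h), setCover.Feasible I S →
        ((SetCoverInstance.approx A D (by omega) L I).card : ℝ) ≤
          max 1 ((2 * α + ε) * Real.log ((I.h + I.η : ℕ) : ℝ)) * (S.card : ℝ) := by
  unfold SetCoverInstance.approx
  split_ifs with h1 h2
  · refine ⟨I.feasible_optimal, fun S hS => ?_⟩
    have h3 : (I.optimal.card : ℝ) ≤ S.card := by exact_mod_cast I.card_optimal_le hS
    exact h3.trans (le_mul_of_one_le_left (Nat.cast_nonneg _) (le_max_left _ _))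
  · refine ⟨StackProg.feasible_searchResult (fun G => (hA G).1) hD, fun S hS => ?_⟩
    have hc : 1 ≤ I.optimal.card := by
      obtain ⟨j, hj, -⟩ := I.feasible_optimal ⟨0, h2.2⟩
      exact Finset.card_pos.2 ⟨j, hj⟩
    have h3 : (I.optimal.card : ℝ) ≤ S.card := by exact_mod_cast I.card_optimal_le hS
    have h4 := hpar I.h I.η I.optimal.card (hL I (by omega)).1 hc
    refine (card_searchResult_le_mul hA hD h2.1 h2.2 h4.2).trans ?_
    exact mul_le_mul (le_max_right _ _) h3 (Nat.cast_nonneg _) (zero_le_one.trans (le_max_left _ _))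
  · exact absurd (hL I (by omega)).2 h2

theorem mainTheorem2 (α ε : ℝ) (hα : 0 < α) (hε : 0 < ε)
    (hMEG : HasPolyTimeApprox minMEGSet (fun n => α * Real.log (n : ℝ))) :
    HasPolyTimeApprox setCover (fun N => (2 * α + ε) * Real.log (N : ℝ)) := by

  obtain ⟨A, ⟨M⟩, hA⟩ := hMEG
  obtain ⟨D, N₀, hD, hN₀, hpar⟩ := exists_good_parameters α ε hα hε
  -- An encoding has length `h + η + 2 + h * η`, which for `h + η < N₀` stays below this threshold;
  -- so only instances of size at least `N₀` reach the search.
  have hsize : ∀ I : SetCoverInstance, N₀ + N₀ + 2 + N₀ * N₀ < I.encode.length →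
      N₀ ≤ I.h + I.η := by
    intro I hI
    by_contra hlt
    rw [I.length_encode] at hI
    have : I.h * I.η ≤ N₀ * N₀ := Nat.mul_le_mul (by omega) (by omega)
    omega
  have hL : ∀ I : SetCoverInstance, N₀ + N₀ + 2 + N₀ * N₀ < I.encode.length →
      N₀ ≤ I.h + I.η ∧ 0 < I.h ∧ 0 < I.η := fun I hI =>
    ⟨hsize I hI, I.pos_of_two_le (hN₀.trans (hsize I hI))⟩
  exact ⟨SetCoverInstance.approx A D (by omega) (N₀ + N₀ + 2 + N₀ * N₀),
    StackProg.nonempty_polyTime_approx (aux := M.toTM2ComputableAux) (P := M.time)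
      (fun G => ⟨M.outputsFun G⟩) (by omega) fun I hI => (hL I hI).2,
    approx_spec hA hD hL hpar⟩

end
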